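/- Let $(M,g)$ be a smooth $n$-dimensional Riemannian manifold with cotangent bundle $\pi:T^*M\to M$. A local chart $(U;x^1,\dots,x^n)$ of $M$ induces the chart $(\pi^{-1}(U);q^1,\dots,q^n,p_1,\dots,p_n)$ of $T^*M$, where $q^i=x^i\circ\pi$ and $p=p_i\,dx^i_{\pi(p)}$. The summation convention is used. Let $g_{ij}$ be the components of $g$, $(g^{ij})$ the inverse matrix, $\Gamma^k_{ij}$ the Christoffel symbols of the Levi-Civita connection $\dot\nabla$ of $g$, and $R^h_{kij}$ the components of its curvature tensor, $R(\partial_{x^i},\partial_{x^j})\partial_{x^k}=R^h_{kij}\partial_{x^h}$ with $R(X,Y)=\dot\nabla_X\dot\nabla_Y-\dot\nabla_Y\dot\nabla_X-\dot\nabla_{[X,Y]}$. Put $$g^{0i}=p_hg^{hi},\quad t=\tfrac12 g^{ik}p_ip_k,\quad \Gamma^0_{ij}=p_k\Gamma^k_{ij},\quad R^0_{kij}=p_hR^h_{kij},\quad Dp_i=dp_i-\Gamma^0_{ij}dq^j,$$ $$\partial^i=\frac{\partial}{\partial p_i},\qquad \delta_i=\frac{\partial}{\partial q^i}+\Gamma^0_{ih}\frac{\partial}{\partial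 p_h}.$$ Let $c_1,c_2,d_1,d_2$ be smooth real functions of $t\in[0,\infty)$ with $c_1>0$, $c_2>0$, $c_1+2td_1>0$, $c_2+2td_2>0$ for all $t\ge 0$, and let $$G^{(1)}_{ij}=c_1g_{ij}+d_1p_ip_j,\qquad G_{(2)}^{ij}=c_2g^{ij}+d_2g^{0i}g^{0j},$$ $$H_{(1)}^{jk}=\frac1{c_1}g^{jk}-\frac{d_1}{c_1(c_1+2td_1)}g^{0j}g^{0k},\qquad H^{(2)}_{jk}=\frac1{c_2}g_{jk}-\frac{d_2}{c_2(c_2+2td_2)}p_jp_k,$$ so that $H_{(1)}$ and $H^{(2)}$ are the inverses of $G^{(1)}$ and $G_{(2)}$. Let $G$ be the Riemannian metric on $T^*M$ given in every induced chart by $$G=G^{(1)}_{ij}\,dq^idq^j+G_{(2)}^{ij}\,Dp_iDp_j .$$ **Theorem 8.** The Levi-Civita connection $\nabla$ of $G$ has, in the frame $(\partial^1,\dots,\partial^n,\delta_1,\dots,\delta_n)$ of every induced chart, the expression $$\nabla_{\partial^i}\partial^j=Q^{ij}_h\partial^h,\qquad \nabla_{\delta_i}\partial^j=-\Gamma^j_{ih}\partial^h+P^{hj}_i\delta_h,$$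 $$\nabla_{\partial^i}\delta_j=P^{hi}_j\delta_h,\qquad \nabla_{\delta_i}\delta_j=\Gamma^h_{ij}\delta_h+S_{hij}\partial^h,$$ where $$Q^{ij}_h=\tfrac12H^{(2)}_{hk}\bigl(\partial^iG_{(2)}^{jk}+\partial^jG_{(2)}^{ik}-\partial^kG_{(2)}^{ij}\bigr),$$ $$P^{hi}_j=\tfrac12H_{(1)}^{hk}\bigl(\partial^iG^{(1)}_{jk}-G_{(2)}^{il}R^0_{ljk}\bigr),$$ $$S_{hij}=-\tfrac12H^{(2)}_{hk}\,\partial^kG^{(1)}_{ij}+\tfrac12R^0_{hij}$$ are $M$-tensor fields on $T^*M$, that is, their components are smooth functions on $\pi^{-1}(U)$ which under a change of charts of $M$ transform like the components of a tensor field on $M$ of type $(2,1)$, $(2,1)$ and $(0,3)$, respectively. Moreover, if $(M,g)$ has constant sectional curvature $c$, then, with $'$ denoting the derivative with respect to $t$, $$Q^{ij}_h=-\frac{c_2'-2d_2}{2(c_2+2d_2t)}g^{ij}p_h+\frac{c_2'}{2c_2}(\delta^j_hg^{0i}+\delta^i_hg^{0j})+\frac{-2c_2'd_2+c_2d_2'}{2c_2(c_2+2d_2t)}p_hg^{0i}g^{0j},$$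 $$P^{hi}_j=-\frac{cc_2-d_1}{2c_1}g^{hi}p_j+\frac{cc_2+d_1}{2(c_1+2d_1t)}\delta^i_jg^{0h}+\frac{c_1'}{2c_1}\delta^h_jg^{0i}+\frac{-c_1'd_1+cc_2d_1-d_1^2+c_1d_1'}{2c_1(c_1+2d_1t)}p_jg^{0h}g^{0i},$$ $$S_{hij}=\frac{-c_1'}{2(c_2+2d_2t)}g_{ij}p_h+\frac{cc_2-d_1}{2c_2}g_{hj}p_i-\frac{cc_2+d_1}{2c_2}g_{hi}p_j-\frac{c_2d_1'-2d_1d_2}{2c_2(c_2+2d_2t)}p_hp_ip_j .$$ -/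

import Mathlib

open Bundle Set
open scoped Manifold ContDiff Topology Bundle

noncomputable section

namespace CotangentLift

/-! ### Levi-Civita connections -/

section LeviCivita

variable {E : Type*} [NormedAddCommGroup E] [NormedSpace ℝ E] [FiniteDimensional ℝ E]
  [CompleteSpace E] {H : Type*} [TopologicalSpace H] {I : ModelWithCorners ℝ E H}
  {N : Type*} [TopologicalSpace N] [ChartedSpace H N] [IsManifold I 2 N]

/-- The covariant derivative `cov` on the tangent bundle of `N` is a Levi-Civita connection of the
field of bilinear forms `G`: its torsion vanishes and `G` is parallel, that is
`X (G (Y, Z)) = G (∇_X Y, Z) + G (Y, ∇_X Z)`.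
In Mathlib's argument order `cov Y x (X x)` is `(∇_X Y)(x)`. -/
def IsLeviCivita (G : (x : N) → TangentSpace I x → TangentSpace I x → ℝ)
    (cov : CovariantDerivative I E (TangentSpace I : N → Type _)) : Prop :=
  cov.torsion = 0 ∧
    ∀ (x : N) (X : TangentSpace I x) (Y Z : (y : N) → TangentSpace I y),
      MDifferentiableAt I I.tangent (fun y ↦ (⟨y, Y y⟩ : TangentBundle I N)) x →
      MDifferentiableAt I I.tangent (fun y ↦ (⟨y, Z y⟩ : TangentBundle I N)) x →
      mvfderiv I (fun y ↦ G y (Y y) (Z y)) x X = G x (cov Y x X) (Z x) + G x (Y x) (cov Z x X)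

end LeviCivita

variable {n : ℕ} {M : Type*} [TopologicalSpace M] [ChartedSpace (EuclideanSpace ℝ (Fin n)) M]

/-! ### The base manifold in a local chart `φ = (x¹, …, xⁿ)` -/

/-- The standard basis vector `e_i` of `ℝⁿ`. -/
abbrev stdVec (i : Fin n) : EuclideanSpace ℝ (Fin n) := EuclideanSpace.single i (1 : ℝ)

/-- The `i`-th partial derivative at `y` of a function on `ℝⁿ`. -/
def pderiv (f : EuclideanSpace ℝ (Fin n) → ℝ) (i : Fin n) (y : EuclideanSpace ℝ (Fin n)) : ℝ :=
  fderiv ℝ f y (stdVec i)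

/-- The coordinate vector `∂/∂xⁱ` at a point `x` of the domain of the chart `φ`. -/
def coordVec (φ : OpenPartialHomeomorph M (EuclideanSpace ℝ (Fin n))) (i : Fin n) (x : M) :
    TangentSpace (𝓡 n) x :=
  (mfderiv (𝓡 n) (𝓡 n) φ x).inverse (stdVec i)

section Base

variable [IsManifold (𝓡 n) ∞ M]
  (g : ContMDiffRiemannianMetric (𝓡 n) ∞ (EuclideanSpace ℝ (Fin n))
    (fun x : M ↦ TangentSpace (𝓡 n) x))
  (φ : OpenPartialHomeomorph M (EuclideanSpace ℝ (Fin n)))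

/-- The components `g_{ij}` of the metric, as functions on the range of the chart. -/
def metricCoeff (y : EuclideanSpace ℝ (Fin n)) : Matrix (Fin n) (Fin n) ℝ :=
  Matrix.of fun i j ↦
    g.inner (φ.symm y) (coordVec φ i (φ.symm y)) (coordVec φ j (φ.symm y))

/-- The Christoffel symbols `Γ^k_{ij}` of the Levi-Civita connection of `g`. -/
def christoffel (k i j : Fin n) (y : EuclideanSpace ℝ (Fin n)) : ℝ :=
  1 / 2 * ∑ l, (metricCoeff g φ y)⁻¹ k l *
    (pderiv (fun z ↦ metricCoeff g φ z j l) i y + pderiv (fun z ↦ metricCoeff g φ z i l) j y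
      - pderiv (fun z ↦ metricCoeff g φ z i j) l y)

/-- The components `R^h_{kij}` of the curvature tensor of `g`: `R(∂_i, ∂_j) ∂_k = R^h_{kij} ∂_h`,
where `R(X, Y) = ∇_X ∇_Y - ∇_Y ∇_X - ∇_{[X, Y]}`. -/
def curvature (h k i j : Fin n) (y : EuclideanSpace ℝ (Fin n)) : ℝ :=
  pderiv (christoffel g φ h j k) i y - pderiv (christoffel g φ h i k) j y
    + ∑ l, (christoffel g φ h i l y * christoffel g φ l j k y
      - christoffel g φ h j l y * christoffel g φ l i k y)

/-- The scalar product, at the point with coordinates `y`, of the tangent vectors `uⁱ ∂_i` and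
`vʲ ∂_j`. -/
def innerCoord (y : EuclideanSpace ℝ (Fin n)) (u v : Fin n → ℝ) : ℝ :=
  ∑ i, ∑ j, metricCoeff g φ y i j * u i * v j

/-- The sectional curvature `g(R(u, v)v, u) / (g(u, u) g(v, v) - g(u, v)²)` of the plane spanned by
the independent tangent vectors `u = uⁱ ∂_i` and `v = vʲ ∂_j`. -/
def sectionalCurvature (y : EuclideanSpace ℝ (Fin n)) (u v : Fin n → ℝ) : ℝ :=
  innerCoord g φ y (fun h ↦ ∑ i, ∑ j, ∑ k, curvature g φ h k i j y * u i * v j * v k) u /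
    (innerCoord g φ y u u * innerCoord g φ y v v - innerCoord g φ y u v ^ 2)

/-- `(M, g)` has constant sectional curvature `c`. -/
def HasConstantSectionalCurvature (c : ℝ) : Prop :=
  ∀ φ ∈ IsManifold.maximalAtlas (𝓡 n) ∞ M, ∀ y ∈ φ.target, ∀ u v : Fin n → ℝ,
    LinearIndependent ℝ ![u, v] → sectionalCurvature g φ y u v = c

end Base

/-! ### The cotangent bundle and its induced charts `(q¹, …, qⁿ, p_1, …, p_n)` -/

variable (n M) in
/-- The cotangent bundle of `M`, with the topology and the manifold structure that Mathlib gives to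
the bundle of continuous linear maps from the tangent bundle to the trivial line bundle. -/
abbrev CotangentBundle [IsManifold (𝓡 n) ∞ M] : Type _ :=
  TotalSpace (EuclideanSpace ℝ (Fin n) →L[ℝ] ℝ)
    (fun x : M ↦ TangentSpace (𝓡 n) x →L[ℝ] Bundle.Trivial M ℝ x)

variable (n) in
/-- The model space of the cotangent bundle. -/
abbrev CotangentModel : Type :=
  EuclideanSpace ℝ (Fin n) × (EuclideanSpace ℝ (Fin n) →L[ℝ] ℝ)

variable (n) in
/-- The model with corners of the cotangent bundle. -/
abbrev cotangentModel :
    ModelWithCorners ℝ (CotangentModel n)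
      (ModelProd (EuclideanSpace ℝ (Fin n)) (EuclideanSpace ℝ (Fin n) →L[ℝ] ℝ)) :=
  (𝓡 n).prod 𝓘(ℝ, EuclideanSpace ℝ (Fin n) →L[ℝ] ℝ)

variable [IsManifold (𝓡 n) ∞ M]

/-- The fibre coordinates `p_i` of a covector `p = p_i dxⁱ`. -/
def mom (φ : OpenPartialHomeomorph M (EuclideanSpace ℝ (Fin n))) (p : CotangentBundle n M)
    (i : Fin n) : ℝ :=
  p.2 (coordVec φ i p.proj)

/-- The chart `p ↦ (q¹, …, qⁿ, p_1, …, p_n)` of the cotangent bundle induced by the chart `φ`. -/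
def inducedChart (φ : OpenPartialHomeomorph M (EuclideanSpace ℝ (Fin n)))
    (p : CotangentBundle n M) : EuclideanSpace ℝ (Fin n) × EuclideanSpace ℝ (Fin n) :=
  (φ p.proj, WithLp.toLp 2 (mom φ p))

/-- The differential at `p` of the induced chart. -/
def inducedDiff (φ : OpenPartialHomeomorph M (EuclideanSpace ℝ (Fin n)))
    (p : CotangentBundle n M) :
    TangentSpace (cotangentModel n) p →L[ℝ]
      EuclideanSpace ℝ (Fin n) × EuclideanSpace ℝ (Fin n) :=
  mfderiv (cotangentModel n) 𝓘(ℝ, EuclideanSpace ℝ (Fin n) × EuclideanSpace ℝ (Fin n))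
    (inducedChart φ) p

/-- The coordinate vector field `∂/∂qⁱ`. -/
def dQ (φ : OpenPartialHomeomorph M (EuclideanSpace ℝ (Fin n))) (i : Fin n)
    (p : CotangentBundle n M) : TangentSpace (cotangentModel n) p :=
  (inducedDiff φ p).inverse (stdVec i, 0)

/-- The coordinate vector field `∂ⁱ = ∂/∂p_i`. -/
def dP (φ : OpenPartialHomeomorph M (EuclideanSpace ℝ (Fin n))) (i : Fin n)
    (p : CotangentBundle n M) : TangentSpace (cotangentModel n) p :=
  (inducedDiff φ p).inverse (0, stdVec i)

/-- The derivative `∂ⁱ f` at `p` of a function on the cotangent bundle. -/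
def pDeriv (φ : OpenPartialHomeomorph M (EuclideanSpace ℝ (Fin n)))
    (f : CotangentBundle n M → ℝ) (i : Fin n) (p : CotangentBundle n M) : ℝ :=
  mvfderiv (cotangentModel n) f p (dP φ i p)

/-- The Jacobian entry `∂yⁱ/∂xᵃ` at `x` of the change from the chart `φ = (xᵃ)` to the chart
`ψ = (yⁱ)`. -/
def jacobian (φ ψ : OpenPartialHomeomorph M (EuclideanSpace ℝ (Fin n))) (x : M)
    (i a : Fin n) : ℝ :=
  pderiv (fun z ↦ ψ (φ.symm z) i) a (φ x)

/-- A family `T` of components, assigned to the charts of `M` (and so to the induced charts of the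
cotangent bundle), with `r` upper and `s` lower indices, is an `M`-tensor field of type `(r, s)`:
the components are smooth functions on the domain of the induced chart, and under a change of charts
they transform like the components of a tensor field of type `(r, s)` on `M`. -/
def IsMTensor (r s : ℕ)
    (T : OpenPartialHomeomorph M (EuclideanSpace ℝ (Fin n)) → CotangentBundle n M →
      (Fin r → Fin n) → (Fin s → Fin n) → ℝ) : Prop :=
  (∀ φ ∈ IsManifold.maximalAtlas (𝓡 n) ∞ M, ∀ up lo,
    ContMDiffOn (cotangentModel n) 𝓘(ℝ, ℝ) ∞ (fun p ↦ T φ p up lo)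
      {p | p.proj ∈ φ.source}) ∧
  ∀ φ ∈ IsManifold.maximalAtlas (𝓡 n) ∞ M, ∀ ψ ∈ IsManifold.maximalAtlas (𝓡 n) ∞ M,
    ∀ p : CotangentBundle n M, p.proj ∈ φ.source → p.proj ∈ ψ.source → ∀ up lo,
      T ψ p up lo = ∑ a : Fin r → Fin n, ∑ b : Fin s → Fin n,
        (∏ k, jacobian φ ψ p.proj (up k) (a k)) * (∏ k, jacobian ψ φ p.proj (b k) (lo k))
          * T φ p a b

section Lift

variable (g : ContMDiffRiemannianMetric (𝓡 n) ∞ (EuclideanSpace ℝ (Fin n))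
    (fun x : M ↦ TangentSpace (𝓡 n) x))
  (φ : OpenPartialHomeomorph M (EuclideanSpace ℝ (Fin n)))

/-- `g_{ij}` at the base point of `p`. -/
def gLow (p : CotangentBundle n M) (i j : Fin n) : ℝ := metricCoeff g φ (φ p.proj) i j

/-- `g^{ij}` at the base point of `p`. -/
def gUp (p : CotangentBundle n M) (i j : Fin n) : ℝ := (metricCoeff g φ (φ p.proj))⁻¹ i j

/-- `g^{0i} = p_h g^{hi}`. -/
def pUp (p : CotangentBundle n M) (i : Fin n) : ℝ := ∑ h, mom φ p h * gUp g φ p h i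

/-- The energy density `t = ½ g^{ik} p_i p_k`. -/
def energy (p : CotangentBundle n M) : ℝ :=
  1 / 2 * ∑ i, ∑ k, gUp g φ p i k * mom φ p i * mom φ p k

/-- `Γ^k_{ij}` at the base point of `p`. -/
def Gam (p : CotangentBundle n M) (k i j : Fin n) : ℝ := christoffel g φ k i j (φ p.proj)

/-- `Γ^0_{ij} = p_k Γ^k_{ij}`. -/
def Gam0 (p : CotangentBundle n M) (i j : Fin n) : ℝ := ∑ k, mom φ p k * Gam g φ p k i j

/-- `R^0_{kij} = p_h R^h_{kij}`. -/
def R0 (p : CotangentBundle n M) (k i j : Fin n) : ℝ :=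
  ∑ h, mom φ p h * curvature g φ h k i j (φ p.proj)

/-- The horizontal vector field `δ_i = ∂/∂qⁱ + Γ^0_{ih} ∂/∂p_h`. -/
def delta (i : Fin n) (p : CotangentBundle n M) : TangentSpace (cotangentModel n) p :=
  dQ φ i p + ∑ h, Gam0 g φ p i h • dP φ h p

/-- The 1-form `dqⁱ`, evaluated at the tangent vector `ξ`. -/
def formDq (p : CotangentBundle n M) (i : Fin n) (ξ : TangentSpace (cotangentModel n) p) : ℝ :=
  (inducedDiff φ p ξ).1 i

/-- The 1-form `Dp_i = dp_i - Γ^0_{ij} dqʲ`, evaluated at the tangent vector `ξ`. -/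
def formDp (p : CotangentBundle n M) (i : Fin n) (ξ : TangentSpace (cotangentModel n) p) : ℝ :=
  (inducedDiff φ p ξ).2 i - ∑ j, Gam0 g φ p i j * formDq φ p j ξ

/-- The coefficients of a natural lift of diagonal type, functions of the energy density; only
their values on `[0, ∞)` matter. -/
structure Coefficients where
  /-- the coefficient of `g_{ij}` -/
  c₁ : ℝ → ℝ
  /-- the coefficient of `g^{ij}` -/
  c₂ : ℝ → ℝ
  /-- the coefficient of `p_i p_j` -/
  d₁ : ℝ → ℝ
  /-- the coefficient of `g^{0i} g^{0j}` -/
  d₂ : ℝ → ℝ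

variable (C : Coefficients)

/-- `G⁽¹⁾_{ij} = c₁ g_{ij} + d₁ p_i p_j`. -/
def G1 (p : CotangentBundle n M) (i j : Fin n) : ℝ :=
  C.c₁ (energy g φ p) * gLow g φ p i j + C.d₁ (energy g φ p) * mom φ p i * mom φ p j

/-- `G₍₂₎^{ij} = c₂ g^{ij} + d₂ g^{0i} g^{0j}`. -/
def G2 (p : CotangentBundle n M) (i j : Fin n) : ℝ :=
  C.c₂ (energy g φ p) * gUp g φ p i j + C.d₂ (energy g φ p) * pUp g φ p i * pUp g φ p j

/-- `H₍₁₎^{jk}`, the inverse of `G⁽¹⁾`. -/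
def H1 (p : CotangentBundle n M) (j k : Fin n) : ℝ :=
  let t := energy g φ p
  1 / C.c₁ t * gUp g φ p j k
    - C.d₁ t / (C.c₁ t * (C.c₁ t + 2 * t * C.d₁ t)) * pUp g φ p j * pUp g φ p k

/-- `H⁽²⁾_{jk}`, the inverse of `G₍₂₎`. -/
def H2 (p : CotangentBundle n M) (j k : Fin n) : ℝ :=
  let t := energy g φ p
  1 / C.c₂ t * gLow g φ p j k
    - C.d₂ t / (C.c₂ t * (C.c₂ t + 2 * t * C.d₂ t)) * mom φ p j * mom φ p k

/-- The expression `G⁽¹⁾_{ij} dqⁱ dqʲ + G₍₂₎^{ij} Dp_i Dp_j` in the induced chart. -/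
def localLift (p : CotangentBundle n M) (ξ η : TangentSpace (cotangentModel n) p) : ℝ :=
  (∑ i, ∑ j, G1 g φ C p i j * formDq φ p i ξ * formDq φ p j η)
    + ∑ i, ∑ j, G2 g φ C p i j * formDp g φ p i ξ * formDp g φ p j η

/-- The natural lift `G` of diagonal type of `g` to the cotangent bundle. At `p` it is evaluated in
the induced chart of the preferred chart of `M` at the base point of `p`; the expression does not
depend on the chart. -/
def naturalLift (p : CotangentBundle n M) (ξ η : TangentSpace (cotangentModel n) p) : ℝ :=
  localLift g (chartAt (EuclideanSpace ℝ (Fin n)) p.proj) C p ξ η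

/-- `Q^{ij}_h = ½ H⁽²⁾_{hk} (∂ⁱ G₍₂₎^{jk} + ∂ʲ G₍₂₎^{ik} - ∂ᵏ G₍₂₎^{ij})`. -/
def Q (p : CotangentBundle n M) (i j h : Fin n) : ℝ :=
  1 / 2 * ∑ k, H2 g φ C p h k *
    (pDeriv φ (fun q ↦ G2 g φ C q j k) i p + pDeriv φ (fun q ↦ G2 g φ C q i k) j p
      - pDeriv φ (fun q ↦ G2 g φ C q i j) k p)

/-- `P^{hi}_j = ½ H₍₁₎^{hk} (∂ⁱ G⁽¹⁾_{jk} - G₍₂₎^{il} R^0_{ljk})`. -/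
def P (p : CotangentBundle n M) (h i j : Fin n) : ℝ :=
  1 / 2 * ∑ k, H1 g φ C p h k *
    (pDeriv φ (fun q ↦ G1 g φ C q j k) i p - ∑ l, G2 g φ C p i l * R0 g φ p l j k)

/-- `S_{hij} = -½ H⁽²⁾_{hk} ∂ᵏ G⁽¹⁾_{ij} + ½ R^0_{hij}`. -/
def S (p : CotangentBundle n M) (h i j : Fin n) : ℝ :=
  -(1 / 2) * (∑ k, H2 g φ C p h k * pDeriv φ (fun q ↦ G1 g φ C q i j) k p)
    + 1 / 2 * R0 g φ p h i j

end Lift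

/-- The Kronecker symbol. -/
def kron (i j : Fin n) : ℝ := if i = j then 1 else 0

/-- The derivative of a function of `t ∈ [0, ∞)` (one-sided at `0`). -/
def tDeriv (f : ℝ → ℝ) (t : ℝ) : ℝ := derivWithin f (Ici 0) t

end CotangentLift

end

/-! The connection is found by Koszul's uniqueness argument in the frame $(\partial^i,\delta_i)$.
This frame is dual to the coframe $(Dp_i,dq^i)$, so $G$ is block diagonal in it, with blocks
$G_{(2)}$ and $G^{(1)}$ (`localLift_adaptedFrame`). Its brackets are $[\partial^i,\partial^j]=0$,
$[\delta_i,\partial^j]=-\Gamma^j_{ih}\partial^h$ and $[\delta_i,\delta_j]=R^0_{hij}\partial^h$. The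
right-hand sides of the theorem, collected in `connCoeff`, are checked to have the torsion
prescribed by these brackets (`connCoeff_sub_connCoeff`) and to be compatible with $G$
(`mvfderiv_localLift_adaptedFrame`). The difference between $\nabla$ and `connCoeff`, lowered with
$G$, is then symmetric in its first two arguments and skew in its last two, hence zero
(`eq_zero_of_symm_of_skew`); nondegeneracy of $G$ concludes (`leviCivita_adaptedFrame`).

Compatibility needs the derivatives of the blocks. Let $W(u)$ be the matrix $\Gamma^h_{aj}u^a$. Then
$dg=W^Tg+gW$, $dp=Dp+pW$ and $dt=g^{0k}Dp_k$: in the last identity the connection terms cancel. So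
the differential of each block is a part linear in $Dp$ plus a part linear in $W$
(`hasDifferentialAt_G1Coord`, `hasDifferentialAt_G2Coord`). The field $\partial^i$ sees only the
first part, and $\delta_i$ only the second.

The lift is defined pointwise in a preferred chart, so it must be shown that its expression is the
same in every chart. The point is that $Dp$ transforms like a covector: the second derivatives of
the change of charts that appear in $dp$ cancel the inhomogeneous term in the law of the Christoffel
symbols (`formDp_change`). That law, and the tensor law of the curvature, are proved once for
isometries between open subsets of a normed space (`christoffel_change`, `curvature_change`).

The $M$-tensor property follows because $Q$, $P$, $S$ are built from $p_i$, $g_{ij}$, $g^{ij}$,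
$\delta^i_j$, $R^0_{kij}$ and functions of $t$ by sums, products and contractions, once the
$\partial^i$-derivatives are replaced by their closed formulas. The same formulas give smoothness.

For constant sectional curvature, the symmetries of the curvature and polarization give
$R(u,v)w=c\,(g(v,w)u-g(u,w)v)$ (`curvature_eq_of_sectional`). What remains is the algebra of
$H_{(1)}$ and $H^{(2)}$, the inverses of rank-one perturbations of multiples of $g$ and $g^{-1}$:
their contractions with the metric and with $p$ are explicit. -/

noncomputable section

namespace CotangentLift

section

set_option maxSynthPendingDepth 3

/-! ### Riemannian geometry on an open subset of a normed space -/

section LocalMetric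

variable {E : Type*} [NormedAddCommGroup E] [NormedSpace ℝ E]

/-- A smooth metric `γ` on the open subset `U` of `E`, with the Christoffel map `Γ` of its
Levi-Civita connection. -/
structure IsLocalMetric (γ : E → E →L[ℝ] E →L[ℝ] ℝ) (Γ : E → E →L[ℝ] E →L[ℝ] E) (U : Set E) :
    Prop where
  isOpen : IsOpen U
  contDiffOn : ContDiffOn ℝ ∞ γ U
  contDiffOn_christoffel : ContDiffOn ℝ ∞ Γ U
  symm : ∀ y ∈ U, ∀ u v, γ y u v = γ y v u
  nondegenerate : ∀ y ∈ U, ∀ v, (∀ w, γ y v w = 0) → v = 0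
  koszul : ∀ y ∈ U, ∀ u v w, γ y (Γ y u v) w =
    1 / 2 * (fderiv ℝ γ y u v w + fderiv ℝ γ y v u w - fderiv ℝ γ y w u v)

/-- The curvature `R(u, v)w` of the connection with Christoffel map `Γ`. -/
def curvatureMap (Γ : E → E →L[ℝ] E →L[ℝ] E) (y u v w : E) : E :=
  fderiv ℝ Γ y u v w - fderiv ℝ Γ y v u w + Γ y u (Γ y v w) - Γ y v (Γ y u w)

/-- The product rule for a bilinear expression `B (X, Y)`. -/
lemma exists_hasFDerivAt_bilin {G : Type*} [NormedAddCommGroup G] [NormedSpace ℝ G]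
    {B : E → E →L[ℝ] E →L[ℝ] G} {B' : E →L[ℝ] E →L[ℝ] E →L[ℝ] G} {X Y : E → E}
    {X' Y' : E →L[ℝ] E} {y : E} (hB : HasFDerivAt B B' y) (hX : HasFDerivAt X X' y)
    (hY : HasFDerivAt Y Y' y) :
    ∃ D : E →L[ℝ] G, HasFDerivAt (fun z ↦ B z (X z) (Y z)) D y ∧
      ∀ a, D a = B' a (X y) (Y y) + B y (X' a) (Y y) + B y (X y) (Y' a) := by
  refine ⟨_, (hB.clm_apply hX).clm_apply hY, fun a ↦ ?_⟩
  simp only [_root_.add_apply, ContinuousLinearMap.comp_apply, ContinuousLinearMap.flip_apply]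
  abel

namespace IsLocalMetric

variable {γ γ' : E → E →L[ℝ] E →L[ℝ] ℝ} {Γ Γ' : E → E →L[ℝ] E →L[ℝ] E} {U V : Set E} {F : E → E}
  {y : E}

lemma hasFDerivAt (h : IsLocalMetric γ Γ U) (hy : y ∈ U) : HasFDerivAt γ (fderiv ℝ γ y) y :=
  ((h.contDiffOn.contDiffAt (h.isOpen.mem_nhds hy)).differentiableAt (by simp)).hasFDerivAt

lemma hasFDerivAt_christoffel (h : IsLocalMetric γ Γ U) (hy : y ∈ U) :
    HasFDerivAt Γ (fderiv ℝ Γ y) y :=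
  ((h.contDiffOn_christoffel.contDiffAt (h.isOpen.mem_nhds hy)).differentiableAt
    (by simp)).hasFDerivAt

lemma ext_inner (h : IsLocalMetric γ Γ U) (hy : y ∈ U) {u v : E}
    (huv : ∀ w, γ y u w = γ y v w) : u = v :=
  sub_eq_zero.1 <| h.nondegenerate y hy _ fun w ↦ by simp [huv]

lemma fderiv_symm (h : IsLocalMetric γ Γ U) (hy : y ∈ U) (u v w : E) :
    fderiv ℝ γ y u v w = fderiv ℝ γ y u w v := by
  have h1 := ((h.hasFDerivAt hy).clm_apply (hasFDerivAt_const v y)).clm_apply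
    (hasFDerivAt_const w y)
  have h2 := ((h.hasFDerivAt hy).clm_apply (hasFDerivAt_const w y)).clm_apply
    (hasFDerivAt_const v y)
  have h3 : (fun z ↦ γ z v w) =ᶠ[𝓝 y] fun z ↦ γ z w v := by
    filter_upwards [h.isOpen.mem_nhds hy] with z hz using h.symm z hz v w
  simpa using congr($(h1.unique (h2.congr_of_eventuallyEq h3)) u)

lemma christoffel_symm (h : IsLocalMetric γ Γ U) (hy : y ∈ U) (u v : E) :
    Γ y u v = Γ y v u := by
  refine h.ext_inner hy fun w ↦ ?_
  rw [h.koszul y hy, h.koszul y hy, h.fderiv_symm hy w]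
  ring

/-- The Christoffel map is metric: in the sum of the two Koszul expressions every derivative cancels
except the one in the direction `u`. -/
lemma fderiv_metric (h : IsLocalMetric γ Γ U) (hy : y ∈ U) (u v w : E) :
    fderiv ℝ γ y u v w = γ y (Γ y u v) w + γ y v (Γ y u w) := by
  rw [h.symm y hy v, h.koszul y hy, h.koszul y hy, h.fderiv_symm hy u v w,
    h.fderiv_symm hy v u w, h.fderiv_symm hy w u v]
  ring

lemma fderiv_christoffel_symm (h : IsLocalMetric γ Γ U) (hy : y ∈ U) (u v w : E) :
    fderiv ℝ Γ y u v w = fderiv ℝ Γ y u w v := by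
  have h1 := ((h.hasFDerivAt_christoffel hy).clm_apply (hasFDerivAt_const v y)).clm_apply
    (hasFDerivAt_const w y)
  have h2 := ((h.hasFDerivAt_christoffel hy).clm_apply (hasFDerivAt_const w y)).clm_apply
    (hasFDerivAt_const v y)
  have h3 : (fun z ↦ Γ z v w) =ᶠ[𝓝 y] fun z ↦ Γ z w v := by
    filter_upwards [h.isOpen.mem_nhds hy] with z hz using h.christoffel_symm hz v w
  simpa using congr($(h1.unique (h2.congr_of_eventuallyEq h3)) u)

/-- Change of variables for the Christoffel map. -/
lemma christoffel_change (h : IsLocalMetric γ Γ U)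
    (h' : IsLocalMetric γ' Γ' V) (hF : ContDiffOn ℝ ∞ F U) (hUV : MapsTo F U V)
    (hsurj : ∀ z ∈ U, Function.Surjective (fderiv ℝ F z))
    (hγ : ∀ z ∈ U, ∀ u v, γ z u v = γ' (F z) (fderiv ℝ F z u) (fderiv ℝ F z v))
    (hy : y ∈ U) (u v : E) :
    fderiv ℝ F y (Γ y u v) = fderiv ℝ (fderiv ℝ F) y u v
      + Γ' (F y) (fderiv ℝ F y u) (fderiv ℝ F y v) := by
  have hFy := hF.contDiffAt (h.isOpen.mem_nhds hy)
  have hF1 : HasFDerivAt F (fderiv ℝ F y) y := (hFy.differentiableAt (by simp)).hasFDerivAt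
  have hF2 : HasFDerivAt (fderiv ℝ F) (fderiv ℝ (fderiv ℝ F) y) y :=
    ((hFy.fderiv_right (m := 1) (by norm_num; exact ENat.LEInfty.out)).differentiableAt (by simp)).hasFDerivAt
  have hsymm : ∀ a b, fderiv ℝ (fderiv ℝ F) y a b = fderiv ℝ (fderiv ℝ F) y b a := fun a b ↦
    (hFy.isSymmSndFDerivAt (by simp; exact ENat.LEInfty.out)) a b
  -- The relation `γ = F^*γ'` is differentiated in the direction `a`; the second derivative of `F`
  -- enters because the transported vectors depend on the point.
  have key : ∀ a b c, fderiv ℝ γ y a b c =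
      fderiv ℝ γ' (F y) (fderiv ℝ F y a) (fderiv ℝ F y b) (fderiv ℝ F y c)
      + γ' (F y) (fderiv ℝ (fderiv ℝ F) y a b) (fderiv ℝ F y c)
      + γ' (F y) (fderiv ℝ F y b) (fderiv ℝ (fderiv ℝ F) y a c) := fun a b c ↦ by
    obtain ⟨D, hD, hDa⟩ := exists_hasFDerivAt_bilin (h.hasFDerivAt hy) (hasFDerivAt_const b y)
      (hasFDerivAt_const c y)
    have hd : ∀ d, HasFDerivAt (fun z ↦ fderiv ℝ F z d) ((fderiv ℝ (fderiv ℝ F) y).flip d) y :=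
      fun d ↦ by simpa using hF2.clm_apply (hasFDerivAt_const d y)
    obtain ⟨D', hD', hDa'⟩ := exists_hasFDerivAt_bilin ((h'.hasFDerivAt (hUV hy)).comp y hF1)
      (hd b) (hd c)
    have h3 : (fun z ↦ γ z b c) =ᶠ[𝓝 y]
        fun z ↦ (γ' ∘ F) z (fderiv ℝ F z b) (fderiv ℝ F z c) := by
      filter_upwards [h.isOpen.mem_nhds hy] with z hz using hγ z hz b c
    have h4 := congr($(hD.unique (hD'.congr_of_eventuallyEq h3)) a)
    rw [hDa, hDa'] at h4
    simpa using h4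
  -- It suffices to test against vectors `F'(y) w`, which are all vectors. In the Koszul combination
  -- the terms with `F''` cancel by symmetry, except for twice the one with `F''(u, v)`.
  refine h'.ext_inner (hUV hy) fun w ↦ ?_
  obtain ⟨w, rfl⟩ := hsurj y hy w
  rw [← hγ y hy, h.koszul y hy, key, key, key, map_add, _root_.add_apply,
    h'.koszul _ (hUV hy), hsymm v u, hsymm w u, hsymm w v,
    h'.symm _ (hUV hy) (fderiv ℝ F y v), h'.symm _ (hUV hy) (fderiv ℝ F y u)]
  ring

/-- Change of variables for the curvature. -/
lemma curvature_change (h : IsLocalMetric γ Γ U)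
    (h' : IsLocalMetric γ' Γ' V) (hF : ContDiffOn ℝ ∞ F U) (hUV : MapsTo F U V)
    (hsurj : ∀ z ∈ U, Function.Surjective (fderiv ℝ F z))
    (hγ : ∀ z ∈ U, ∀ u v, γ z u v = γ' (F z) (fderiv ℝ F z u) (fderiv ℝ F z v))
    (hy : y ∈ U) (u v w : E) :
    fderiv ℝ F y (curvatureMap Γ y u v w) =
      curvatureMap Γ' (F y) (fderiv ℝ F y u) (fderiv ℝ F y v) (fderiv ℝ F y w) := by
  have hFy := hF.contDiffAt (h.isOpen.mem_nhds hy)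
  have hF1 : HasFDerivAt F (fderiv ℝ F y) y := (hFy.differentiableAt (by simp)).hasFDerivAt
  have hF2' : ContDiffAt ℝ 2 (fderiv ℝ F) y := hFy.fderiv_right (m := 2) (by norm_num; exact ENat.LEInfty.out)
  have hF2 : HasFDerivAt (fderiv ℝ F) (fderiv ℝ (fderiv ℝ F) y) y :=
    (hF2'.differentiableAt (by simp)).hasFDerivAt
  have hF3 : HasFDerivAt (fderiv ℝ (fderiv ℝ F)) (fderiv ℝ (fderiv ℝ (fderiv ℝ F)) y) y :=
    ((hF2'.fderiv_right (m := 1) (by norm_num)).differentiableAt (by simp)).hasFDerivAt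
  have hsymm : ∀ a b, fderiv ℝ (fderiv ℝ F) y a b = fderiv ℝ (fderiv ℝ F) y b a := fun a b ↦
    (hFy.isSymmSndFDerivAt (by simp; exact ENat.LEInfty.out)) a b
  -- The third derivative of `F` is the second derivative of `fderiv ℝ F`, which gives symmetry in
  -- the first two slots.
  have hsymm3 : ∀ a b, fderiv ℝ (fderiv ℝ (fderiv ℝ F)) y a b =
      fderiv ℝ (fderiv ℝ (fderiv ℝ F)) y b a := fun a b ↦
    (hF2'.isSymmSndFDerivAt (by simp)) a b
  have law : ∀ z ∈ U, ∀ a b, fderiv ℝ F z (Γ z a b) = fderiv ℝ (fderiv ℝ F) z a b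
      + Γ' (F z) (fderiv ℝ F z a) (fderiv ℝ F z b) :=
    fun z hz a b ↦ h.christoffel_change h' hF hUV hsurj hγ hz a b
  have key : ∀ a b c, fderiv ℝ (fderiv ℝ F) y a (Γ y b c) + fderiv ℝ F y (fderiv ℝ Γ y a b c) =
      fderiv ℝ (fderiv ℝ (fderiv ℝ F)) y a b c
      + fderiv ℝ Γ' (F y) (fderiv ℝ F y a) (fderiv ℝ F y b) (fderiv ℝ F y c)
      + Γ' (F y) (fderiv ℝ (fderiv ℝ F) y a b) (fderiv ℝ F y c)
      + Γ' (F y) (fderiv ℝ F y b) (fderiv ℝ (fderiv ℝ F) y a c) := fun a b c ↦ by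
    have h1 := hF2.clm_apply (((h.hasFDerivAt_christoffel hy).clm_apply
      (hasFDerivAt_const b y)).clm_apply (hasFDerivAt_const c y))
    have hd : ∀ d, HasFDerivAt (fun z ↦ fderiv ℝ F z d) ((fderiv ℝ (fderiv ℝ F) y).flip d) y :=
      fun d ↦ by simpa using hF2.clm_apply (hasFDerivAt_const d y)
    obtain ⟨D, hD, hDa⟩ := exists_hasFDerivAt_bilin hF3 (hasFDerivAt_const b y)
      (hasFDerivAt_const c y)
    obtain ⟨D', hD', hDa'⟩ := exists_hasFDerivAt_bilin
      ((h'.hasFDerivAt_christoffel (hUV hy)).comp y hF1) (hd b) (hd c)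
    have h3 : (fun z ↦ fderiv ℝ F z (Γ z b c)) =ᶠ[𝓝 y]
        fun z ↦ fderiv ℝ (fderiv ℝ F) z b c + (Γ' ∘ F) z (fderiv ℝ F z b) (fderiv ℝ F z c) := by
      filter_upwards [h.isOpen.mem_nhds hy] with z hz using law z hz b c
    have h4 := congr($(h1.unique ((hD.add hD').congr_of_eventuallyEq h3)) a)
    rw [_root_.add_apply D, hDa, hDa'] at h4
    simp only [_root_.add_apply, ContinuousLinearMap.comp_apply,
      ContinuousLinearMap.flip_apply, _root_.zero_apply, map_zero,
      Function.comp_apply, zero_add, add_zero] at h4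
    rw [add_comm, h4]
    abel
  -- Antisymmetrizing the differentiated law in `u`, `v` removes the third derivative. The law
  -- itself, applied to the nested terms `Γ (u, Γ (v, w))`, removes the second derivatives.
  have e1 := key u v w
  have e2 := key v u w
  rw [hsymm3 v u, hsymm v u] at e2
  simp only [curvatureMap, map_add, map_sub, law y hy]
  have e3 := congr($e1 - $e2)
  rw [← sub_eq_zero] at e3 ⊢
  rw [← e3]
  abel

lemma curvature_swap (u v w : E) : curvatureMap Γ y u v w = -curvatureMap Γ y v u w := by
  simp only [curvatureMap]
  abel

/-- The first Bianchi identity. -/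
lemma curvature_bianchi (h : IsLocalMetric γ Γ U) (hy : y ∈ U) (u v w : E) :
    curvatureMap Γ y u v w + curvatureMap Γ y v w u + curvatureMap Γ y w u v = 0 := by
  simp only [curvatureMap]
  rw [h.fderiv_christoffel_symm hy v w u, h.fderiv_christoffel_symm hy w u v,
    h.fderiv_christoffel_symm hy u w v, h.christoffel_symm hy w u, h.christoffel_symm hy w v,
    h.christoffel_symm hy v u]
  abel

/-- The second derivative of `x ↦ γ x w z` is symmetric. Expressing it through `Γ` by metricity and
antisymmetrizing leaves `γ (R w, z) + γ (w, R z) = 0`. -/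
lemma curvature_skew (h : IsLocalMetric γ Γ U) (hy : y ∈ U) (u v w z : E) :
    γ y (curvatureMap Γ y u v w) z = -γ y (curvatureMap Γ y u v z) w := by
  have hf : ContDiffAt ℝ ∞ (fun x ↦ γ x w z) y :=
    ((h.contDiffOn.contDiffAt (h.isOpen.mem_nhds hy)).clm_apply contDiffAt_const).clm_apply
      contDiffAt_const
  have hf2 : HasFDerivAt (fderiv ℝ (fun x ↦ γ x w z)) (fderiv ℝ (fderiv ℝ (fun x ↦ γ x w z)) y) y :=
    ((hf.fderiv_right (m := 1) (by norm_num; exact ENat.LEInfty.out)).differentiableAt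
      (by simp)).hasFDerivAt
  have hsymm : ∀ a b, fderiv ℝ (fderiv ℝ (fun x ↦ γ x w z)) y a b =
      fderiv ℝ (fderiv ℝ (fun x ↦ γ x w z)) y b a := fun a b ↦
    (hf.isSymmSndFDerivAt (by simp; exact ENat.LEInfty.out)) a b
  have hfd : ∀ x ∈ U, ∀ b, fderiv ℝ (fun x ↦ γ x w z) x b = γ x (Γ x b w) z + γ x w (Γ x b z) :=
    fun x hx b ↦ by
      obtain ⟨D, hD, hDa⟩ := exists_hasFDerivAt_bilin (h.hasFDerivAt hx) (hasFDerivAt_const w x)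
        (hasFDerivAt_const z x)
      rw [hD.fderiv, hDa, h.fderiv_metric hx]
      simp
  have hg := h.hasFDerivAt hy
  have hG := h.hasFDerivAt_christoffel hy
  have hGd : ∀ b d, HasFDerivAt (fun x ↦ Γ x b d) (((fderiv ℝ Γ y).flip b).flip d) y :=
    fun b d ↦ by
      simpa using (hG.clm_apply (hasFDerivAt_const b y)).clm_apply (hasFDerivAt_const d y)
  have key : ∀ a b, fderiv ℝ (fderiv ℝ (fun x ↦ γ x w z)) y a b =
      fderiv ℝ γ y a (Γ y b w) z + γ y (fderiv ℝ Γ y a b w) z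
      + fderiv ℝ γ y a w (Γ y b z) + γ y w (fderiv ℝ Γ y a b z) := fun a b ↦ by
    obtain ⟨D, hD, hDa⟩ := exists_hasFDerivAt_bilin hg (hGd b w) (hasFDerivAt_const z y)
    obtain ⟨D', hD', hDa'⟩ := exists_hasFDerivAt_bilin hg (hasFDerivAt_const w y) (hGd b z)
    have h1 := hf2.clm_apply (hasFDerivAt_const b y)
    have h3 : (fun x ↦ fderiv ℝ (fun x ↦ γ x w z) x b) =ᶠ[𝓝 y]
        fun x ↦ γ x (Γ x b w) z + γ x w (Γ x b z) := by
      filter_upwards [h.isOpen.mem_nhds hy] with x hx using hfd x hx b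
    have h4 := congr($(h1.unique ((hD.add hD').congr_of_eventuallyEq h3)) a)
    rw [_root_.add_apply D, hDa, hDa'] at h4
    simp only [_root_.add_apply, ContinuousLinearMap.comp_apply,
      ContinuousLinearMap.flip_apply, _root_.zero_apply, map_zero,
      zero_add, add_zero] at h4
    rw [h4]
    ring
  have e1 := key u v
  have e2 := key v u
  rw [hsymm v u] at e2
  simp only [h.fderiv_metric hy] at e1 e2
  simp only [curvatureMap, map_add, map_sub, _root_.add_apply,
    _root_.sub_apply]
  rw [h.symm y hy (fderiv ℝ Γ y u v z) w, h.symm y hy (fderiv ℝ Γ y v u z) w,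
    h.symm y hy (Γ y u (Γ y v z)) w, h.symm y hy (Γ y v (Γ y u z)) w]
  linarith

/-- The curvature of a metric whose sectional curvature is the constant `c`. -/
lemma curvature_eq_of_sectional (h : IsLocalMetric γ Γ U) (hy : y ∈ U) (c : ℝ)
    (hc : ∀ u v, γ y (curvatureMap Γ y u v v) u = c * (γ y u u * γ y v v - γ y u v ^ 2))
    (u v w : E) :
    curvatureMap Γ y u v w = c • (γ y v w • u - γ y u w • v) := by
  -- `T` is the deviation from the model tensor of curvature `c`. It has all the algebraic
  -- symmetries of a curvature tensor, and its sectional values vanish by hypothesis.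
  set T : E → E → E → E → ℝ := fun a b d e ↦ γ y (curvatureMap Γ y a b d) e
    - c * (γ y b d * γ y a e - γ y a d * γ y b e) with hT
  have s1 : ∀ a b d e, T a b d e = -T b a d e := fun a b d e ↦ by
    simp only [hT, curvature_swap (Γ := Γ) (y := y) a b, map_neg, _root_.neg_apply]
    ring
  have s2 : ∀ a b d e, T a b d e = -T a b e d := fun a b d e ↦ by
    simp only [hT, h.curvature_skew hy a b d e]
    ring
  have s3 : ∀ a b d e, T a b d e + T b d a e + T d a b e = 0 := fun a b d e ↦ by
    have := congr(γ y $(h.curvature_bianchi hy a b d) e)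
    simp only [map_add, _root_.add_apply, map_zero,
      _root_.zero_apply] at this
    simp only [hT]
    rw [h.symm y hy d a, h.symm y hy d b, h.symm y hy b a]
    linear_combination this
  have s4 : ∀ a b, T a b b a = 0 := fun a b ↦ by
    simp only [hT, hc]
    rw [h.symm y hy b a]
    ring
  have addU : ∀ a b d e x, T (a + x) b d e = T a b d e + T x b d e := fun a b d e x ↦ by
    simp only [hT, curvatureMap, map_add, map_sub, _root_.add_apply,
      _root_.sub_apply]
    ring
  have addV : ∀ a b d e x, T a (b + x) d e = T a b d e + T a x d e := fun a b d e x ↦ by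
    rw [s1, addU, s1 b, s1 x]
    ring
  have addW : ∀ a b d e x, T a b (d + x) e = T a b d e + T a b x e := fun a b d e x ↦ by
    simp only [hT, curvatureMap, map_add, map_sub, _root_.add_apply,
      _root_.sub_apply]
    ring
  have addZ : ∀ a b d e x, T a b d (e + x) = T a b d e + T a b d x := fun a b d e x ↦ by
    rw [s2, addW, s2 a b e, s2 a b x]
    ring
  -- The pair symmetry comes from combining four Bianchi identities with the two skew symmetries.
  have pair : ∀ a b d e, T a b d e = T d e a b := fun a b d e ↦ by
    linarith [s3 a b d e, s3 b d e a, s3 d e a b, s3 e a b d, s2 a b d e, s2 b d a e, s2 d a b e,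
      s2 b d e a, s2 d e b a, s2 e b d a, s2 d e a b, s2 e a d b, s2 a d e b, s2 e a b d,
      s2 a b e d, s2 b e a d, s1 a b d e, s1 d e a b, s1 a d b e, s1 b d a e, s1 e a b d, s1 b e a d,
      s1 a d e b, s1 e b d a, s1 b d e a]
  -- Polarization of the vanishing sectional values in the second argument; the two cross terms
  -- agree by pair symmetry. The next step polarizes in the outer argument.
  have p1 : ∀ a b d, T a b d a = 0 := fun a b d ↦ by
    have := s4 a (b + d)
    rw [addV, addW, addW, s4, s4] at this
    linarith [pair a d b a, s1 b a a d, s2 a b a d, s1 a b d a, s2 b a a d]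
  have p2 : ∀ a b d e, T a b d e = -T e b d a := fun a b d e ↦ by
    have := p1 (a + e) b d
    rw [addU, addZ, addZ, p1, p1] at this
    linarith
  -- `T` is now skew under transposing slots 1, 2, slots 3, 4 and slots 1, 4, hence totally skew;
  -- the three Bianchi terms are then equal, so each vanishes.
  have T0 : ∀ a b d e, T a b d e = 0 := fun a b d e ↦ by
    linarith [s3 a b d e, p2 a b d e, p2 b d a e, p2 d a b e, s1 e b d a, s2 b e d a, s1 a b d e,
      s2 a b d e, pair a b d e, pair b d a e, pair d a b e, s2 e d a b, s1 e d a b, s1 e a b d,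
      s1 d a b e, s2 d a b e, s1 b d a e, s2 b d a e, p2 b a d e, p2 a d b e, p2 d b a e,
      s1 e d a b, s1 e a d b, s1 e b a d, s2 e b a d, s2 e a b d, s2 e d a b, pair e a b d,
      pair e b d a, pair e d a b, s2 a d b e, p2 b d e a]
  refine h.ext_inner hy fun z ↦ ?_
  have := T0 u v w z
  simp only [hT] at this
  simp only [map_smul, map_sub, _root_.smul_apply, _root_.sub_apply,
    smul_eq_mul]
  linarith

end IsLocalMetric

end LocalMetric

/-! ### Induced charts of the cotangent bundle -/

section InducedChart

variable {n : ℕ} {M : Type*} [TopologicalSpace M] [ChartedSpace (EuclideanSpace ℝ (Fin n)) M]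
  [IsManifold (𝓡 n) ∞ M] {φ ψ : OpenPartialHomeomorph M (EuclideanSpace ℝ (Fin n))}

omit [IsManifold (𝓡 n) ∞ M] in
lemma mem_maximalAtlas_one (hφ : φ ∈ IsManifold.maximalAtlas (𝓡 n) ∞ M) :
    φ ∈ IsManifold.maximalAtlas (𝓡 n) 1 M :=
  IsManifold.maximalAtlas_subset_of_le ENat.LEInfty.out hφ

omit [IsManifold (𝓡 n) ∞ M] in
lemma mdifferentiable_chart (hφ : φ ∈ IsManifold.maximalAtlas (𝓡 n) ∞ M) :
    φ.MDifferentiable (𝓡 n) (𝓡 n) :=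
  ⟨fun _ hx ↦ (mdifferentiableAt_of_mem_maximalAtlas
      (mem_maximalAtlas_one hφ) hx).mdifferentiableWithinAt,
    fun _ hx ↦ (mdifferentiableAt_symm_of_mem_maximalAtlas
      (mem_maximalAtlas_one hφ) hx).mdifferentiableWithinAt⟩

omit [IsManifold (𝓡 n) ∞ M] in
lemma isInvertible_mfderiv_chart (hφ : φ ∈ IsManifold.maximalAtlas (𝓡 n) ∞ M) {x : M}
    (hx : x ∈ φ.source) : (mfderiv (𝓡 n) (𝓡 n) φ x).IsInvertible :=
  ⟨(mdifferentiable_chart hφ).mfderiv hx, rfl⟩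

/-- The coordinate field is the pullback under `φ` of a constant field on the model space. -/
lemma contMDiffAt_coordVec (hφ : φ ∈ IsManifold.maximalAtlas (𝓡 n) ∞ M) {x : M}
    (hx : x ∈ φ.source) (i : Fin n) :
    ContMDiffAt (𝓡 n) (𝓡 n).tangent ∞
      (fun z ↦ (⟨z, coordVec φ i z⟩ : TangentBundle (𝓡 n) M)) x := by
  refine ContMDiffAt.mpullback_vectorField_preimage (I' := 𝓡 n)
    (V := fun y ↦ (stdVec i : TangentSpace (𝓡 n) y)) (n := ∞) ?_
    (contMDiffAt_of_mem_maximalAtlas hφ hx) (isInvertible_mfderiv_chart hφ hx) (by simp)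
  exact contMDiffAt_vectorSpace_iff_contDiffAt.2 contDiffAt_const

/-- The momentum is the pairing of the tautological covector with the coordinate field pulled back
along the projection, and this pairing is smooth. -/
lemma contMDiffAt_mom (hφ : φ ∈ IsManifold.maximalAtlas (𝓡 n) ∞ M) {p : CotangentBundle n M}
    (hp : p.proj ∈ φ.source) (i : Fin n) :
    ContMDiffAt (cotangentModel n) 𝓘(ℝ, ℝ) ∞ (fun q ↦ mom φ q i) p := by
  have h1 : ContMDiffAt (cotangentModel n) (𝓡 n).tangent ∞
      (fun q : CotangentBundle n M ↦
        (⟨q.proj, coordVec φ i q.proj⟩ : TangentBundle (𝓡 n) M)) p :=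
    (contMDiffAt_coordVec hφ hp i).comp p (Bundle.contMDiffAt_proj _)
  have h2 : ContMDiffAt (cotangentModel n) (cotangentModel n) ∞
      (fun q : CotangentBundle n M ↦ (⟨q.proj, q.2⟩ : CotangentBundle n M)) p := contMDiffAt_id
  have h3 := ContMDiffAt.clm_bundle_apply (b := fun q : CotangentBundle n M ↦ q.proj) h2 h1
  exact (contMDiffAt_totalSpace.1 h3).2

lemma contMDiffAt_metricCoeff
    (g : ContMDiffRiemannianMetric (𝓡 n) ∞ (EuclideanSpace ℝ (Fin n))
      (fun x : M ↦ TangentSpace (𝓡 n) x))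
    (hφ : φ ∈ IsManifold.maximalAtlas (𝓡 n) ∞ M) {y : EuclideanSpace ℝ (Fin n)}
    (hy : y ∈ φ.target) (i j : Fin n) :
    ContDiffAt ℝ ∞ (fun z ↦ metricCoeff g φ z i j) y := by
  rw [← contMDiffAt_iff_contDiffAt]
  have h1 : ContMDiffAt (𝓡 n) (𝓡 n) ∞ φ.symm y := contMDiffAt_symm_of_mem_maximalAtlas hφ hy
  have h2 := fun i ↦ (contMDiffAt_coordVec hφ (φ.map_target hy) i).comp y h1
  have h3 := (g.contMDiff (φ.symm y)).comp y h1
  have h4 := ContMDiffAt.clm_bundle_apply₂ (E₃ := Bundle.Trivial M ℝ) (b := φ.symm) h3 (h2 i) (h2 j)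
  exact (contMDiffAt_totalSpace.1 h4).2

lemma contMDiffAt_inducedChart (hφ : φ ∈ IsManifold.maximalAtlas (𝓡 n) ∞ M)
    {p : CotangentBundle n M} (hp : p.proj ∈ φ.source) :
    ContMDiffAt (cotangentModel n)
      𝓘(ℝ, EuclideanSpace ℝ (Fin n) × EuclideanSpace ℝ (Fin n)) ∞ (inducedChart φ) p := by
  refine ContMDiffAt.prodMk_space
    ((contMDiffAt_of_mem_maximalAtlas hφ hp).comp p (Bundle.contMDiffAt_proj _)) ?_
  have h : ContMDiffAt (cotangentModel n) 𝓘(ℝ, Fin n → ℝ) ∞ (fun q ↦ mom φ q) p :=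
    contMDiffAt_pi_space.2 fun i ↦ contMDiffAt_mom hφ hp i
  exact (EuclideanSpace.equiv (Fin n) ℝ).symm.contDiff.contMDiff.contMDiffAt.comp p h

lemma mdifferentiableAt_inducedChart (hφ : φ ∈ IsManifold.maximalAtlas (𝓡 n) ∞ M)
    {p : CotangentBundle n M} (hp : p.proj ∈ φ.source) :
    MDifferentiableAt (cotangentModel n)
      𝓘(ℝ, EuclideanSpace ℝ (Fin n) × EuclideanSpace ℝ (Fin n)) (inducedChart φ) p :=
  (contMDiffAt_inducedChart hφ hp).mdifferentiableAt (by simp)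

/-- The fibre line through `p` in the direction `η`. -/
lemma contMDiff_fibre_line (p : CotangentBundle n M)
    (η : TangentSpace (𝓡 n) p.proj →L[ℝ] Bundle.Trivial M ℝ p.proj) :
    ContMDiff 𝓘(ℝ, ℝ) (cotangentModel n) ∞
      (fun s : ℝ ↦ (⟨p.proj, p.2 + s • η⟩ : CotangentBundle n M)) := by
  intro s
  refine contMDiffAt_totalSpace.2 ⟨contMDiffAt_const, ?_⟩
  rw [contMDiffAt_iff_contDiffAt]
  set e := trivializationAt (EuclideanSpace ℝ (Fin n) →L[ℝ] ℝ)
    (fun x : M ↦ TangentSpace (𝓡 n) x →L[ℝ] Bundle.Trivial M ℝ x) p.proj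
  have h : ∀ s : ℝ, (e ⟨p.proj, p.2 + s • η⟩).2 =
      e.continuousLinearMapAt ℝ p.proj p.2 + s • e.continuousLinearMapAt ℝ p.proj η := fun s ↦ by
    rw [← ContinuousLinearMap.map_smul, ← ContinuousLinearMap.map_add,
      Trivialization.continuousLinearMapAt_apply, Trivialization.coe_linearMapAt_of_mem]
    exact FiberBundle.mem_baseSet_trivializationAt' _
  simp only [h]
  fun_prop

omit [IsManifold (𝓡 n) ∞ M] in
lemma isInvertible_of_surjective {V W : Type*} [AddCommGroup V] [Module ℝ V] [TopologicalSpace V]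
    [IsTopologicalAddGroup V] [ContinuousSMul ℝ V] [T2Space V] [FiniteDimensional ℝ V]
    [AddCommGroup W] [Module ℝ W] [TopologicalSpace W]
    [IsTopologicalAddGroup W] [ContinuousSMul ℝ W] [T2Space W] [FiniteDimensional ℝ W]
    (hVW : Module.finrank ℝ V = Module.finrank ℝ W) {f : V →L[ℝ] W}
    (hf : Function.Surjective f) : f.IsInvertible := by
  have hinj : Function.Injective f :=
    (LinearMap.injective_iff_surjective_of_finrank_eq_finrank (f := (f : V →ₗ[ℝ] W)) hVW).2 hf
  refine ⟨(LinearEquiv.ofBijective (f : V →ₗ[ℝ] W) ⟨hinj, hf⟩).toContinuousLinearEquiv, ?_⟩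
  ext v
  rfl

/-- The vector is the velocity of the line `p + s η` in the fibre, where `η` is the covector whose
components in the chart are those of `b`. -/
lemma exists_inducedDiff_eq_vertical (hφ : φ ∈ IsManifold.maximalAtlas (𝓡 n) ∞ M)
    {p : CotangentBundle n M} (hp : p.proj ∈ φ.source) (b : EuclideanSpace ℝ (Fin n)) :
    ∃ ξ, inducedDiff φ p ξ = (0, b) := by
  let η : TangentSpace (𝓡 n) p.proj →L[ℝ] ℝ :=
    (innerSL ℝ b).comp (mfderiv (𝓡 n) (𝓡 n) φ p.proj)
  have hin : ∀ i, inner ℝ b (stdVec i) = b i := fun i ↦ by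
    simp [stdVec, EuclideanSpace.inner_single_right]
  have hη : ∀ i, η (coordVec φ i p.proj) = b i := fun i ↦ by
    have : mfderiv (𝓡 n) (𝓡 n) φ p.proj (coordVec φ i p.proj) = stdVec i :=
      (isInvertible_mfderiv_chart hφ hp).self_apply_inverse _
    change inner ℝ b (mfderiv (𝓡 n) (𝓡 n) φ p.proj (coordVec φ i p.proj)) = b i
    rw [this]
    exact hin i
  let c : ℝ → CotangentBundle n M := fun s ↦ ⟨p.proj, p.2 + s • η⟩
  have hc0 : c 0 = p := by
    simp only [c, zero_smul, add_zero]
  have hc := (contMDiff_fibre_line p η).mdifferentiable (by simp) 0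
  have hcomp : (inducedChart φ ∘ c) =
      fun s ↦ (φ p.proj, WithLp.toLp 2 (mom φ p) + s • b) := by
    funext s
    refine Prod.ext rfl ?_
    ext i
    change p.2 _ + s * η (coordVec φ i p.proj) = _
    rw [hη]
    rfl
  have hd : HasDerivAt (fun s : ℝ ↦ (φ p.proj, WithLp.toLp 2 (mom φ p) + s • b)) (0, b) 0 := by
    refine (hasDerivAt_const _ _).prodMk ?_
    simpa using ((hasDerivAt_id (0 : ℝ)).smul_const b).const_add (WithLp.toLp 2 (mom φ p))
  have hind : MDifferentiableAt (cotangentModel n)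
      𝓘(ℝ, EuclideanSpace ℝ (Fin n) × EuclideanSpace ℝ (Fin n)) (inducedChart φ) (c 0) :=
    mdifferentiableAt_inducedChart hφ hp
  have h1 := mfderiv_comp_apply (0 : ℝ) hind hc 1
  have h2 : mfderiv 𝓘(ℝ, ℝ) 𝓘(ℝ, EuclideanSpace ℝ (Fin n) × EuclideanSpace ℝ (Fin n))
      (inducedChart φ ∘ c) 0 (1 : ℝ) = ((0 : EuclideanSpace ℝ (Fin n)), b) := by
    rw [hcomp, mfderiv_eq_fderiv]
    exact hd.deriv
  -- The existential hides the vector, whose type depends on `c 0`, so that `c 0` can be rewritten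
  -- to `p`.
  have h3 : ∃ ξ, inducedDiff φ (c 0) ξ = (0, b) := ⟨_, h1.symm.trans h2⟩
  rwa [hc0] at h3

lemma fst_inducedDiff (hφ : φ ∈ IsManifold.maximalAtlas (𝓡 n) ∞ M)
    {p : CotangentBundle n M} (hp : p.proj ∈ φ.source) (ξ : TangentSpace (cotangentModel n) p) :
    (inducedDiff φ p ξ).1 = mfderiv (𝓡 n) (𝓡 n) φ p.proj
      (mfderiv (cotangentModel n) (𝓡 n) (fun q : CotangentBundle n M ↦ q.proj) p ξ) := by
  have hd := mdifferentiableAt_inducedChart hφ hp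
  have hproj : MDifferentiableAt (cotangentModel n) (𝓡 n)
      (fun q : CotangentBundle n M ↦ q.proj) p :=
    (Bundle.contMDiffAt_proj _ (n := 1)).mdifferentiableAt one_ne_zero
  have hφd : MDifferentiableAt (𝓡 n) (𝓡 n) φ p.proj := 
    mdifferentiableAt_of_mem_maximalAtlas (mem_maximalAtlas_one hφ) hp
  have h1 := mfderiv_comp_apply p hφd hproj ξ
  have hfst : HasMFDerivAt 𝓘(ℝ, EuclideanSpace ℝ (Fin n) × EuclideanSpace ℝ (Fin n)) (𝓡 n)
      (Prod.fst : EuclideanSpace ℝ (Fin n) × EuclideanSpace ℝ (Fin n) → _)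
      (inducedChart φ p) (ContinuousLinearMap.fst ℝ (EuclideanSpace ℝ (Fin n)) (EuclideanSpace ℝ (Fin n))) :=
    hasFDerivAt_fst.hasMFDerivAt
  have h2 := (hfst.comp p hd.hasMFDerivAt).mfderiv
  rw [← h1]
  have h3 : (Prod.fst ∘ (inducedChart φ)) = φ ∘ (fun q : CotangentBundle n M ↦ q.proj) := rfl
  rw [h3] at h2
  exact (congr($h2 ξ)).symm

/-- A differentiable section through `p` provides horizontal velocities; it is used to show that the
differential of the projection is onto. -/
lemma exists_section (p : CotangentBundle n M) :
    ∃ s : M → CotangentBundle n M, (∀ x, (s x).proj = x) ∧ s p.proj = p ∧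
      ContMDiffAt (𝓡 n) (cotangentModel n) 1 s p.proj := by
  let V : M → Type := fun x ↦ TangentSpace (𝓡 n) x →L[ℝ] Bundle.Trivial M ℝ x
  refine ⟨fun x ↦ ⟨x, FiberBundle.extend (E := V) (EuclideanSpace ℝ (Fin n) →L[ℝ] ℝ) (x := p.proj)
    p.2 x⟩, fun _ ↦ rfl, ?_, FiberBundle.contMDiffAt_extend (V := V) (𝓡 n)
      (EuclideanSpace ℝ (Fin n) →L[ℝ] ℝ) p.2⟩
  exact congrArg (TotalSpace.mk p.proj) (FiberBundle.extend_apply_self (E := V) _ p.2)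

lemma surjective_mfderiv_proj (p : CotangentBundle n M) :
    Function.Surjective
      (mfderiv (cotangentModel n) (𝓡 n) (fun q : CotangentBundle n M ↦ q.proj) p) := by
  intro v
  obtain ⟨s, hs, hsp, hsd⟩ := exists_section p
  have hproj : MDifferentiableAt (cotangentModel n) (𝓡 n)
      (fun q : CotangentBundle n M ↦ q.proj) (s p.proj) :=
    (Bundle.contMDiffAt_proj _ (n := 1)).mdifferentiableAt one_ne_zero
  have h1 := mfderiv_comp_apply p.proj hproj (hsd.mdifferentiableAt one_ne_zero) v
  have h2 : (fun q : CotangentBundle n M ↦ q.proj) ∘ s = id := funext hs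
  rw [h2, mfderiv_id] at h1
  have h3 : ∃ ξ, mfderiv (cotangentModel n) (𝓡 n) (fun q : CotangentBundle n M ↦ q.proj)
      (s p.proj) ξ = v := ⟨_, h1.symm⟩
  rwa [hsp] at h3

/-- Surjectivity suffices, the dimensions being equal. A tangent vector over the wanted base
velocity exists because the projection is a submersion, and a vertical vector corrects its fibre
component. -/
lemma isInvertible_inducedDiff (hφ : φ ∈ IsManifold.maximalAtlas (𝓡 n) ∞ M)
    {p : CotangentBundle n M} (hp : p.proj ∈ φ.source) : (inducedDiff φ p).IsInvertible := by
  have hsurj : Function.Surjective (inducedDiff φ p) := fun ⟨a, b⟩ ↦ by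
    obtain ⟨v, hv⟩ := (isInvertible_mfderiv_chart hφ hp).surjective a
    obtain ⟨ξ, rfl⟩ := surjective_mfderiv_proj p v
    rw [← fst_inducedDiff hφ hp] at hv
    obtain ⟨η, hη⟩ := exists_inducedDiff_eq_vertical hφ hp (b - (inducedDiff φ p ξ).2)
    refine ⟨ξ + η, ?_⟩
    rw [ContinuousLinearMap.map_add, hη]
    ext1 <;> simp [hv]
  have hrank : Module.finrank ℝ (CotangentModel n) =
      Module.finrank ℝ (EuclideanSpace ℝ (Fin n) × EuclideanSpace ℝ (Fin n)) := by
    rw [Module.finrank_prod, Module.finrank_prod,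
      ← (LinearMap.toContinuousLinearMap (𝕜 := ℝ) (E := EuclideanSpace ℝ (Fin n)) (F' := ℝ)).finrank_eq]
    simp
  exact isInvertible_of_surjective (V := CotangentModel n) hrank hsurj

lemma inducedDiff_dQ (hφ : φ ∈ IsManifold.maximalAtlas (𝓡 n) ∞ M)
    {p : CotangentBundle n M} (hp : p.proj ∈ φ.source) (i : Fin n) :
    inducedDiff φ p (dQ φ i p) = (stdVec i, 0) :=
  (isInvertible_inducedDiff hφ hp).self_apply_inverse _

lemma inducedDiff_dP (hφ : φ ∈ IsManifold.maximalAtlas (𝓡 n) ∞ M)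
    {p : CotangentBundle n M} (hp : p.proj ∈ φ.source) (i : Fin n) :
    inducedDiff φ p (dP φ i p) = (0, stdVec i) :=
  (isInvertible_inducedDiff hφ hp).self_apply_inverse _

lemma inducedDiff_sum {ι : Type*} (s : Finset ι) (p : CotangentBundle n M) (c : ι → ℝ)
    (ξ : ι → TangentSpace (cotangentModel n) p) :
    inducedDiff φ p (∑ i ∈ s, c i • ξ i) = ∑ i ∈ s, c i • inducedDiff φ p (ξ i) := by
  classical
  induction s using Finset.induction_on with
  | empty => exact ContinuousLinearMap.map_zero _
  | insert a s ha ih =>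
    rw [Finset.sum_insert ha, Finset.sum_insert ha, ContinuousLinearMap.map_add,
      ContinuousLinearMap.map_smul, ih]

lemma sum_smul_stdVec (b : Fin n → ℝ) : ∑ i, b i • stdVec i = WithLp.toLp 2 b := by
  ext j
  simp [stdVec, Pi.single_apply]

lemma inducedDiff_delta (g : ContMDiffRiemannianMetric (𝓡 n) ∞ (EuclideanSpace ℝ (Fin n))
      (fun x : M ↦ TangentSpace (𝓡 n) x))
    (hφ : φ ∈ IsManifold.maximalAtlas (𝓡 n) ∞ M)
    {p : CotangentBundle n M} (hp : p.proj ∈ φ.source) (i : Fin n) :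
    inducedDiff φ p (delta g φ i p) = (stdVec i, WithLp.toLp 2 (Gam0 g φ p i)) := by
  rw [delta, ContinuousLinearMap.map_add, inducedDiff_sum, inducedDiff_dQ hφ hp]
  simp only [inducedDiff_dP hφ hp]
  ext1
  · simp [Prod.fst_sum]
  · simp [Prod.snd_sum, sum_smul_stdVec]

/-- The derivative of a function given in an induced chart. -/
lemma mvfderiv_comp_inducedChart (hφ : φ ∈ IsManifold.maximalAtlas (𝓡 n) ∞ M)
    {p : CotangentBundle n M} (hp : p.proj ∈ φ.source)
    {f : EuclideanSpace ℝ (Fin n) × EuclideanSpace ℝ (Fin n) → ℝ}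
    (hf : DifferentiableAt ℝ f (inducedChart φ p)) (ξ : TangentSpace (cotangentModel n) p) :
    mvfderiv (cotangentModel n) (fun q ↦ f (inducedChart φ q)) p ξ =
      fderiv ℝ f (inducedChart φ p) (inducedDiff φ p ξ) := by
  have h := (hf.hasFDerivAt.hasMFDerivAt.comp p
    (mdifferentiableAt_inducedChart hφ hp).hasMFDerivAt).mfderiv
  exact congr($h ξ)

lemma isOpen_proj_preimage_source (φ : OpenPartialHomeomorph M (EuclideanSpace ℝ (Fin n))) :
    IsOpen {p : CotangentBundle n M | p.proj ∈ φ.source} :=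
  φ.open_source.preimage (FiberBundle.continuous_proj _ _)

end InducedChart

/-! ### The metric and its Christoffel symbols in a chart -/

section MatrixInverse

variable {n : ℕ} {E : Type*} [NormedAddCommGroup E] [NormedSpace ℝ E]

lemma contDiffAt_det {m : ℕ∞ω} {f : E → Matrix (Fin n) (Fin n) ℝ} {y : E}
    (hf : ∀ i j, ContDiffAt ℝ m (fun z ↦ f z i j) y) : ContDiffAt ℝ m (fun z ↦ (f z).det) y := by
  simp only [Matrix.det_apply]
  refine ContDiffAt.sum fun σ _ ↦ ContDiffAt.const_smul _ ?_
  exact contDiffAt_prod fun i _ ↦ hf _ _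

/-- By Cramer's rule an entry of the inverse is a quotient of determinants, hence of polynomials in
the entries. -/
lemma contDiffAt_matrix_inv {m : ℕ∞ω} {f : E → Matrix (Fin n) (Fin n) ℝ} {y : E}
    (hf : ∀ i j, ContDiffAt ℝ m (fun z ↦ f z i j) y) (hy : (f y).det ≠ 0) (i j : Fin n) :
    ContDiffAt ℝ m (fun z ↦ (f z)⁻¹ i j) y := by
  have h : ∀ z, (f z)⁻¹ i j = (f z).det⁻¹ * ((f z).updateRow j (Pi.single i 1)).det := fun z ↦ by
    rw [Matrix.inv_def, Matrix.smul_apply, Matrix.adjugate_apply, Ring.inverse_eq_inv', smul_eq_mul]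
  simp only [h]
  refine ((contDiffAt_det hf).inv hy).mul (contDiffAt_det fun a b ↦ ?_)
  by_cases ha : a = j
  · subst ha
    simpa using contDiffAt_const
  · simpa [Matrix.updateRow_ne ha] using hf a b

end MatrixInverse

/-! ### Bilinear maps on `ℝⁿ` given by their components. -/

section LinearExt

variable {n : ℕ}

lemma eq_sum_stdVec (u : EuclideanSpace ℝ (Fin n)) : u = ∑ i, u i • stdVec i := by
  rw [sum_smul_stdVec]

lemma IsLinearMap.ext_stdVec {W : Type*} [AddCommGroup W] [Module ℝ W]
    {f f' : EuclideanSpace ℝ (Fin n) → W} (hf : IsLinearMap ℝ f)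
    (hf' : IsLinearMap ℝ f') (h : ∀ i, f (stdVec i) = f' (stdVec i)) (u) : f u = f' u := by
  have : hf.mk' f = hf'.mk' f' :=
    (EuclideanSpace.basisFun (Fin n) ℝ).toBasis.ext fun i ↦ by simpa using h i
  exact congr($this u)

/-- The bilinear form with components `c`. -/
def bilinOfCoeff {W : Type*} [NormedAddCommGroup W] [NormedSpace ℝ W] (c : Fin n → Fin n → W) :
    EuclideanSpace ℝ (Fin n) →L[ℝ] EuclideanSpace ℝ (Fin n) →L[ℝ] W :=
  ∑ i, ∑ j, (EuclideanSpace.proj i : EuclideanSpace ℝ (Fin n) →L[ℝ] ℝ).smulRight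
    ((EuclideanSpace.proj j : EuclideanSpace ℝ (Fin n) →L[ℝ] ℝ).smulRight (c i j))

variable {W : Type*} [NormedAddCommGroup W] [NormedSpace ℝ W]

lemma bilinOfCoeff_apply (c : Fin n → Fin n → W) (u v : EuclideanSpace ℝ (Fin n)) :
    bilinOfCoeff c u v = ∑ i, ∑ j, (u i * v j) • c i j := by
  simp [bilinOfCoeff, mul_smul]

@[simp] lemma bilinOfCoeff_stdVec (c : Fin n → Fin n → W) (i j : Fin n) :
    bilinOfCoeff c (stdVec i) (stdVec j) = c i j := by
  simp [bilinOfCoeff_apply, stdVec]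

/-- This links component arrays to intrinsic bilinear forms: with `L` the inverse differential of a
chart, it identifies the metric in coordinates with `g.inner`. -/
lemma bilinOfCoeff_comp
    (B : EuclideanSpace ℝ (Fin n) →L[ℝ] EuclideanSpace ℝ (Fin n) →L[ℝ] W)
    (L : EuclideanSpace ℝ (Fin n) →L[ℝ] EuclideanSpace ℝ (Fin n)) (u v : EuclideanSpace ℝ (Fin n)) :
    bilinOfCoeff (fun i j ↦ B (L (stdVec i)) (L (stdVec j))) u v = B (L u) (L v) := by
  rw [bilinOfCoeff_apply]
  conv_rhs => rw [eq_sum_stdVec u]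
  rw [map_sum, map_sum, _root_.sum_apply]
  refine Finset.sum_congr rfl fun i _ ↦ ?_
  conv_rhs => rw [eq_sum_stdVec v]
  simp only [mul_smul, map_sum, map_smul, _root_.smul_apply]
  exact Finset.sum_congr rfl fun j _ ↦ smul_comm _ _ _

lemma contDiffAt_bilinOfCoeff {m : ℕ∞ω} {E : Type*} [NormedAddCommGroup E] [NormedSpace ℝ E]
    {c : E → Fin n → Fin n → W} {y : E} (hc : ∀ i j, ContDiffAt ℝ m (fun z ↦ c z i j) y) :
    ContDiffAt ℝ m (fun z ↦ bilinOfCoeff (c z)) y := by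
  refine ContDiffAt.sum fun i _ ↦ ContDiffAt.sum fun j _ ↦ ?_
  exact contDiffAt_const.smulRight (contDiffAt_const.smulRight (hc i j))

end LinearExt

/-! ### Metric, Christoffel symbols and curvature as fields of multilinear maps in a chart. -/

section Chart

variable {n : ℕ} {M : Type*} [TopologicalSpace M] [ChartedSpace (EuclideanSpace ℝ (Fin n)) M]
  [IsManifold (𝓡 n) ∞ M]
  (g : ContMDiffRiemannianMetric (𝓡 n) ∞ (EuclideanSpace ℝ (Fin n))
      (fun x : M ↦ TangentSpace (𝓡 n) x))
  {φ : OpenPartialHomeomorph M (EuclideanSpace ℝ (Fin n))}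

variable (φ) in
/-- The metric in the chart `φ`, as a field of bilinear forms. -/
def metricMap (y : EuclideanSpace ℝ (Fin n)) :
    EuclideanSpace ℝ (Fin n) →L[ℝ] EuclideanSpace ℝ (Fin n) →L[ℝ] ℝ :=
  bilinOfCoeff fun i j ↦ metricCoeff g φ y i j

variable (φ) in
/-- The Christoffel symbols in the chart `φ`, as a field of bilinear maps. -/
def christoffelMap (y : EuclideanSpace ℝ (Fin n)) :
    EuclideanSpace ℝ (Fin n) →L[ℝ] EuclideanSpace ℝ (Fin n) →L[ℝ] EuclideanSpace ℝ (Fin n) :=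
  bilinOfCoeff fun i j ↦ WithLp.toLp 2 fun k ↦ christoffel g φ k i j y

lemma metricCoeff_symm (y : EuclideanSpace ℝ (Fin n)) (i j : Fin n) :
    metricCoeff g φ y i j = metricCoeff g φ y j i :=
  g.symm _ _ _

/-- No condition on `y` is needed: `ContinuousLinearMap.inverse` is linear even where the
differential is not invertible. Symmetry of `metricMap` therefore holds everywhere. -/
lemma metricMap_eq_inner (y u v : EuclideanSpace ℝ (Fin n)) :
    metricMap g φ y u v = g.inner (φ.symm y) ((mfderiv (𝓡 n) (𝓡 n) φ (φ.symm y)).inverse u)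
      ((mfderiv (𝓡 n) (𝓡 n) φ (φ.symm y)).inverse v) := by
  exact bilinOfCoeff_comp (g.inner (φ.symm y)) (mfderiv (𝓡 n) (𝓡 n) φ (φ.symm y)).inverse u v

variable {y : EuclideanSpace ℝ (Fin n)}

lemma metricMap_pos (hφ : φ ∈ IsManifold.maximalAtlas (𝓡 n) ∞ M) (hy : y ∈ φ.target)
    {u : EuclideanSpace ℝ (Fin n)} (hu : u ≠ 0) : 0 < metricMap g φ y u u := by
  rw [metricMap_eq_inner]
  refine g.pos _ _ fun h ↦ hu ?_
  exact ((isInvertible_mfderiv_chart hφ (φ.map_target hy)).self_apply_inverse u).symm.trans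
    ((congrArg (mfderiv (𝓡 n) (𝓡 n) φ (φ.symm y)) h).trans (ContinuousLinearMap.map_zero _))

lemma metricMap_toLp (c d : Fin n → ℝ) :
    metricMap g φ y (WithLp.toLp 2 c) (WithLp.toLp 2 d) = c ⬝ᵥ (metricCoeff g φ y).mulVec d := by
  simp only [metricMap, bilinOfCoeff_apply, dotProduct, Matrix.mulVec, Finset.mul_sum, smul_eq_mul]
  exact Finset.sum_congr rfl fun i _ ↦ Finset.sum_congr rfl fun j _ ↦ by ring

/-- A vector in the kernel of the Gram matrix would have length zero, against positivity. -/
lemma isUnit_metricCoeff (hφ : φ ∈ IsManifold.maximalAtlas (𝓡 n) ∞ M) (hy : y ∈ φ.target) :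
    IsUnit (metricCoeff g φ y) := by
  rw [← Matrix.mulVec_injective_iff_isUnit]
  refine (injective_iff_map_eq_zero (metricCoeff g φ y).mulVecLin).2 fun c hc ↦ ?_
  by_contra hne
  have h := metricMap_pos g hφ hy (u := WithLp.toLp 2 c) (by simpa using hne)
  rw [metricMap_toLp] at h
  simp only [Matrix.mulVecLin_apply] at hc
  simp [hc] at h

lemma det_metricCoeff_ne_zero (hφ : φ ∈ IsManifold.maximalAtlas (𝓡 n) ∞ M) (hy : y ∈ φ.target) :
    (metricCoeff g φ y).det ≠ 0 :=
  ((Matrix.isUnit_iff_isUnit_det _).1 (isUnit_metricCoeff g hφ hy)).ne_zero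

lemma contDiffAt_metricCoeff_inv (hφ : φ ∈ IsManifold.maximalAtlas (𝓡 n) ∞ M)
    (hy : y ∈ φ.target) (i j : Fin n) :
    ContDiffAt ℝ ∞ (fun z ↦ (metricCoeff g φ z)⁻¹ i j) y :=
  contDiffAt_matrix_inv (fun i j ↦ contMDiffAt_metricCoeff g hφ hy i j)
    (det_metricCoeff_ne_zero g hφ hy) i j

lemma contDiffAt_pderiv {f : EuclideanSpace ℝ (Fin n) → ℝ} (hf : ContDiffAt ℝ ∞ f y) (i : Fin n) :
    ContDiffAt ℝ ∞ (pderiv f i) y :=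
  (hf.fderiv_right (m := ∞) (by simp)).clm_apply contDiffAt_const

lemma contDiffAt_christoffel (hφ : φ ∈ IsManifold.maximalAtlas (𝓡 n) ∞ M)
    (hy : y ∈ φ.target) (k i j : Fin n) :
    ContDiffAt ℝ ∞ (christoffel g φ k i j) y := by
  have h := fun i j k ↦ contDiffAt_pderiv (contMDiffAt_metricCoeff g hφ hy i j) k
  refine contDiffAt_const.mul (ContDiffAt.sum fun l _ ↦ ?_)
  exact (contDiffAt_metricCoeff_inv g hφ hy k l).mul (((h j l i).add (h i l j)).sub (h i j l))

lemma contDiffAt_curvature (hφ : φ ∈ IsManifold.maximalAtlas (𝓡 n) ∞ M)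
    (hy : y ∈ φ.target) (h k i j : Fin n) :
    ContDiffAt ℝ ∞ (curvature g φ h k i j) y := by
  have hc := contDiffAt_christoffel g hφ hy
  refine ((contDiffAt_pderiv (hc _ _ _) _).sub (contDiffAt_pderiv (hc _ _ _) _)).add
    (ContDiffAt.sum fun l _ ↦ ?_)
  exact ((hc _ _ _).mul (hc _ _ _)).sub ((hc _ _ _).mul (hc _ _ _))

lemma contDiffAt_metricMap (hφ : φ ∈ IsManifold.maximalAtlas (𝓡 n) ∞ M) (hy : y ∈ φ.target) :
    ContDiffAt ℝ ∞ (metricMap g φ) y :=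
  contDiffAt_bilinOfCoeff (contMDiffAt_metricCoeff g hφ hy)

lemma contDiffAt_christoffelMap (hφ : φ ∈ IsManifold.maximalAtlas (𝓡 n) ∞ M)
    (hy : y ∈ φ.target) : ContDiffAt ℝ ∞ (christoffelMap g φ) y := by
  refine contDiffAt_bilinOfCoeff fun i j ↦ ?_
  exact (EuclideanSpace.equiv (Fin n) ℝ).symm.contDiff.contDiffAt.comp y
    (contDiffAt_pi.2 fun k ↦ contDiffAt_christoffel g hφ hy k i j)

lemma fderiv_metricMap_stdVec (hφ : φ ∈ IsManifold.maximalAtlas (𝓡 n) ∞ M) (hy : y ∈ φ.target)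
    (u : EuclideanSpace ℝ (Fin n)) (j l : Fin n) :
    fderiv ℝ (metricMap g φ) y u (stdVec j) (stdVec l) =
      fderiv ℝ (fun z ↦ metricCoeff g φ z j l) y u := by
  have hd := ((contDiffAt_metricMap g hφ hy).differentiableAt (by simp)).hasFDerivAt
  have h := (hd.clm_apply (hasFDerivAt_const (stdVec j) y)).clm_apply
    (hasFDerivAt_const (stdVec l) y)
  simp only [metricMap, bilinOfCoeff_stdVec] at h
  rw [h.fderiv]
  simp

lemma fderiv_christoffelMap_stdVec (hφ : φ ∈ IsManifold.maximalAtlas (𝓡 n) ∞ M)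
    (hy : y ∈ φ.target) (u : EuclideanSpace ℝ (Fin n)) (j k h : Fin n) :
    fderiv ℝ (christoffelMap g φ) y u (stdVec j) (stdVec k) h =
      fderiv ℝ (christoffel g φ h j k) y u := by
  have hd := ((contDiffAt_christoffelMap g hφ hy).differentiableAt (by simp)).hasFDerivAt
  have h1 := (EuclideanSpace.proj h : EuclideanSpace ℝ (Fin n) →L[ℝ] ℝ).hasFDerivAt.comp y
    ((hd.clm_apply (hasFDerivAt_const (stdVec j) y)).clm_apply (hasFDerivAt_const (stdVec k) y))
  have h2 : ((EuclideanSpace.proj h : EuclideanSpace ℝ (Fin n) →L[ℝ] ℝ) ∘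
      fun z ↦ christoffelMap g φ z (stdVec j) (stdVec k)) = christoffel g φ h j k := by
    funext z
    simp [christoffelMap]
  rw [h2] at h1
  rw [h1.fderiv]
  simp

/-- Lowering the upper index cancels the inverse matrix in the definition of the Christoffel
symbols, leaving Koszul's expression on coordinate vectors. -/
lemma sum_metricCoeff_christoffel (hφ : φ ∈ IsManifold.maximalAtlas (𝓡 n) ∞ M)
    (hy : y ∈ φ.target) (i j l : Fin n) :
    ∑ k, metricCoeff g φ y l k * christoffel g φ k i j y =
      1 / 2 * (pderiv (fun z ↦ metricCoeff g φ z j l) i y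
        + pderiv (fun z ↦ metricCoeff g φ z i l) j y
        - pderiv (fun z ↦ metricCoeff g φ z i j) l y) := by
  set c : Fin n → ℝ := fun l ↦ pderiv (fun z ↦ metricCoeff g φ z j l) i y
        + pderiv (fun z ↦ metricCoeff g φ z i l) j y
        - pderiv (fun z ↦ metricCoeff g φ z i j) l y
  have h : ∀ k, christoffel g φ k i j y = 1 / 2 * ((metricCoeff g φ y)⁻¹.mulVec c) k :=
    fun k ↦ rfl
  have h2 : (metricCoeff g φ y).mulVec ((metricCoeff g φ y)⁻¹.mulVec c) = c := by
    rw [Matrix.mulVec_mulVec, Matrix.mul_nonsing_inv _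
      ((Matrix.isUnit_iff_isUnit_det _).1 (isUnit_metricCoeff g hφ hy)), Matrix.one_mulVec]
  have h3 := congrFun h2 l
  simp only [h]
  change _ = 1 / 2 * c l
  rw [← h3]
  simp only [Matrix.mulVec, dotProduct, Finset.mul_sum]
  exact Finset.sum_congr rfl fun k _ ↦ Finset.sum_congr rfl fun m _ ↦ by ring

lemma metricMap_symm (u v : EuclideanSpace ℝ (Fin n)) :
    metricMap g φ y u v = metricMap g φ y v u := by
  rw [metricMap_eq_inner, metricMap_eq_inner, g.symm]

/-- Both sides of Koszul's identity are trilinear, so it need only be checked on basis vectors,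
where it is `sum_metricCoeff_christoffel`. -/
theorem isLocalMetric_metricMap (hφ : φ ∈ IsManifold.maximalAtlas (𝓡 n) ∞ M) :
    IsLocalMetric (metricMap g φ) (christoffelMap g φ) φ.target where
  isOpen := φ.open_target
  contDiffOn := fun _ hy ↦ (contDiffAt_metricMap g hφ hy).contDiffWithinAt
  contDiffOn_christoffel := fun _ hy ↦ (contDiffAt_christoffelMap g hφ hy).contDiffWithinAt
  symm := fun _ _ u v ↦ metricMap_symm g u v
  nondegenerate := fun y hy v hv ↦ by
    by_contra hne
    exact (metricMap_pos g hφ hy hne).ne' (hv v)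
  koszul := fun y hy u v w ↦ by
    revert u
    refine IsLinearMap.ext_stdVec ⟨by simp, by simp⟩
      ⟨fun _ _ ↦ ?_, fun _ _ ↦ ?_⟩ fun i ↦ ?_
    · simp only [map_add, _root_.add_apply]; ring
    · simp only [map_smul, _root_.smul_apply, smul_eq_mul]; ring
    revert v
    refine IsLinearMap.ext_stdVec ⟨by simp, by simp⟩
      ⟨fun _ _ ↦ ?_, fun _ _ ↦ ?_⟩ fun j ↦ ?_
    · simp only [map_add, _root_.add_apply]; ring
    · simp only [map_smul, _root_.smul_apply, smul_eq_mul]; ring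
    revert w
    refine IsLinearMap.ext_stdVec ⟨by simp, by simp⟩
      ⟨fun _ _ ↦ ?_, fun _ _ ↦ ?_⟩ fun l ↦ ?_
    · simp only [map_add, _root_.add_apply]; ring
    · simp only [map_smul, _root_.smul_apply, smul_eq_mul]; ring
    rw [fderiv_metricMap_stdVec g hφ hy, fderiv_metricMap_stdVec g hφ hy,
      fderiv_metricMap_stdVec g hφ hy, metricMap_symm]
    refine Eq.trans ?_ (sum_metricCoeff_christoffel g hφ hy i j l)
    rw [christoffelMap, bilinOfCoeff_stdVec, ← sum_smul_stdVec, map_sum]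
    refine Finset.sum_congr rfl fun k _ ↦ ?_
    rw [map_smul, metricMap, bilinOfCoeff_stdVec, smul_eq_mul, mul_comm]

lemma curvatureMap_stdVec (hφ : φ ∈ IsManifold.maximalAtlas (𝓡 n) ∞ M)
    (hy : y ∈ φ.target) (h k i j : Fin n) :
    curvatureMap (christoffelMap g φ) y (stdVec i) (stdVec j) (stdVec k) h =
      curvature g φ h k i j y := by
  have hc : ∀ i (u : EuclideanSpace ℝ (Fin n)), christoffelMap g φ y (stdVec i) u h =
      ∑ l, christoffel g φ h i l y * u l := fun i u ↦ by
    conv_lhs => rw [eq_sum_stdVec u]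
    simp only [map_sum, map_smul, christoffelMap, bilinOfCoeff_stdVec, WithLp.ofLp_sum,
      Finset.sum_apply, PiLp.smul_apply, smul_eq_mul]
    exact Finset.sum_congr rfl fun l _ ↦ mul_comm _ _
  simp only [curvatureMap, PiLp.add_apply, PiLp.sub_apply, fderiv_christoffelMap_stdVec g hφ hy, hc]
  simp only [christoffelMap, bilinOfCoeff_stdVec, curvature, Finset.sum_sub_distrib, pderiv]
  ring

end Chart

/-! ### Change of charts -/

/-- A change of charts is defined on the overlap only, so the metric of the source chart has to be
restricted to it. -/
lemma IsLocalMetric.mono {E : Type*} [NormedAddCommGroup E] [NormedSpace ℝ E]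
    {γ : E → E →L[ℝ] E →L[ℝ] ℝ} {Γ : E → E →L[ℝ] E →L[ℝ] E} {U V : Set E}
    (h : IsLocalMetric γ Γ U) (hV : IsOpen V) (hVU : V ⊆ U) : IsLocalMetric γ Γ V where
  isOpen := hV
  contDiffOn := h.contDiffOn.mono hVU
  contDiffOn_christoffel := h.contDiffOn_christoffel.mono hVU
  symm := fun y hy ↦ h.symm y (hVU hy)
  nondegenerate := fun y hy ↦ h.nondegenerate y (hVU hy)
  koszul := fun y hy ↦ h.koszul y (hVU hy)

section Change

variable {n : ℕ} {M : Type*} [TopologicalSpace M] [ChartedSpace (EuclideanSpace ℝ (Fin n)) M]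
  {φ ψ : OpenPartialHomeomorph M (EuclideanSpace ℝ (Fin n))}

variable (φ ψ) in
/-- The change of coordinates from the chart `φ` to the chart `ψ`. -/
def transition (y : EuclideanSpace ℝ (Fin n)) : EuclideanSpace ℝ (Fin n) := ψ (φ.symm y)

variable (φ ψ) in
/-- The domain of the change of coordinates from `φ` to `ψ`. -/
def overlap : Set (EuclideanSpace ℝ (Fin n)) := (φ.symm.trans ψ).source

omit [ChartedSpace (EuclideanSpace ℝ (Fin n)) M] in
lemma mem_overlap {y : EuclideanSpace ℝ (Fin n)} :
    y ∈ overlap φ ψ ↔ y ∈ φ.target ∧ φ.symm y ∈ ψ.source := by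
  simp [overlap]

omit [ChartedSpace (EuclideanSpace ℝ (Fin n)) M] in
lemma isOpen_overlap : IsOpen (overlap φ ψ) := (φ.symm.trans ψ).open_source

omit [ChartedSpace (EuclideanSpace ℝ (Fin n)) M] in
lemma mem_overlap_of_mem {x : M} (hx : x ∈ φ.source) (hx' : x ∈ ψ.source) :
    φ x ∈ overlap φ ψ :=
  mem_overlap.2 ⟨φ.map_source hx, by rwa [φ.left_inv hx]⟩

omit [ChartedSpace (EuclideanSpace ℝ (Fin n)) M] in
lemma transition_apply {x : M} (hx : x ∈ φ.source) : transition φ ψ (φ x) = ψ x := by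
  rw [transition, φ.left_inv hx]

lemma contDiffOn_transition (hφ : φ ∈ IsManifold.maximalAtlas (𝓡 n) ∞ M)
    (hψ : ψ ∈ IsManifold.maximalAtlas (𝓡 n) ∞ M) :
    ContDiffOn ℝ ∞ (transition φ ψ) (overlap φ ψ) := fun y hy ↦ by
  obtain ⟨h1, h2⟩ := mem_overlap.1 hy
  have h3 : ContMDiffAt 𝓘(ℝ, EuclideanSpace ℝ (Fin n)) 𝓘(ℝ, EuclideanSpace ℝ (Fin n)) ∞
      (transition φ ψ) y :=
    (contMDiffAt_of_mem_maximalAtlas hψ h2).comp y (contMDiffAt_symm_of_mem_maximalAtlas hφ h1)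
  exact (contMDiffAt_iff_contDiffAt.1 h3).contDiffWithinAt

lemma contDiffAt_transition (hφ : φ ∈ IsManifold.maximalAtlas (𝓡 n) ∞ M)
    (hψ : ψ ∈ IsManifold.maximalAtlas (𝓡 n) ∞ M) {y : EuclideanSpace ℝ (Fin n)}
    (hy : y ∈ overlap φ ψ) : ContDiffAt ℝ ∞ (transition φ ψ) y :=
  (contDiffOn_transition hφ hψ).contDiffAt (isOpen_overlap.mem_nhds hy)

/-- Chain rule for `ψ`, which equals `transition φ ψ ∘ φ` near `x`. -/
lemma fderiv_transition (hφ : φ ∈ IsManifold.maximalAtlas (𝓡 n) ∞ M)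
    (hψ : ψ ∈ IsManifold.maximalAtlas (𝓡 n) ∞ M) {x : M} (hx : x ∈ φ.source)
    (hx' : x ∈ ψ.source) (v : TangentSpace (𝓡 n) x) :
    fderiv ℝ (transition φ ψ) (φ x) (mfderiv (𝓡 n) (𝓡 n) φ x v) =
      mfderiv (𝓡 n) (𝓡 n) ψ x v := by
  have h1 : HasMFDerivAt (𝓡 n) (𝓡 n) φ x (mfderiv (𝓡 n) (𝓡 n) φ x) :=
    ((mdifferentiable_chart hφ).mdifferentiableAt hx).hasMFDerivAt
  have h2 := ((contDiffAt_transition hφ hψ (mem_overlap_of_mem hx hx')).differentiableAt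
    (by simp)).hasFDerivAt.hasMFDerivAt
  have h3 : ψ =ᶠ[𝓝 x] (transition φ ψ) ∘ φ := by
    filter_upwards [φ.open_source.mem_nhds hx] with z hz
    exact (transition_apply hz).symm
  have h4 := (h2.comp x h1).congr_of_eventuallyEq h3
  exact (congr($(h4.mfderiv) v)).symm

lemma fderiv_transition_coordVec (hφ : φ ∈ IsManifold.maximalAtlas (𝓡 n) ∞ M)
    (hψ : ψ ∈ IsManifold.maximalAtlas (𝓡 n) ∞ M) {x : M} (hx : x ∈ φ.source)
    (hx' : x ∈ ψ.source) (u : EuclideanSpace ℝ (Fin n)) :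
    fderiv ℝ (transition φ ψ) (φ x) u =
      mfderiv (𝓡 n) (𝓡 n) ψ x ((mfderiv (𝓡 n) (𝓡 n) φ x).inverse u) := by
  rw [← fderiv_transition hφ hψ hx hx']
  exact congrArg _ ((isInvertible_mfderiv_chart hφ hx).self_apply_inverse u).symm

lemma fderiv_transition_fderiv_transition (hφ : φ ∈ IsManifold.maximalAtlas (𝓡 n) ∞ M)
    (hψ : ψ ∈ IsManifold.maximalAtlas (𝓡 n) ∞ M) {x : M} (hx : x ∈ φ.source)
    (hx' : x ∈ ψ.source) (u : EuclideanSpace ℝ (Fin n)) :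
    fderiv ℝ (transition φ ψ) (φ x) (fderiv ℝ (transition ψ φ) (ψ x) u) = u := by
  rw [fderiv_transition_coordVec hψ hφ hx' hx]
  exact (fderiv_transition hφ hψ hx hx' _).trans
    ((isInvertible_mfderiv_chart hψ hx').self_apply_inverse u)

lemma surjective_fderiv_transition (hφ : φ ∈ IsManifold.maximalAtlas (𝓡 n) ∞ M)
    (hψ : ψ ∈ IsManifold.maximalAtlas (𝓡 n) ∞ M) {y : EuclideanSpace ℝ (Fin n)}
    (hy : y ∈ overlap φ ψ) : Function.Surjective (fderiv ℝ (transition φ ψ) y) := fun u ↦ by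
  obtain ⟨h1, h2⟩ := mem_overlap.1 hy
  have h := fderiv_transition_fderiv_transition hφ hψ (φ.map_target h1) h2 u
  rw [φ.right_inv h1] at h
  exact ⟨_, h⟩

lemma jacobian_eq (hφ : φ ∈ IsManifold.maximalAtlas (𝓡 n) ∞ M)
    (hψ : ψ ∈ IsManifold.maximalAtlas (𝓡 n) ∞ M) {x : M} (hx : x ∈ φ.source)
    (hx' : x ∈ ψ.source) (i a : Fin n) :
    jacobian φ ψ x i a = fderiv ℝ (transition φ ψ) (φ x) (stdVec a) i := by
  have h1 := (EuclideanSpace.proj i : EuclideanSpace ℝ (Fin n) →L[ℝ] ℝ).hasFDerivAt.comp (φ x)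
    ((contDiffAt_transition hφ hψ (mem_overlap_of_mem hx hx')).differentiableAt
      (by simp)).hasFDerivAt
  exact congr($(h1.fderiv) (stdVec a))

lemma fderiv_transition_stdVec (hφ : φ ∈ IsManifold.maximalAtlas (𝓡 n) ∞ M)
    (hψ : ψ ∈ IsManifold.maximalAtlas (𝓡 n) ∞ M) {x : M} (hx : x ∈ φ.source)
    (hx' : x ∈ ψ.source) (a : Fin n) :
    fderiv ℝ (transition φ ψ) (φ x) (stdVec a) = ∑ i, jacobian φ ψ x i a • stdVec i := by
  rw [sum_smul_stdVec]
  ext i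
  exact (jacobian_eq hφ hψ hx hx' i a).symm

/-- Trilinear expansion; the order of summation, with the index of the third argument outermost, is
that of the lower indices of `R0`. -/
lemma curvatureMap_sum (Γ : EuclideanSpace ℝ (Fin n) → EuclideanSpace ℝ (Fin n) →L[ℝ]
    EuclideanSpace ℝ (Fin n) →L[ℝ] EuclideanSpace ℝ (Fin n)) (y : EuclideanSpace ℝ (Fin n))
    (L : EuclideanSpace ℝ (Fin n) →L[ℝ] ℝ) (u v w : Fin n → ℝ) :
    L (curvatureMap Γ y (∑ i, u i • stdVec i) (∑ i, v i • stdVec i) (∑ i, w i • stdVec i)) =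
      ∑ a, ∑ b, ∑ c, w a * u b * v c *
        L (curvatureMap Γ y (stdVec b) (stdVec c) (stdVec a)) := by
  have h1 : ∀ u v, curvatureMap Γ y u v (∑ i, w i • stdVec i) =
      ∑ a, w a • curvatureMap Γ y u v (stdVec a) := fun u v ↦ by
    simp only [curvatureMap, map_sum, map_smul, smul_add, smul_sub, Finset.sum_add_distrib,
      Finset.sum_sub_distrib]
  have h2 : ∀ v x, curvatureMap Γ y (∑ i, u i • stdVec i) v x =
      ∑ b, u b • curvatureMap Γ y (stdVec b) v x := fun v x ↦ by
    simp only [curvatureMap, map_sum, map_smul, smul_add, smul_sub, Finset.sum_add_distrib,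
      Finset.sum_sub_distrib, _root_.sum_apply, _root_.smul_apply]
  have h3 : ∀ u x, curvatureMap Γ y u (∑ i, v i • stdVec i) x =
      ∑ c, v c • curvatureMap Γ y u (stdVec c) x := fun u x ↦ by
    simp only [curvatureMap, map_sum, map_smul, smul_add, smul_sub, Finset.sum_add_distrib,
      Finset.sum_sub_distrib, _root_.sum_apply, _root_.smul_apply]
  simp only [h1, h2, h3, map_sum, map_smul, smul_eq_mul, Finset.mul_sum, mul_assoc]

lemma sum_jacobian_mul (hφ : φ ∈ IsManifold.maximalAtlas (𝓡 n) ∞ M)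
    (hψ : ψ ∈ IsManifold.maximalAtlas (𝓡 n) ∞ M) {x : M} (hx : x ∈ φ.source)
    (hx' : x ∈ ψ.source) (i j : Fin n) :
    ∑ a, jacobian φ ψ x i a * jacobian ψ φ x a j = if i = j then 1 else 0 := by
  have h := congr($(fderiv_transition_fderiv_transition hφ hψ hx hx' (stdVec j)) i)
  rw [fderiv_transition_stdVec hψ hφ hx' hx, map_sum, WithLp.ofLp_sum, Finset.sum_apply] at h
  simp only [map_smul, PiLp.smul_apply, smul_eq_mul, ← jacobian_eq hφ hψ hx hx'] at h
  rw [Finset.sum_congr rfl fun a _ ↦ mul_comm _ _, h]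
  simp [stdVec]

lemma coordVec_change (hφ : φ ∈ IsManifold.maximalAtlas (𝓡 n) ∞ M)
    (hψ : ψ ∈ IsManifold.maximalAtlas (𝓡 n) ∞ M) {x : M} (hx : x ∈ φ.source)
    (hx' : x ∈ ψ.source) (u : EuclideanSpace ℝ (Fin n)) :
    (mfderiv (𝓡 n) (𝓡 n) ψ x).inverse (fderiv ℝ (transition φ ψ) (φ x) u) =
      (mfderiv (𝓡 n) (𝓡 n) φ x).inverse u := by
  rw [fderiv_transition_coordVec hφ hψ hx hx']
  exact (isInvertible_mfderiv_chart hψ hx').inverse_apply_self _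

variable [IsManifold (𝓡 n) ∞ M]
  (g : ContMDiffRiemannianMetric (𝓡 n) ∞ (EuclideanSpace ℝ (Fin n))
      (fun x : M ↦ TangentSpace (𝓡 n) x))

lemma metricMap_eq_inner_of_mem {x : M} (hx : x ∈ φ.source) (u v : EuclideanSpace ℝ (Fin n)) :
    metricMap g φ (φ x) u v = g.inner x ((mfderiv (𝓡 n) (𝓡 n) φ x).inverse u)
      ((mfderiv (𝓡 n) (𝓡 n) φ x).inverse v) := by
  -- The point `φ.symm (φ x)` equals `x` only propositionally and the tangent spaces depend on it,
  -- so the statement is generalized to a point `x' = x` before substituting.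
  have h : ∀ x', x' = x → metricMap g φ (φ x) u v =
      g.inner x' ((mfderiv (𝓡 n) (𝓡 n) φ x').inverse u)
        ((mfderiv (𝓡 n) (𝓡 n) φ x').inverse v) →
      metricMap g φ (φ x) u v = g.inner x ((mfderiv (𝓡 n) (𝓡 n) φ x).inverse u)
        ((mfderiv (𝓡 n) (𝓡 n) φ x).inverse v) := by
    rintro _ rfl h
    exact h
  exact h _ (φ.left_inv hx) (metricMap_eq_inner g _ u v)

lemma metricMap_change_of_mem (hφ : φ ∈ IsManifold.maximalAtlas (𝓡 n) ∞ M)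
    (hψ : ψ ∈ IsManifold.maximalAtlas (𝓡 n) ∞ M) {x : M} (hx : x ∈ φ.source)
    (hx' : x ∈ ψ.source) (u v : EuclideanSpace ℝ (Fin n)) :
    metricMap g φ (φ x) u v = metricMap g ψ (ψ x) (fderiv ℝ (transition φ ψ) (φ x) u)
      (fderiv ℝ (transition φ ψ) (φ x) v) := by
  rw [metricMap_eq_inner_of_mem g hx, metricMap_eq_inner_of_mem g hx',
    coordVec_change hφ hψ hx hx', coordVec_change hφ hψ hx hx']

lemma metricMap_change (hφ : φ ∈ IsManifold.maximalAtlas (𝓡 n) ∞ M)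
    (hψ : ψ ∈ IsManifold.maximalAtlas (𝓡 n) ∞ M) {y : EuclideanSpace ℝ (Fin n)}
    (hy : y ∈ overlap φ ψ) (u v : EuclideanSpace ℝ (Fin n)) :
    metricMap g φ y u v = metricMap g ψ (transition φ ψ y) (fderiv ℝ (transition φ ψ) y u)
      (fderiv ℝ (transition φ ψ) y v) := by
  obtain ⟨h1, h2⟩ := mem_overlap.1 hy
  have h := metricMap_change_of_mem g hφ hψ (φ.map_target h1) h2 u v
  rwa [φ.right_inv h1] at h

/-- A change of charts is an isometry between the two coordinate metrics, so the general law applies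
on the overlap. -/
lemma christoffelMap_change (hφ : φ ∈ IsManifold.maximalAtlas (𝓡 n) ∞ M)
    (hψ : ψ ∈ IsManifold.maximalAtlas (𝓡 n) ∞ M) {y : EuclideanSpace ℝ (Fin n)}
    (hy : y ∈ overlap φ ψ) (u v : EuclideanSpace ℝ (Fin n)) :
    fderiv ℝ (transition φ ψ) y (christoffelMap g φ y u v) =
      fderiv ℝ (fderiv ℝ (transition φ ψ)) y u v
        + christoffelMap g ψ (transition φ ψ y) (fderiv ℝ (transition φ ψ) y u)
          (fderiv ℝ (transition φ ψ) y v) :=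
  ((isLocalMetric_metricMap g hφ).mono isOpen_overlap fun _ h ↦ (mem_overlap.1 h).1
    ).christoffel_change (isLocalMetric_metricMap g hψ) (contDiffOn_transition hφ hψ)
    (fun _ h ↦ ψ.map_source (mem_overlap.1 h).2)
    (fun _ h ↦ surjective_fderiv_transition hφ hψ h) (fun _ h ↦ metricMap_change g hφ hψ h) hy u v

lemma curvatureMap_change (hφ : φ ∈ IsManifold.maximalAtlas (𝓡 n) ∞ M)
    (hψ : ψ ∈ IsManifold.maximalAtlas (𝓡 n) ∞ M) {y : EuclideanSpace ℝ (Fin n)}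
    (hy : y ∈ overlap φ ψ) (u v w : EuclideanSpace ℝ (Fin n)) :
    fderiv ℝ (transition φ ψ) y (curvatureMap (christoffelMap g φ) y u v w) =
      curvatureMap (christoffelMap g ψ) (transition φ ψ y) (fderiv ℝ (transition φ ψ) y u)
        (fderiv ℝ (transition φ ψ) y v) (fderiv ℝ (transition φ ψ) y w) :=
  ((isLocalMetric_metricMap g hφ).mono isOpen_overlap fun _ h ↦ (mem_overlap.1 h).1
    ).curvature_change (isLocalMetric_metricMap g hψ) (contDiffOn_transition hφ hψ)
    (fun _ h ↦ ψ.map_source (mem_overlap.1 h).2)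
    (fun _ h ↦ surjective_fderiv_transition hφ hψ h) (fun _ h ↦ metricMap_change g hφ hψ h)
    hy u v w

/-! ### Change of induced charts -/

/-- The covector `p` in the coordinates of the chart `φ`. -/
def momForm (φ : OpenPartialHomeomorph M (EuclideanSpace ℝ (Fin n))) (p : CotangentBundle n M) :
    EuclideanSpace ℝ (Fin n) →L[ℝ] ℝ :=
  ∑ h, mom φ p h • (EuclideanSpace.proj h : EuclideanSpace ℝ (Fin n) →L[ℝ] ℝ)

lemma momForm_apply (p : CotangentBundle n M) (w : EuclideanSpace ℝ (Fin n)) :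
    momForm φ p w = ∑ h, mom φ p h * w h := by
  simp [momForm]

lemma momForm_stdVec (p : CotangentBundle n M) (i : Fin n) :
    momForm φ p (stdVec i) = mom φ p i := by
  simp [momForm_apply, stdVec]

/-- Linearity of the covector; this intrinsic form makes the invariance under a change of charts
immediate. -/
lemma momForm_eq (p : CotangentBundle n M) (w : EuclideanSpace ℝ (Fin n)) :
    momForm φ p w = p.2 ((mfderiv (𝓡 n) (𝓡 n) φ p.proj).inverse w) := by
  have key : ∀ (A : EuclideanSpace ℝ (Fin n) →L[ℝ] EuclideanSpace ℝ (Fin n))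
      (B : EuclideanSpace ℝ (Fin n) →L[ℝ] ℝ), ∑ h, B (A (stdVec h)) * w h = B (A w) := by
    intro A B
    conv_rhs => rw [eq_sum_stdVec w]
    simp [mul_comm]
  rw [momForm_apply]
  exact key _ _

lemma momForm_change (hφ : φ ∈ IsManifold.maximalAtlas (𝓡 n) ∞ M)
    (hψ : ψ ∈ IsManifold.maximalAtlas (𝓡 n) ∞ M) {p : CotangentBundle n M}
    (hp : p.proj ∈ φ.source) (hp' : p.proj ∈ ψ.source) (w : EuclideanSpace ℝ (Fin n)) :
    momForm ψ p (fderiv ℝ (transition φ ψ) (φ p.proj) w) = momForm φ p w := by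
  rw [momForm_eq, momForm_eq, coordVec_change hφ hψ hp hp']

lemma mom_change (hφ : φ ∈ IsManifold.maximalAtlas (𝓡 n) ∞ M)
    (hψ : ψ ∈ IsManifold.maximalAtlas (𝓡 n) ∞ M) {p : CotangentBundle n M}
    (hp : p.proj ∈ φ.source) (hp' : p.proj ∈ ψ.source) (a : Fin n) :
    mom φ p a = ∑ i, jacobian φ ψ p.proj i a * mom ψ p i := by
  rw [← momForm_stdVec, ← momForm_change hφ hψ hp hp', fderiv_transition_stdVec hφ hψ hp hp',
    map_sum]
  exact Finset.sum_congr rfl fun i _ ↦ by rw [map_smul, momForm_stdVec, smul_eq_mul]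

lemma gLow_eq (p : CotangentBundle n M) (i j : Fin n) :
    gLow g φ p i j = metricMap g φ (φ p.proj) (stdVec i) (stdVec j) := by
  rw [metricMap, bilinOfCoeff_stdVec]; rfl

lemma gLow_change (hφ : φ ∈ IsManifold.maximalAtlas (𝓡 n) ∞ M)
    (hψ : ψ ∈ IsManifold.maximalAtlas (𝓡 n) ∞ M) {p : CotangentBundle n M}
    (hp : p.proj ∈ φ.source) (hp' : p.proj ∈ ψ.source) (a b : Fin n) :
    gLow g φ p a b = ∑ i, ∑ j, jacobian φ ψ p.proj i a * jacobian φ ψ p.proj j b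
      * gLow g ψ p i j := by
  rw [gLow_eq, metricMap_change_of_mem g hφ hψ hp hp', fderiv_transition_stdVec hφ hψ hp hp',
    fderiv_transition_stdVec hφ hψ hp hp', map_sum]
  rw [Finset.sum_comm]
  refine Finset.sum_congr rfl fun j _ ↦ ?_
  rw [map_sum, _root_.sum_apply]
  refine Finset.sum_congr rfl fun i _ ↦ ?_
  rw [map_smul, map_smul, _root_.smul_apply, gLow_eq, smul_eq_mul, smul_eq_mul]
  ring

/-- With `A`, `B` the mutually inverse Jacobian matrices, `g` in the chart `ψ` is `Bᵀ g B`;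
inverting gives `A g⁻¹ Aᵀ`. -/
lemma gUp_change (hφ : φ ∈ IsManifold.maximalAtlas (𝓡 n) ∞ M)
    (hψ : ψ ∈ IsManifold.maximalAtlas (𝓡 n) ∞ M) {p : CotangentBundle n M}
    (hp : p.proj ∈ φ.source) (hp' : p.proj ∈ ψ.source) (i j : Fin n) :
    gUp g ψ p i j = ∑ a, ∑ b, jacobian φ ψ p.proj i a * jacobian φ ψ p.proj j b
      * gUp g φ p a b := by
  set A : Matrix (Fin n) (Fin n) ℝ := Matrix.of (jacobian φ ψ p.proj) with hA
  set B : Matrix (Fin n) (Fin n) ℝ := Matrix.of (jacobian ψ φ p.proj) with hB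
  have hAB : A * B = 1 := by
    ext i j
    rw [Matrix.mul_apply, Matrix.one_apply]
    exact sum_jacobian_mul hφ hψ hp hp' i j
  have hg : metricCoeff g ψ (ψ p.proj) = B.transpose * metricCoeff g φ (φ p.proj) * B := by
    ext i j
    refine (gLow_change g hψ hφ hp' hp i j).trans ?_
    simp only [Matrix.mul_apply, Matrix.transpose_apply, Finset.sum_mul]
    rw [Finset.sum_comm]
    refine Finset.sum_congr rfl fun b _ ↦ Finset.sum_congr rfl fun a _ ↦ ?_
    change _ = jacobian ψ φ p.proj a i * gLow g φ p a b * jacobian ψ φ p.proj b j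
    ring
  have hBinv : B⁻¹ = A := Matrix.inv_eq_left_inv hAB
  have hinv : (metricCoeff g ψ (ψ p.proj))⁻¹ =
      A * ((metricCoeff g φ (φ p.proj))⁻¹ * A.transpose) := by
    rw [hg, Matrix.mul_inv_rev, Matrix.mul_inv_rev, ← Matrix.transpose_nonsing_inv, hBinv]
  rw [gUp, hinv]
  simp only [Matrix.mul_apply, Matrix.transpose_apply, Finset.mul_sum]
  refine Finset.sum_congr rfl fun a _ ↦ Finset.sum_congr rfl fun b _ ↦ ?_
  change jacobian φ ψ p.proj i a * (gUp g φ p a b * jacobian φ ψ p.proj j b) = _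
  ring

lemma R0_eq (hφ : φ ∈ IsManifold.maximalAtlas (𝓡 n) ∞ M) {p : CotangentBundle n M}
    (hp : p.proj ∈ φ.source) (k i j : Fin n) :
    R0 g φ p k i j = momForm φ p
      (curvatureMap (christoffelMap g φ) (φ p.proj) (stdVec i) (stdVec j) (stdVec k)) := by
  rw [momForm_apply]
  simp only [curvatureMap_stdVec g hφ (φ.map_source hp)]
  rfl

/-- The curvature is natural under the isometry given by the change of charts, and pairing with `p`
does not depend on the chart. -/
lemma R0_change (hφ : φ ∈ IsManifold.maximalAtlas (𝓡 n) ∞ M)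
    (hψ : ψ ∈ IsManifold.maximalAtlas (𝓡 n) ∞ M) {p : CotangentBundle n M}
    (hp : p.proj ∈ φ.source) (hp' : p.proj ∈ ψ.source) (k i j : Fin n) :
    R0 g φ p k i j = ∑ a, ∑ b, ∑ c, jacobian φ ψ p.proj a k * jacobian φ ψ p.proj b i
      * jacobian φ ψ p.proj c j * R0 g ψ p a b c := by
  rw [R0_eq g hφ hp, ← momForm_change hφ hψ hp hp',
    curvatureMap_change g hφ hψ (mem_overlap_of_mem hp hp'), transition_apply hp]
  simp only [fderiv_transition_stdVec hφ hψ hp hp', curvatureMap_sum, R0_eq g hψ hp']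

lemma formDq_change (hφ : φ ∈ IsManifold.maximalAtlas (𝓡 n) ∞ M)
    (hψ : ψ ∈ IsManifold.maximalAtlas (𝓡 n) ∞ M) {p : CotangentBundle n M}
    (hp : p.proj ∈ φ.source) (hp' : p.proj ∈ ψ.source) (ξ : TangentSpace (cotangentModel n) p) :
    (inducedDiff ψ p ξ).1 = fderiv ℝ (transition φ ψ) (φ p.proj) (inducedDiff φ p ξ).1 := by
  rw [fst_inducedDiff hφ hp, fst_inducedDiff hψ hp']
  exact (fderiv_transition hφ hψ hp hp' _).symm

lemma formDq_eq_sum (hφ : φ ∈ IsManifold.maximalAtlas (𝓡 n) ∞ M)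
    (hψ : ψ ∈ IsManifold.maximalAtlas (𝓡 n) ∞ M) {p : CotangentBundle n M}
    (hp : p.proj ∈ φ.source) (hp' : p.proj ∈ ψ.source) (ξ : TangentSpace (cotangentModel n) p)
    (i : Fin n) :
    formDq ψ p i ξ = ∑ a, jacobian φ ψ p.proj i a * formDq φ p a ξ := by
  rw [formDq, formDq_change hφ hψ hp hp', eq_sum_stdVec (inducedDiff φ p ξ).1, map_sum,
    WithLp.ofLp_sum, Finset.sum_apply]
  simp only [map_smul, PiLp.smul_apply, smul_eq_mul, ← jacobian_eq hφ hψ hp hp']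
  exact Finset.sum_congr rfl fun a _ ↦ mul_comm _ _

end Change

/-! ### Independence of the chart -/

/-- Here `z` stands for the coordinates of one covector in two charts at once; the function is the
right-hand side of `p_b = p'_i ∂yⁱ/∂xᵇ`. -/
lemma exists_hasFDerivAt_inner {E : Type*} [NormedAddCommGroup E] [InnerProductSpace ℝ E]
    {D : E → E →L[ℝ] E} {D' : E →L[ℝ] E →L[ℝ] E} (z : (E × E) × (E × E))
    (hD : HasFDerivAt D D' z.1.1) (w : E) :
    ∃ L : (E × E) × (E × E) →L[ℝ] ℝ,
      HasFDerivAt (fun z : (E × E) × (E × E) ↦ (inner ℝ z.2.2 (D z.1.1 w) : ℝ)) L z ∧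
        ∀ a, L a = inner ℝ a.2.2 (D z.1.1 w) + inner ℝ z.2.2 (D' a.1.1 w) := by
  have hz1 : HasFDerivAt (fun z : (E × E) × (E × E) ↦ z.1.1) _ z := (hasFDerivAt_fst (𝕜 := ℝ) (p := z)).fst
  have hz2 : HasFDerivAt (fun z : (E × E) × (E × E) ↦ z.2.2) _ z := (hasFDerivAt_snd (𝕜 := ℝ) (p := z)).snd
  have h := HasFDerivAt.comp z (g := D) (f := fun z : (E × E) × (E × E) ↦ z.1.1) hD hz1
  refine ⟨_, hz2.inner ℝ (h.clm_apply (hasFDerivAt_const w z)), fun a ↦ ?_⟩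
  simp [add_comm]

section Lift

variable {n : ℕ} {M : Type*} [TopologicalSpace M] [ChartedSpace (EuclideanSpace ℝ (Fin n)) M]
  [IsManifold (𝓡 n) ∞ M] {φ ψ : OpenPartialHomeomorph M (EuclideanSpace ℝ (Fin n))}
  (g : ContMDiffRiemannianMetric (𝓡 n) ∞ (EuclideanSpace ℝ (Fin n))
      (fun x : M ↦ TangentSpace (𝓡 n) x))

/-- The relation `p_b = p'_i ∂yⁱ/∂xᵇ` is differentiated along `ξ`. The second derivatives of the
change of charts appear because the Jacobian varies with the base point. -/
lemma inducedDiff_snd_change (hφ : φ ∈ IsManifold.maximalAtlas (𝓡 n) ∞ M)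
    (hψ : ψ ∈ IsManifold.maximalAtlas (𝓡 n) ∞ M) {p : CotangentBundle n M}
    (hp : p.proj ∈ φ.source) (hp' : p.proj ∈ ψ.source) (ξ : TangentSpace (cotangentModel n) p)
    (b : Fin n) :
    (inducedDiff φ p ξ).2 b =
      inner ℝ (inducedDiff ψ p ξ).2 (fderiv ℝ (transition φ ψ) (φ p.proj) (stdVec b))
      + momForm ψ p (fderiv ℝ (fderiv ℝ (transition φ ψ)) (φ p.proj)
        (inducedDiff φ p ξ).1 (stdVec b)) := by
  let E := EuclideanSpace ℝ (Fin n)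
  have hmom : ∀ (q : CotangentBundle n M) (w : E),
      inner ℝ (WithLp.toLp 2 (mom ψ q) : E) w = momForm ψ q w := fun q w ↦ by
    rw [momForm_apply, PiLp.inner_apply]
    exact Finset.sum_congr rfl fun i _ ↦ by simp [mul_comm]
  have hF2 : HasFDerivAt (fderiv ℝ (transition φ ψ))
      (fderiv ℝ (fderiv ℝ (transition φ ψ)) (φ p.proj)) (φ p.proj) :=
    (((contDiffAt_transition hφ hψ (mem_overlap_of_mem hp hp')).fderiv_right (m := ∞)
      (by simp)).differentiableAt (by simp)).hasFDerivAt
  have h1 : HasMFDerivAt (cotangentModel n) 𝓘(ℝ, E × E) (inducedChart φ) p (inducedDiff φ p) :=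
    (mdifferentiableAt_inducedChart hφ hp).hasMFDerivAt
  have h2 : HasMFDerivAt (cotangentModel n) 𝓘(ℝ, E × E) (inducedChart ψ) p (inducedDiff ψ p) :=
    (mdifferentiableAt_inducedChart hψ hp').hasMFDerivAt
  let f : (E × E) × (E × E) → ℝ := fun z ↦
    inner ℝ z.2.2 (fderiv ℝ (transition φ ψ) z.1.1 (stdVec b))
  obtain ⟨L, hf, hL⟩ := exists_hasFDerivAt_inner (inducedChart φ p, inducedChart ψ p) hF2
    (stdVec b)
  have h12 : HasMFDerivAt (cotangentModel n) 𝓘(ℝ, (E × E) × (E × E))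
      (fun q ↦ (inducedChart φ q, inducedChart ψ q)) p ((inducedDiff φ p).prod (inducedDiff ψ p)) :=
    ⟨h1.1.prodMk h2.1, h1.2.prodMk h2.2⟩
  have h3 := hf.hasMFDerivAt.comp p h12
  let pr : E × E →L[ℝ] ℝ :=
    (EuclideanSpace.proj b : E →L[ℝ] ℝ).comp (ContinuousLinearMap.snd ℝ E E)
  have h4 := (ContinuousLinearMap.hasFDerivAt pr (x := inducedChart φ p)).hasMFDerivAt.comp p h1
  have hev : (pr ∘ inducedChart φ : CotangentBundle n M → ℝ) =ᶠ[𝓝 p]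
      f ∘ fun q ↦ (inducedChart φ q, inducedChart ψ q) := by
    filter_upwards [(isOpen_proj_preimage_source φ).mem_nhds hp,
      (isOpen_proj_preimage_source ψ).mem_nhds hp'] with q hq hq'
    change mom φ q b = inner ℝ (WithLp.toLp 2 (mom ψ q) : E)
      (fderiv ℝ (transition φ ψ) (φ q.proj) (stdVec b))
    rw [hmom, momForm_change hφ hψ hq hq', momForm_stdVec]
  have h5 := congr($((h3.congr_of_eventuallyEq hev).mfderiv.symm.trans h4.mfderiv) ξ)
  refine h5.symm.trans ((hL _).trans ?_)
  rw [← hmom]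
  rfl

/-- The covector `Dp` of an arbitrary tangent vector `ξ`, as a linear form. -/
lemma formDp_eq (p : CotangentBundle n M) (i : Fin n) (ξ : TangentSpace (cotangentModel n) p) :
    formDp g φ p i ξ = (inducedDiff φ p ξ).2 i
      - momForm φ p (christoffelMap g φ (φ p.proj) (stdVec i) (inducedDiff φ p ξ).1) := by
  rw [formDp]
  congr 1
  conv_rhs => rw [eq_sum_stdVec (inducedDiff φ p ξ).1]
  rw [map_sum, map_sum]
  refine Finset.sum_congr rfl fun j _ ↦ ?_
  rw [map_smul, map_smul, christoffelMap, bilinOfCoeff_stdVec, momForm_apply, smul_eq_mul,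
    mul_comm]
  rfl

/-- The term with second derivatives in the law of `dp` is exactly the inhomogeneous term in the law
of the Christoffel symbols, paired with `p`. The two cancel in `Dp`, which is why the horizontal
distribution, and with it the lift, is globally defined. -/
lemma formDp_change (hφ : φ ∈ IsManifold.maximalAtlas (𝓡 n) ∞ M)
    (hψ : ψ ∈ IsManifold.maximalAtlas (𝓡 n) ∞ M) {p : CotangentBundle n M}
    (hp : p.proj ∈ φ.source) (hp' : p.proj ∈ ψ.source) (ξ : TangentSpace (cotangentModel n) p)
    (b : Fin n) :
    formDp g φ p b ξ = ∑ i, jacobian φ ψ p.proj i b * formDp g ψ p i ξ := by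
  have hy := mem_overlap_of_mem hp hp'
  rw [formDp_eq, inducedDiff_snd_change hφ hψ hp hp',
    (isLocalMetric_metricMap g hφ).christoffel_symm (φ.map_source hp),
    ← momForm_change hφ hψ hp hp', christoffelMap_change g hφ hψ hy, map_add,
    ← formDq_change hφ hψ hp hp', transition_apply hp,
    (isLocalMetric_metricMap g hψ).christoffel_symm (ψ.map_source hp'),
    fderiv_transition_stdVec hφ hψ hp hp']
  simp only [formDp_eq, mul_sub, Finset.sum_sub_distrib, map_sum, map_smul, _root_.sum_apply,
    _root_.smul_apply, smul_eq_mul, inner_sum, inner_smul_right]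
  have h : ∀ i, inner ℝ (inducedDiff ψ p ξ).2 (stdVec i) = (inducedDiff ψ p ξ).2 i := fun i ↦ by
    simp [stdVec, EuclideanSpace.inner_single_right]
  simp only [h]
  ring

omit [IsManifold (𝓡 n) ∞ M] in
lemma kron_change (hφ : φ ∈ IsManifold.maximalAtlas (𝓡 n) ∞ M)
    (hψ : ψ ∈ IsManifold.maximalAtlas (𝓡 n) ∞ M) {x : M} (hx : x ∈ φ.source)
    (hx' : x ∈ ψ.source) (i j : Fin n) :
    (kron i j : ℝ) = ∑ a, ∑ b, jacobian φ ψ x i a * jacobian ψ φ x b j * kron a b := by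
  rw [kron, ← sum_jacobian_mul hφ hψ hx hx']
  exact Finset.sum_congr rfl fun a _ ↦ by simp [kron]

lemma pUp_change (hφ : φ ∈ IsManifold.maximalAtlas (𝓡 n) ∞ M)
    (hψ : ψ ∈ IsManifold.maximalAtlas (𝓡 n) ∞ M) {p : CotangentBundle n M}
    (hp : p.proj ∈ φ.source) (hp' : p.proj ∈ ψ.source) (i : Fin n) :
    pUp g ψ p i = ∑ a, jacobian φ ψ p.proj i a * pUp g φ p a := by
  have h : ∀ h, gUp g ψ p h i = ∑ a, jacobian φ ψ p.proj h a *
      ∑ b, jacobian φ ψ p.proj i b * gUp g φ p a b := fun h ↦ by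
    rw [gUp_change g hφ hψ hp hp']
    simp only [Finset.mul_sum, mul_assoc]
  simp only [pUp, h, mom_change hφ hψ hp hp', Finset.mul_sum, Finset.sum_mul]
  rw [Finset.sum_comm, Finset.sum_congr rfl fun a _ ↦ Finset.sum_comm, Finset.sum_comm]
  refine Finset.sum_congr rfl fun b _ ↦ Finset.sum_congr rfl fun a _ ↦
    Finset.sum_congr rfl fun c _ ↦ by ring

lemma energy_eq (p : CotangentBundle n M) :
    energy g φ p = 1 / 2 * ∑ i, pUp g φ p i * mom φ p i := by
  simp only [energy, pUp, Finset.sum_mul]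
  rw [Finset.sum_comm]
  congr 1
  exact Finset.sum_congr rfl fun a _ ↦ Finset.sum_congr rfl fun b _ ↦ by ring

lemma energy_change (hφ : φ ∈ IsManifold.maximalAtlas (𝓡 n) ∞ M)
    (hψ : ψ ∈ IsManifold.maximalAtlas (𝓡 n) ∞ M) {p : CotangentBundle n M}
    (hp : p.proj ∈ φ.source) (hp' : p.proj ∈ ψ.source) : energy g ψ p = energy g φ p := by
  rw [energy_eq, energy_eq]
  simp only [pUp_change g hφ hψ hp hp', mom_change hφ hψ hp hp', Finset.mul_sum, Finset.sum_mul]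
  rw [Finset.sum_comm]
  exact Finset.sum_congr rfl fun a _ ↦ Finset.sum_congr rfl fun b _ ↦ by ring

lemma G1_change (C : Coefficients) (hφ : φ ∈ IsManifold.maximalAtlas (𝓡 n) ∞ M)
    (hψ : ψ ∈ IsManifold.maximalAtlas (𝓡 n) ∞ M) {p : CotangentBundle n M}
    (hp : p.proj ∈ φ.source) (hp' : p.proj ∈ ψ.source) (i j : Fin n) :
    G1 g φ C p i j = ∑ a, ∑ b, jacobian φ ψ p.proj a i * jacobian φ ψ p.proj b j
      * G1 g ψ C p a b := by
  simp only [G1, energy_change g hφ hψ hp hp', gLow_change g hφ hψ hp hp',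
    mom_change hφ hψ hp hp', mul_add, Finset.sum_add_distrib, Finset.mul_sum, Finset.sum_mul]
  congr 1
  · exact Finset.sum_congr rfl fun a _ ↦ Finset.sum_congr rfl fun b _ ↦ by ring
  · rw [Finset.sum_comm]
    exact Finset.sum_congr rfl fun a _ ↦ Finset.sum_congr rfl fun b _ ↦ by ring

lemma G2_change (C : Coefficients) (hφ : φ ∈ IsManifold.maximalAtlas (𝓡 n) ∞ M)
    (hψ : ψ ∈ IsManifold.maximalAtlas (𝓡 n) ∞ M) {p : CotangentBundle n M}
    (hp : p.proj ∈ φ.source) (hp' : p.proj ∈ ψ.source) (i j : Fin n) :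
    G2 g ψ C p i j = ∑ a, ∑ b, jacobian φ ψ p.proj i a * jacobian φ ψ p.proj j b
      * G2 g φ C p a b := by
  simp only [G2, energy_change g hφ hψ hp hp', gUp_change g hφ hψ hp hp',
    pUp_change g hφ hψ hp hp', mul_add, Finset.sum_add_distrib, Finset.mul_sum, Finset.sum_mul]
  congr 1
  · exact Finset.sum_congr rfl fun a _ ↦ Finset.sum_congr rfl fun b _ ↦ by ring
  · rw [Finset.sum_comm]
    exact Finset.sum_congr rfl fun a _ ↦ Finset.sum_congr rfl fun b _ ↦ by ring

/-- A bilinear form evaluated on two vectors is invariant when its components and those of the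
vectors transform contragrediently. -/
lemma sum_bilin_change {X X' : Fin n → Fin n → ℝ} {u u' v v' : Fin n → ℝ}
    {A : Fin n → Fin n → ℝ} (hX : ∀ i j, X' i j = ∑ a, ∑ b, A i a * A j b * X a b)
    (hu : ∀ a, u a = ∑ i, A i a * u' i) (hv : ∀ a, v a = ∑ i, A i a * v' i) :
    ∑ i, ∑ j, X' i j * u' i * v' j = ∑ a, ∑ b, X a b * u a * v b := by
  have h : ∀ a b, X a b * u a * v b =
      ∑ i, ∑ j, A i a * A j b * X a b * u' i * v' j := fun a b ↦ by
    rw [hu, hv, mul_assoc, Finset.sum_mul_sum, Finset.mul_sum]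
    refine Finset.sum_congr rfl fun i _ ↦ ?_
    rw [Finset.mul_sum]
    exact Finset.sum_congr rfl fun j _ ↦ by ring
  simp only [h, hX, Finset.sum_mul]
  calc _ = ∑ i, ∑ a, ∑ j, ∑ b, A i a * A j b * X a b * u' i * v' j :=
        Finset.sum_congr rfl fun i _ ↦ Finset.sum_comm
    _ = ∑ a, ∑ i, ∑ b, ∑ j, A i a * A j b * X a b * u' i * v' j := by
        rw [Finset.sum_comm]
        exact Finset.sum_congr rfl fun a _ ↦ Finset.sum_congr rfl fun i _ ↦ Finset.sum_comm
    _ = _ := Finset.sum_congr rfl fun a _ ↦ Finset.sum_comm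

theorem localLift_eq (C : Coefficients) (hφ : φ ∈ IsManifold.maximalAtlas (𝓡 n) ∞ M)
    (hψ : ψ ∈ IsManifold.maximalAtlas (𝓡 n) ∞ M) {p : CotangentBundle n M}
    (hp : p.proj ∈ φ.source) (hp' : p.proj ∈ ψ.source) (ξ η : TangentSpace (cotangentModel n) p) :
    localLift g φ C p ξ η = localLift g ψ C p ξ η := by
  rw [localLift, localLift]
  congr 1
  -- The two halves use the invariance in opposite directions, since `dq` is contravariant and `Dp`
  -- covariant.
  · exact (sum_bilin_change (A := fun i a ↦ jacobian φ ψ p.proj a i) (G1_change g C hφ hψ hp hp')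
      (formDq_eq_sum hφ hψ hp hp' ξ) (formDq_eq_sum hφ hψ hp hp' η))
  · exact (sum_bilin_change (A := fun i a ↦ jacobian φ ψ p.proj i a) (G2_change g C hφ hψ hp hp')
      (fun a ↦ formDp_change g hφ hψ hp hp' ξ a) (fun a ↦ formDp_change g hφ hψ hp hp' η a)).symm

theorem naturalLift_eq (C : Coefficients) (hφ : φ ∈ IsManifold.maximalAtlas (𝓡 n) ∞ M)
    {p : CotangentBundle n M} (hp : p.proj ∈ φ.source) (ξ η : TangentSpace (cotangentModel n) p) :
    naturalLift g C p ξ η = localLift g φ C p ξ η :=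
  localLift_eq g C (IsManifold.chart_mem_maximalAtlas _) hφ (mem_chart_source _ _) hp ξ η

end Lift

/-! ### Derivatives of the coefficients of the lift -/

section Differential

variable {F : Type*} [NormedAddCommGroup F] [NormedSpace ℝ F] {f f' : F → ℝ} {D D' : F → ℝ} {z : F}

/-- The function `f` is differentiable at `z`, with differential `D`. -/
def HasDifferentialAt (f D : F → ℝ) (z : F) : Prop :=
  ∃ L : F →L[ℝ] ℝ, HasFDerivAt f L z ∧ ∀ ζ, L ζ = D ζ

namespace HasDifferentialAt

lemma differentiableAt (h : HasDifferentialAt f D z) : DifferentiableAt ℝ f z := by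
  obtain ⟨L, hL, -⟩ := h
  exact hL.differentiableAt

lemma fderiv (h : HasDifferentialAt f D z) (ζ : F) : fderiv ℝ f z ζ = D ζ := by
  obtain ⟨L, hL, h⟩ := h
  rw [hL.fderiv, h]

lemma congr (h : HasDifferentialAt f D z) (hD : ∀ ζ, D ζ = D' ζ) : HasDifferentialAt f D' z := by
  obtain ⟨L, hL, h⟩ := h
  exact ⟨L, hL, fun ζ ↦ (h ζ).trans (hD ζ)⟩

lemma add (h : HasDifferentialAt f D z) (h' : HasDifferentialAt f' D' z) :
    HasDifferentialAt (fun z ↦ f z + f' z) (fun ζ ↦ D ζ + D' ζ) z := by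
  obtain ⟨L, hL, h⟩ := h
  obtain ⟨L', hL', h'⟩ := h'
  exact ⟨_, hL.add hL', fun ζ ↦ by simp [h, h']⟩

lemma mul (h : HasDifferentialAt f D z) (h' : HasDifferentialAt f' D' z) :
    HasDifferentialAt (fun z ↦ f z * f' z) (fun ζ ↦ D ζ * f' z + f z * D' ζ) z := by
  obtain ⟨L, hL, h⟩ := h
  obtain ⟨L', hL', h'⟩ := h'
  exact ⟨_, hL.mul hL', fun ζ ↦ by simp [h, h']; ring⟩

lemma const_mul (h : HasDifferentialAt f D z) (c : ℝ) :
    HasDifferentialAt (fun z ↦ c * f z) (fun ζ ↦ c * D ζ) z := by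
  obtain ⟨L, hL, h⟩ := h
  exact ⟨_, hL.const_mul c, fun ζ ↦ by simp [h]⟩

lemma sum {ι : Type*} {s : Finset ι} {f D : ι → F → ℝ}
    (h : ∀ i ∈ s, HasDifferentialAt (f i) (D i) z) :
    HasDifferentialAt (fun z ↦ ∑ i ∈ s, f i z) (fun ζ ↦ ∑ i ∈ s, D i ζ) z := by
  choose! L hL h using h
  exact ⟨_, HasFDerivAt.fun_sum hL, fun ζ ↦ by
    rw [_root_.sum_apply]; exact Finset.sum_congr rfl fun i hi ↦ h i hi ζ⟩

/-- The chain rule for an outer function that is differentiable on `[0, ∞)` only. -/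
lemma comp_of_nonneg (h : HasDifferentialAt f D z) {c : ℝ → ℝ}
    (hc : ContDiffOn ℝ ∞ c (Ici 0)) (hf : ∀ᶠ w in 𝓝 z, 0 ≤ f w) :
    HasDifferentialAt (fun z ↦ c (f z)) (fun ζ ↦ tDeriv c (f z) * D ζ) z := by
  obtain ⟨L, hL, h⟩ := h
  have h0 : HasDerivWithinAt c (tDeriv c (f z)) (Ici 0) (f z) :=
    ((hc.differentiableOn (by simp)) (f z) hf.self_of_nhds).hasDerivWithinAt
  have h1 := h0.hasFDerivWithinAt.comp z (t := Ici 0) (s := {w | 0 ≤ f w}) hL.hasFDerivWithinAt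
    fun w hw ↦ hw
  -- The set where `f ≥ 0` is a neighbourhood of `z`, so the derivative within it is a full
  -- derivative even though `c` has only a one-sided derivative at `0`.
  refine ⟨_, h1.hasFDerivAt hf, fun ζ ↦ ?_⟩
  simp [h, mul_comm]

end HasDifferentialAt

end Differential

/-! ### Differentials of `g`, `g⁻¹`, `t`, `G⁽¹⁾` and `G₍₂₎`, split into a `Dp` part and a connection
part. -/

section Lift

variable {n : ℕ} {M : Type*} [TopologicalSpace M] [ChartedSpace (EuclideanSpace ℝ (Fin n)) M]
  [IsManifold (𝓡 n) ∞ M]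
  (g : ContMDiffRiemannianMetric (𝓡 n) ∞ (EuclideanSpace ℝ (Fin n))
      (fun x : M ↦ TangentSpace (𝓡 n) x))
  {φ : OpenPartialHomeomorph M (EuclideanSpace ℝ (Fin n))}

lemma gLow_symm (p : CotangentBundle n M) (i j : Fin n) : gLow g φ p i j = gLow g φ p j i :=
  metricCoeff_symm g _ i j

lemma metricCoeff_inv_symm (y : EuclideanSpace ℝ (Fin n)) (i j : Fin n) :
    (metricCoeff g φ y)⁻¹ i j = (metricCoeff g φ y)⁻¹ j i := by
  have h : (metricCoeff g φ y).transpose = metricCoeff g φ y := by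
    ext i j
    exact metricCoeff_symm g y j i
  conv_lhs => rw [← h, ← Matrix.transpose_nonsing_inv]
  rfl

lemma gUp_symm (p : CotangentBundle n M) (i j : Fin n) : gUp g φ p i j = gUp g φ p j i :=
  metricCoeff_inv_symm g _ i j

variable (φ) in
/-- The matrix of connection forms `Γ^h_{aj} uᵃ`. -/
def connForm (y u : EuclideanSpace ℝ (Fin n)) : Matrix (Fin n) (Fin n) ℝ :=
  Matrix.of fun h j ↦ christoffelMap g φ y u (stdVec j) h

lemma connForm_stdVec (y : EuclideanSpace ℝ (Fin n)) (i h j : Fin n) :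
    connForm g φ y (stdVec i) h j = christoffel g φ h i j y := by
  simp [connForm, christoffelMap]

lemma connForm_zero (y : EuclideanSpace ℝ (Fin n)) : connForm g φ y 0 = 0 := by
  ext h j
  simp [connForm]

variable {y : EuclideanSpace ℝ (Fin n)}

/-- Metricity of the connection in matrix form, `dg = Wᵀ g + g W`. -/
lemma fderiv_metricCoeff (hφ : φ ∈ IsManifold.maximalAtlas (𝓡 n) ∞ M) (hy : y ∈ φ.target)
    (u : EuclideanSpace ℝ (Fin n)) (j k : Fin n) :
    fderiv ℝ (fun z ↦ metricCoeff g φ z j k) y u =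
      ((connForm g φ y u).transpose * metricCoeff g φ y + metricCoeff g φ y * connForm g φ y u)
        j k := by
  rw [← fderiv_metricMap_stdVec g hφ hy, (isLocalMetric_metricMap g hφ).fderiv_metric hy,
    eq_sum_stdVec (christoffelMap g φ y u (stdVec j)),
    eq_sum_stdVec (christoffelMap g φ y u (stdVec k))]
  simp only [Matrix.add_apply, Matrix.mul_apply, map_sum, map_smul, _root_.sum_apply,
    _root_.smul_apply, metricMap, bilinOfCoeff_stdVec, smul_eq_mul]
  congr 1
  exact Finset.sum_congr rfl fun h _ ↦ mul_comm _ _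

lemma hasDifferentialAt_metricCoeff (hφ : φ ∈ IsManifold.maximalAtlas (𝓡 n) ∞ M)
    (hy : y ∈ φ.target) (j k : Fin n) :
    HasDifferentialAt (fun z ↦ metricCoeff g φ z j k) (fun u ↦
      ((connForm g φ y u).transpose * metricCoeff g φ y + metricCoeff g φ y * connForm g φ y u)
        j k) y :=
  ⟨_, ((contMDiffAt_metricCoeff g hφ hy j k).differentiableAt (by simp)).hasFDerivAt,
    fun u ↦ fderiv_metricCoeff g hφ hy u j k⟩

lemma hasDifferentialAt_metricCoeff_inv (hφ : φ ∈ IsManifold.maximalAtlas (𝓡 n) ∞ M)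
    (hy : y ∈ φ.target) (j k : Fin n) :
    HasDifferentialAt (fun z ↦ (metricCoeff g φ z)⁻¹ j k) (fun u ↦
      -((metricCoeff g φ y)⁻¹ * (connForm g φ y u).transpose
        + connForm g φ y u * (metricCoeff g φ y)⁻¹) j k) y := by
  have hd := fun j k ↦ ((contDiffAt_metricCoeff_inv g hφ hy j k).differentiableAt
    (by simp)).hasFDerivAt
  refine ⟨_, hd j k, fun u ↦ ?_⟩
  set X : Matrix (Fin n) (Fin n) ℝ :=
    Matrix.of fun j k ↦ fderiv ℝ (fun z ↦ (metricCoeff g φ z)⁻¹ j k) y u with hX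
  set A := metricCoeff g φ y with hA
  set W := connForm g φ y u with hW
  have hdet : IsUnit A.det := (Matrix.isUnit_iff_isUnit_det _).1 (isUnit_metricCoeff g hφ hy)
  -- The identity `g g⁻¹ = 1` is differentiated; solving for the derivative `X` of the inverse gives
  -- the formula.
  have hmul : (W.transpose * A + A * W) * A⁻¹ + A * X = 0 := by
    ext i l
    have h1 : HasDifferentialAt (fun z ↦ ∑ m, metricCoeff g φ z i m * (metricCoeff g φ z)⁻¹ m l) _ y
      := HasDifferentialAt.sum fun m _ ↦ (hasDifferentialAt_metricCoeff g hφ hy i m).mul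
        ⟨_, hd m l, fun _ ↦ rfl⟩
    have h2 : (fun z ↦ ∑ m, metricCoeff g φ z i m * (metricCoeff g φ z)⁻¹ m l) =ᶠ[𝓝 y]
        fun _ ↦ (1 : Matrix (Fin n) (Fin n) ℝ) i l := by
      filter_upwards [φ.open_target.mem_nhds hy] with z hz
      rw [← Matrix.mul_apply, Matrix.mul_nonsing_inv _
        ((Matrix.isUnit_iff_isUnit_det _).1 (isUnit_metricCoeff g hφ hz))]
    have h3 := h1.fderiv u
    rw [h2.fderiv_eq, fderiv_const_apply, Finset.sum_add_distrib] at h3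
    rw [Matrix.add_apply, Matrix.mul_apply, Matrix.mul_apply]
    exact h3.symm
  have h4 : X = -(A⁻¹ * W.transpose + W * A⁻¹) := by
    have h5 : A⁻¹ * ((W.transpose * A + A * W) * A⁻¹ + A * X) = 0 := by rw [hmul, Matrix.mul_zero]
    have h6 : A⁻¹ * ((W.transpose * A + A * W) * A⁻¹ + A * X) =
        A⁻¹ * W.transpose * (A * A⁻¹) + (A⁻¹ * A) * W * A⁻¹ + (A⁻¹ * A) * X := by noncomm_ring
    rw [h6, Matrix.mul_nonsing_inv _ hdet, Matrix.nonsing_inv_mul _ hdet, Matrix.mul_one,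
      Matrix.one_mul, Matrix.one_mul] at h5
    exact eq_neg_of_add_eq_zero_right h5
  exact congr($h4 j k)

/-- The dual form of `c` is the square length of the vector `g⁻¹ c`. It ensures `t ≥ 0`, so that
only values of the coefficients on `[0, ∞)` occur. -/
lemma dotProduct_inv_mulVec_nonneg (hφ : φ ∈ IsManifold.maximalAtlas (𝓡 n) ∞ M)
    (hy : y ∈ φ.target) (c : Fin n → ℝ) : 0 ≤ (metricCoeff g φ y)⁻¹.mulVec c ⬝ᵥ c := by
  have hdet := (Matrix.isUnit_iff_isUnit_det _).1 (isUnit_metricCoeff g hφ hy)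
  have h := metricMap_toLp g (φ := φ) (y := y) ((metricCoeff g φ y)⁻¹.mulVec c)
    ((metricCoeff g φ y)⁻¹.mulVec c)
  rw [Matrix.mulVec_mulVec, Matrix.mul_nonsing_inv _ hdet, Matrix.one_mulVec] at h
  rw [← h]
  by_cases h0 : WithLp.toLp 2 ((metricCoeff g φ y)⁻¹.mulVec c) = 0
  · rw [h0, map_zero]
  · exact (metricMap_pos g hφ hy h0).le

variable (φ) in
/-- The coordinate representation of `p ↦ g^{0i}`. -/
def pUpCoord (z : EuclideanSpace ℝ (Fin n) × EuclideanSpace ℝ (Fin n)) (i : Fin n) : ℝ :=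
  ∑ h, z.2 h * (metricCoeff g φ z.1)⁻¹ h i

variable (φ) in
/-- The coordinate representation of the energy density. -/
def energyCoord (z : EuclideanSpace ℝ (Fin n) × EuclideanSpace ℝ (Fin n)) : ℝ :=
  1 / 2 * ∑ i, ∑ k, (metricCoeff g φ z.1)⁻¹ i k * z.2 i * z.2 k

variable (φ) in
/-- The components `Dp_k` of the tangent vector `ζ` at the point with coordinates `z`. -/
def vertForm (z ζ : EuclideanSpace ℝ (Fin n) × EuclideanSpace ℝ (Fin n)) : Fin n → ℝ :=
  fun k ↦ ζ.2 k - Matrix.vecMul z.2 (connForm g φ z.1 ζ.1) k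

lemma pUpCoord_eq (z : EuclideanSpace ℝ (Fin n) × EuclideanSpace ℝ (Fin n)) :
    pUpCoord g φ z = Matrix.vecMul z.2 (metricCoeff g φ z.1)⁻¹ := rfl

lemma pUpCoord_eq_mulVec (z : EuclideanSpace ℝ (Fin n) × EuclideanSpace ℝ (Fin n)) :
    pUpCoord g φ z = (metricCoeff g φ z.1)⁻¹.mulVec z.2 := by
  funext i
  simp only [pUpCoord, Matrix.mulVec, dotProduct]
  exact Finset.sum_congr rfl fun h _ ↦ by rw [metricCoeff_inv_symm, mul_comm]

lemma energyCoord_eq (z : EuclideanSpace ℝ (Fin n) × EuclideanSpace ℝ (Fin n)) :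
    energyCoord g φ z = 1 / 2 * ∑ i, pUpCoord g φ z i * z.2 i := by
  simp only [energyCoord, pUpCoord, Finset.sum_mul]
  rw [Finset.sum_comm]
  congr 1
  exact Finset.sum_congr rfl fun a _ ↦ Finset.sum_congr rfl fun b _ ↦ by ring

variable {z : EuclideanSpace ℝ (Fin n) × EuclideanSpace ℝ (Fin n)}

lemma energyCoord_nonneg (hφ : φ ∈ IsManifold.maximalAtlas (𝓡 n) ∞ M) (hz : z.1 ∈ φ.target) :
    0 ≤ energyCoord g φ z := by
  rw [energyCoord_eq, pUpCoord_eq_mulVec]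
  exact mul_nonneg (by norm_num) (dotProduct_inv_mulVec_nonneg g hφ hz _)

lemma eventually_energyCoord_nonneg (hφ : φ ∈ IsManifold.maximalAtlas (𝓡 n) ∞ M)
    (hz : z.1 ∈ φ.target) : ∀ᶠ w in 𝓝 z, 0 ≤ energyCoord g φ w := by
  filter_upwards [continuousAt_fst.preimage_mem_nhds (φ.open_target.mem_nhds hz)] with w hw
  exact energyCoord_nonneg g hφ hw

lemma HasDifferentialAt.comp_fst {f D : EuclideanSpace ℝ (Fin n) → ℝ}
    (h : HasDifferentialAt f D z.1) :
    HasDifferentialAt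
      (fun w : EuclideanSpace ℝ (Fin n) × EuclideanSpace ℝ (Fin n) ↦ f w.1) (fun ζ ↦ D ζ.1) z := by
  obtain ⟨L, hL, h⟩ := h
  exact ⟨_, hL.comp z hasFDerivAt_fst, fun ζ ↦ h ζ.1⟩

variable (φ) in
-- `dp = Dp + pW`; writing every differential in terms of `Dp` and `W` separates vertical from
-- horizontal derivatives.
lemma hasDifferentialAt_mom (k : Fin n) :
    HasDifferentialAt
      (fun w : EuclideanSpace ℝ (Fin n) × EuclideanSpace ℝ (Fin n) ↦ w.2 k)
      (fun ζ ↦ vertForm g φ z ζ k + Matrix.vecMul z.2 (connForm g φ z.1 ζ.1) k) z :=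
  ⟨_, (EuclideanSpace.proj k : EuclideanSpace ℝ (Fin n) →L[ℝ] ℝ).hasFDerivAt.comp z
      hasFDerivAt_snd, fun ζ ↦ by simp [vertForm]⟩

lemma hasDifferentialAt_pUpCoord (hφ : φ ∈ IsManifold.maximalAtlas (𝓡 n) ∞ M)
    (hz : z.1 ∈ φ.target) (i : Fin n) :
    HasDifferentialAt (fun w ↦ pUpCoord g φ w i)
      (fun ζ ↦ Matrix.vecMul (vertForm g φ z ζ) (metricCoeff g φ z.1)⁻¹ i
        - (connForm g φ z.1 ζ.1).mulVec (pUpCoord g φ z) i) z := by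
  refine (HasDifferentialAt.sum fun h _ ↦ (hasDifferentialAt_mom g φ h).mul
    (hasDifferentialAt_metricCoeff_inv g hφ hz h i).comp_fst).congr fun ζ ↦ ?_
  set W := connForm g φ z.1 ζ.1
  set B := (metricCoeff g φ z.1)⁻¹
  have key : Matrix.vecMul (vertForm g φ z ζ + Matrix.vecMul z.2 W) B
      + Matrix.vecMul z.2 (-(B * W.transpose + W * B)) =
      Matrix.vecMul (vertForm g φ z ζ) B - W.mulVec (pUpCoord g φ z) := by
    rw [Matrix.add_vecMul, Matrix.vecMul_neg, Matrix.vecMul_add, ← Matrix.vecMul_vecMul,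
      ← Matrix.vecMul_vecMul, Matrix.vecMul_transpose, pUpCoord_eq]
    abel
  rw [Finset.sum_add_distrib]
  exact congrFun key i

/-- The connection terms coming from `dp` and from `dg⁻¹` cancel because the connection is metric.
Hence `t`, and every function of it, is constant along the horizontal fields. -/
lemma hasDifferentialAt_energyCoord (hφ : φ ∈ IsManifold.maximalAtlas (𝓡 n) ∞ M)
    (hz : z.1 ∈ φ.target) :
    HasDifferentialAt (energyCoord g φ) (fun ζ ↦ pUpCoord g φ z ⬝ᵥ vertForm g φ z ζ) z := by
  rw [funext (energyCoord_eq g (φ := φ))]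
  refine ((HasDifferentialAt.sum fun i _ ↦ (hasDifferentialAt_pUpCoord g hφ hz i).mul
    (hasDifferentialAt_mom g φ i)).const_mul _).congr fun ζ ↦ ?_
  set W := connForm g φ z.1 ζ.1
  set β := vertForm g φ z ζ
  set q := pUpCoord g φ z with hq
  have h1 : Matrix.vecMul β (metricCoeff g φ z.1)⁻¹ ⬝ᵥ z.2 = q ⬝ᵥ β := by
    rw [hq, pUpCoord_eq_mulVec, ← Matrix.dotProduct_mulVec, dotProduct_comm]
  have h2 : W.mulVec q ⬝ᵥ z.2 = q ⬝ᵥ Matrix.vecMul z.2 W := by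
    rw [dotProduct_comm, Matrix.dotProduct_mulVec, dotProduct_comm]
  rw [Finset.sum_add_distrib]
  change 1 / 2 * ((Matrix.vecMul β (metricCoeff g φ z.1)⁻¹ - W.mulVec q) ⬝ᵥ z.2
    + q ⬝ᵥ (β + Matrix.vecMul z.2 W)) = _
  rw [sub_dotProduct, dotProduct_add, h1, h2]
  ring

variable (C : Coefficients)

variable (φ) in
/-- The coordinate representation of `G⁽¹⁾`. -/
def G1Coord (z : EuclideanSpace ℝ (Fin n) × EuclideanSpace ℝ (Fin n)) (i j : Fin n) : ℝ :=
  C.c₁ (energyCoord g φ z) * metricCoeff g φ z.1 i j + C.d₁ (energyCoord g φ z) * z.2 i * z.2 j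

variable (φ) in
/-- The coordinate representation of `G₍₂₎`. -/
def G2Coord (z : EuclideanSpace ℝ (Fin n) × EuclideanSpace ℝ (Fin n)) (i j : Fin n) : ℝ :=
  C.c₂ (energyCoord g φ z) * (metricCoeff g φ z.1)⁻¹ i j
    + C.d₂ (energyCoord g φ z) * pUpCoord g φ z i * pUpCoord g φ z j

/-- The connection terms of `dg` and of `dp` have the same shape and recombine with the coefficients
of `t` into `G⁽¹⁾` itself. One formula thus gives both the `∂ⁱ`- and the `δ_i`-derivatives. -/
lemma hasDifferentialAt_G1Coord (hφ : φ ∈ IsManifold.maximalAtlas (𝓡 n) ∞ M)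
    (hz : z.1 ∈ φ.target) (hc₁ : ContDiffOn ℝ ∞ C.c₁ (Ici 0)) (hd₁ : ContDiffOn ℝ ∞ C.d₁ (Ici 0))
    (j k : Fin n) :
    HasDifferentialAt (fun w ↦ G1Coord g φ C w j k) (fun ζ ↦
      (pUpCoord g φ z ⬝ᵥ vertForm g φ z ζ) *
        (tDeriv C.c₁ (energyCoord g φ z) * metricCoeff g φ z.1 j k
          + tDeriv C.d₁ (energyCoord g φ z) * z.2 j * z.2 k)
      + C.d₁ (energyCoord g φ z) * (vertForm g φ z ζ j * z.2 k + z.2 j * vertForm g φ z ζ k)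
      + ∑ h, (connForm g φ z.1 ζ.1 h j * G1Coord g φ C z h k
        + connForm g φ z.1 ζ.1 h k * G1Coord g φ C z j h)) z := by
  have ht := hasDifferentialAt_energyCoord g hφ hz
  have ht0 := eventually_energyCoord_nonneg g hφ hz
  refine (((ht.comp_of_nonneg hc₁ ht0).mul (hasDifferentialAt_metricCoeff g hφ hz j k).comp_fst).add
    (((ht.comp_of_nonneg hd₁ ht0).mul (hasDifferentialAt_mom g φ j)).mul
      (hasDifferentialAt_mom g φ k))).congr fun ζ ↦ ?_
  have h1 : ∑ h, connForm g φ z.1 ζ.1 h j * G1Coord g φ C z h k =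
      C.c₁ (energyCoord g φ z) * ((connForm g φ z.1 ζ.1).transpose * metricCoeff g φ z.1) j k
      + C.d₁ (energyCoord g φ z) * Matrix.vecMul z.2 (connForm g φ z.1 ζ.1) j * z.2 k := by
    simp only [G1Coord, Matrix.mul_apply, Matrix.transpose_apply, Matrix.vecMul, dotProduct,
      Finset.mul_sum, Finset.sum_mul, ← Finset.sum_add_distrib]
    exact Finset.sum_congr rfl fun h _ ↦ by ring
  have h2 : ∑ h, connForm g φ z.1 ζ.1 h k * G1Coord g φ C z j h =
      C.c₁ (energyCoord g φ z) * (metricCoeff g φ z.1 * connForm g φ z.1 ζ.1) j k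
      + C.d₁ (energyCoord g φ z) * Matrix.vecMul z.2 (connForm g φ z.1 ζ.1) k * z.2 j := by
    simp only [G1Coord, Matrix.mul_apply, Matrix.vecMul, dotProduct,
      Finset.mul_sum, Finset.sum_mul, ← Finset.sum_add_distrib]
    exact Finset.sum_congr rfl fun h _ ↦ by ring
  rw [Finset.sum_add_distrib, h1, h2, Matrix.add_apply]
  ring

/-- As for `G⁽¹⁾`, but the connection terms enter with a minus sign, the indices being upper. -/
lemma hasDifferentialAt_G2Coord (hφ : φ ∈ IsManifold.maximalAtlas (𝓡 n) ∞ M)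
    (hz : z.1 ∈ φ.target) (hc₂ : ContDiffOn ℝ ∞ C.c₂ (Ici 0)) (hd₂ : ContDiffOn ℝ ∞ C.d₂ (Ici 0))
    (j k : Fin n) :
    HasDifferentialAt (fun w ↦ G2Coord g φ C w j k) (fun ζ ↦
      (pUpCoord g φ z ⬝ᵥ vertForm g φ z ζ) *
        (tDeriv C.c₂ (energyCoord g φ z) * (metricCoeff g φ z.1)⁻¹ j k
          + tDeriv C.d₂ (energyCoord g φ z) * pUpCoord g φ z j * pUpCoord g φ z k)
      + C.d₂ (energyCoord g φ z) *
        (Matrix.vecMul (vertForm g φ z ζ) (metricCoeff g φ z.1)⁻¹ j * pUpCoord g φ z k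
          + pUpCoord g φ z j * Matrix.vecMul (vertForm g φ z ζ) (metricCoeff g φ z.1)⁻¹ k)
      - ∑ h, (connForm g φ z.1 ζ.1 j h * G2Coord g φ C z h k
        + connForm g φ z.1 ζ.1 k h * G2Coord g φ C z j h)) z := by
  have ht := hasDifferentialAt_energyCoord g hφ hz
  have ht0 := eventually_energyCoord_nonneg g hφ hz
  refine (((ht.comp_of_nonneg hc₂ ht0).mul
    (hasDifferentialAt_metricCoeff_inv g hφ hz j k).comp_fst).add
    (((ht.comp_of_nonneg hd₂ ht0).mul (hasDifferentialAt_pUpCoord g hφ hz j)).mul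
      (hasDifferentialAt_pUpCoord g hφ hz k))).congr fun ζ ↦ ?_
  have h1 : ∑ h, connForm g φ z.1 ζ.1 j h * G2Coord g φ C z h k =
      C.c₂ (energyCoord g φ z) * (connForm g φ z.1 ζ.1 * (metricCoeff g φ z.1)⁻¹) j k
      + C.d₂ (energyCoord g φ z) * (connForm g φ z.1 ζ.1).mulVec (pUpCoord g φ z) j
        * pUpCoord g φ z k := by
    simp only [G2Coord, Matrix.mul_apply, Matrix.mulVec, dotProduct,
      Finset.mul_sum, Finset.sum_mul, ← Finset.sum_add_distrib]
    exact Finset.sum_congr rfl fun h _ ↦ by ring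
  have h2 : ∑ h, connForm g φ z.1 ζ.1 k h * G2Coord g φ C z j h =
      C.c₂ (energyCoord g φ z) * ((metricCoeff g φ z.1)⁻¹ * (connForm g φ z.1 ζ.1).transpose) j k
      + C.d₂ (energyCoord g φ z) * (connForm g φ z.1 ζ.1).mulVec (pUpCoord g φ z) k
        * pUpCoord g φ z j := by
    simp only [G2Coord, Matrix.mul_apply, Matrix.transpose_apply, Matrix.mulVec, dotProduct,
      Finset.mul_sum, Finset.sum_mul, ← Finset.sum_add_distrib]
    exact Finset.sum_congr rfl fun h _ ↦ by ring
  rw [Finset.sum_add_distrib, h1, h2, Matrix.add_apply]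
  ring

variable {p : CotangentBundle n M}

lemma vertForm_vertical (i k : Fin n) :
    vertForm g φ z (0, stdVec i) k = kron i k := by
  simp [vertForm, connForm_zero, stdVec, kron, eq_comm]

/-- The fibre component of `δ_i` is chosen to be `p W(e_i)`, which makes `Dp` vanish on it. -/
lemma vertForm_horizontal (i : Fin n) :
    vertForm g φ (inducedChart φ p) (stdVec i, WithLp.toLp 2 (Gam0 g φ p i)) = 0 := by
  funext k
  simp only [vertForm, Matrix.vecMul, dotProduct, connForm_stdVec]
  exact sub_self _

lemma sum_mul_kron (f : Fin n → ℝ) (i : Fin n) : ∑ a, f a * kron i a = f i := by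
  simp [kron]

lemma sum_kron_mul (f : Fin n → ℝ) (i : Fin n) : ∑ a, kron i a * f a = f i := by
  simp [kron]

variable (hφ : φ ∈ IsManifold.maximalAtlas (𝓡 n) ∞ M) (hp : p.proj ∈ φ.source)

include hφ hp

lemma mvfderiv_eq_of_hasDifferentialAt
    {f D : EuclideanSpace ℝ (Fin n) × EuclideanSpace ℝ (Fin n) → ℝ}
    (h : HasDifferentialAt f D (inducedChart φ p)) (ξ : TangentSpace (cotangentModel n) p) :
    mvfderiv (cotangentModel n) (fun q ↦ f (inducedChart φ q)) p ξ = D (inducedDiff φ p ξ) :=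
  (mvfderiv_comp_inducedChart hφ hp h.differentiableAt ξ).trans (h.fderiv _)

lemma pDeriv_G1 (hc₁ : ContDiffOn ℝ ∞ C.c₁ (Ici 0)) (hd₁ : ContDiffOn ℝ ∞ C.d₁ (Ici 0))
    (i j k : Fin n) :
    pDeriv φ (fun q ↦ G1 g φ C q j k) i p =
      tDeriv C.c₁ (energy g φ p) * pUp g φ p i * gLow g φ p j k
      + tDeriv C.d₁ (energy g φ p) * pUp g φ p i * mom φ p j * mom φ p k
      + C.d₁ (energy g φ p) * (kron i j * mom φ p k + mom φ p j * kron i k) := by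
  refine (mvfderiv_eq_of_hasDifferentialAt hφ hp (hasDifferentialAt_G1Coord g C hφ
    (z := inducedChart φ p) (φ.map_source hp) hc₁ hd₁ j k) _).trans ?_
  rw [inducedDiff_dP hφ hp]
  simp only [dotProduct, vertForm_vertical, sum_mul_kron, connForm_zero, Matrix.zero_apply,
    zero_mul, add_zero, Finset.sum_const_zero]
  change pUp g φ p i * (tDeriv C.c₁ (energy g φ p) * gLow g φ p j k
    + tDeriv C.d₁ (energy g φ p) * mom φ p j * mom φ p k)
    + C.d₁ (energy g φ p) * (kron i j * mom φ p k + mom φ p j * kron i k) = _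
  ring

lemma pDeriv_G2 (hc₂ : ContDiffOn ℝ ∞ C.c₂ (Ici 0)) (hd₂ : ContDiffOn ℝ ∞ C.d₂ (Ici 0))
    (i j k : Fin n) :
    pDeriv φ (fun q ↦ G2 g φ C q j k) i p =
      tDeriv C.c₂ (energy g φ p) * pUp g φ p i * gUp g φ p j k
      + tDeriv C.d₂ (energy g φ p) * pUp g φ p i * pUp g φ p j * pUp g φ p k
      + C.d₂ (energy g φ p) * (gUp g φ p i j * pUp g φ p k + pUp g φ p j * gUp g φ p i k) := by
  refine (mvfderiv_eq_of_hasDifferentialAt hφ hp (hasDifferentialAt_G2Coord g C hφ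
    (z := inducedChart φ p) (φ.map_source hp) hc₂ hd₂ j k) _).trans ?_
  rw [inducedDiff_dP hφ hp]
  simp only [dotProduct, Matrix.vecMul, vertForm_vertical, sum_mul_kron, sum_kron_mul,
    connForm_zero, Matrix.zero_apply, zero_mul, add_zero, Finset.sum_const_zero, sub_zero]
  change pUp g φ p i * (tDeriv C.c₂ (energy g φ p) * gUp g φ p j k
    + tDeriv C.d₂ (energy g φ p) * pUp g φ p j * pUp g φ p k)
    + C.d₂ (energy g φ p) * (gUp g φ p i j * pUp g φ p k + pUp g φ p j * gUp g φ p i k) = _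
  ring

/-- Along `δ_i` the `Dp` part is zero, so only the connection terms remain, as for the covariant
derivative of a parallel tensor of type `(0, 2)`. -/
lemma mvfderiv_G1_delta (hc₁ : ContDiffOn ℝ ∞ C.c₁ (Ici 0)) (hd₁ : ContDiffOn ℝ ∞ C.d₁ (Ici 0))
    (i j k : Fin n) :
    mvfderiv (cotangentModel n) (fun q ↦ G1 g φ C q j k) p (delta g φ i p) =
      ∑ h, (Gam g φ p h i j * G1 g φ C p h k + Gam g φ p h i k * G1 g φ C p j h) := by
  refine (mvfderiv_eq_of_hasDifferentialAt hφ hp (hasDifferentialAt_G1Coord g C hφ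
    (z := inducedChart φ p) (φ.map_source hp) hc₁ hd₁ j k) _).trans ?_
  rw [inducedDiff_delta g hφ hp, vertForm_horizontal]
  simp only [dotProduct_zero, Pi.zero_apply, zero_mul, mul_zero, add_zero, zero_add,
    connForm_stdVec]
  rfl

/-- Horizontal parallelism again, now for a tensor of type `(2, 0)`. -/
lemma mvfderiv_G2_delta (hc₂ : ContDiffOn ℝ ∞ C.c₂ (Ici 0)) (hd₂ : ContDiffOn ℝ ∞ C.d₂ (Ici 0))
    (i j k : Fin n) :
    mvfderiv (cotangentModel n) (fun q ↦ G2 g φ C q j k) p (delta g φ i p) =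
      -∑ h, (Gam g φ p j i h * G2 g φ C p h k + Gam g φ p k i h * G2 g φ C p j h) := by
  refine (mvfderiv_eq_of_hasDifferentialAt hφ hp (hasDifferentialAt_G2Coord g C hφ
    (z := inducedChart φ p) (φ.map_source hp) hc₂ hd₂ j k) _).trans ?_
  rw [inducedDiff_delta g hφ hp, vertForm_horizontal]
  simp only [dotProduct_zero, Pi.zero_apply, zero_mul, mul_zero, add_zero, zero_sub,
    connForm_stdVec, Matrix.zero_vecMul]
  rfl

end Lift

/-! ### The adapted frame -/

section Frame

variable {n : ℕ} {M : Type*} [TopologicalSpace M] [ChartedSpace (EuclideanSpace ℝ (Fin n)) M]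
  [IsManifold (𝓡 n) ∞ M]
  (g : ContMDiffRiemannianMetric (𝓡 n) ∞ (EuclideanSpace ℝ (Fin n))
      (fun x : M ↦ TangentSpace (𝓡 n) x))
  {φ : OpenPartialHomeomorph M (EuclideanSpace ℝ (Fin n))}

variable (φ) in
/-- The vector field on the cotangent bundle that is `V` in the chart induced by `φ`. -/
def liftField (V : EuclideanSpace ℝ (Fin n) × EuclideanSpace ℝ (Fin n) →
      EuclideanSpace ℝ (Fin n) × EuclideanSpace ℝ (Fin n))
    (q : CotangentBundle n M) : TangentSpace (cotangentModel n) q :=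
  (inducedDiff φ q).inverse (V (inducedChart φ q))

variable {V W : EuclideanSpace ℝ (Fin n) × EuclideanSpace ℝ (Fin n) →
      EuclideanSpace ℝ (Fin n) × EuclideanSpace ℝ (Fin n)} {p : CotangentBundle n M}

lemma mdifferentiableAt_field {E : Type*} [NormedAddCommGroup E] [NormedSpace ℝ E] {V : E → E}
    {z : E} (hV : ContDiffAt ℝ ∞ V z) :
    MDifferentiableAt 𝓘(ℝ, E) 𝓘(ℝ, E).tangent
      (fun w ↦ (⟨w, V w⟩ : TangentBundle 𝓘(ℝ, E) E)) z :=
  (contMDiffAt_vectorSpace_iff_contDiffAt.2 hV).mdifferentiableAt (by simp)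

/-- The field is the pullback of `V` under the induced chart, whose differential is invertible at
`p`. -/
lemma mdifferentiableAt_liftField (hφ : φ ∈ IsManifold.maximalAtlas (𝓡 n) ∞ M)
    (hp : p.proj ∈ φ.source) (hV : ContDiffAt ℝ ∞ V (inducedChart φ p)) :
    MDifferentiableAt (cotangentModel n) (cotangentModel n).tangent
      (fun q ↦ (⟨q, liftField φ V q⟩ : TangentBundle (cotangentModel n) (CotangentBundle n M))) p :=
  (ContMDiffAt.mpullback_vectorField_preimage (n := ∞) (m := ∞)
    (contMDiffAt_vectorSpace_iff_contDiffAt.2 hV) (contMDiffAt_inducedChart hφ hp)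
    (isInvertible_inducedDiff hφ hp) (by simp)).mdifferentiableAt (by simp)

lemma mlieBracket_eq_lieBracket {E : Type*} [NormedAddCommGroup E] [NormedSpace ℝ E]
    (V W : (x : E) → TangentSpace 𝓘(ℝ, E) x) (z : E) :
    VectorField.mlieBracket 𝓘(ℝ, E) V W z = VectorField.lieBracket ℝ V W z := by
  rw [← VectorField.mlieBracketWithin_univ, VectorField.mlieBracketWithin_eq_lieBracketWithin]
  exact congrFun VectorField.lieBracketWithin_univ z

/-- Pullback commutes with the Lie bracket, so brackets of the frame fields can be computed in `ℝⁿ ×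
ℝⁿ`. -/
lemma mlieBracket_liftField (hφ : φ ∈ IsManifold.maximalAtlas (𝓡 n) ∞ M)
    (hp : p.proj ∈ φ.source) (hV : ContDiffAt ℝ ∞ V (inducedChart φ p))
    (hW : ContDiffAt ℝ ∞ W (inducedChart φ p)) :
    VectorField.mlieBracket (cotangentModel n) (liftField φ V) (liftField φ W) p =
      (inducedDiff φ p).inverse (VectorField.lieBracket ℝ V W (inducedChart φ p)) := by
  -- Over `ℝ` the exponent `minSmoothness ℝ 2` is just `2`.
  have : IsManifold (cotangentModel n) (minSmoothness ℝ 2) (CotangentBundle n M) := by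
    rw [minSmoothness_of_isRCLikeNormedField]
    infer_instance
  have h := VectorField.mpullback_mlieBracket (mdifferentiableAt_field hV)
    (mdifferentiableAt_field hW) (contMDiffAt_inducedChart hφ hp)
    (by simp; exact ENat.LEInfty.out)
  exact h.symm.trans (congrArg (inducedDiff φ p).inverse (mlieBracket_eq_lieBracket V W _))

/-- The coordinate representation of `∂ⁱ`. -/
def vertCoord (i : Fin n) (_ : EuclideanSpace ℝ (Fin n) × EuclideanSpace ℝ (Fin n)) :
    EuclideanSpace ℝ (Fin n) × EuclideanSpace ℝ (Fin n) :=
  (0, stdVec i)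

variable (φ) in
/-- The coordinate representation of `δ_i`. -/
def horCoord (i : Fin n) (z : EuclideanSpace ℝ (Fin n) × EuclideanSpace ℝ (Fin n)) :
    EuclideanSpace ℝ (Fin n) × EuclideanSpace ℝ (Fin n) :=
  (stdVec i, WithLp.toLp 2 fun h ↦ ∑ k, z.2 k * christoffel g φ k i h z.1)

lemma dP_eq_liftField (i : Fin n) : dP (M := M) φ i = liftField φ (vertCoord i) := rfl

/-- Only linearity of `inverse` is used, so this is an equality of fields on the whole bundle and
can be rewritten inside a bracket or a derivative. -/
lemma delta_eq_liftField (i : Fin n) : delta g φ i = liftField φ (horCoord g φ i) := by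
  funext q
  set L := (inducedDiff φ q).inverse with hL
  have key : ∀ (s : Finset (Fin n)) (c : Fin n → ℝ),
      L (0, ∑ h ∈ s, c h • stdVec h) = ∑ h ∈ s, c h • L (0, stdVec h) := by
    intro s c
    classical
    induction s using Finset.induction_on with
    | empty => exact ContinuousLinearMap.map_zero _
    | insert a s ha ih =>
      rw [Finset.sum_insert ha, Finset.sum_insert ha, ← ih, ← ContinuousLinearMap.map_smul,
        ← ContinuousLinearMap.map_add]
      simp
  have h2 : ((stdVec i, WithLp.toLp 2 (Gam0 g φ q i)) :
      EuclideanSpace ℝ (Fin n) × EuclideanSpace ℝ (Fin n)) =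
      (stdVec i, 0) + (0, ∑ h, Gam0 g φ q i h • stdVec h) := by
    rw [sum_smul_stdVec]
    simp
  change _ = L (stdVec i, WithLp.toLp 2 (Gam0 g φ q i))
  rw [h2, ContinuousLinearMap.map_add, key]
  rfl

variable {z : EuclideanSpace ℝ (Fin n) × EuclideanSpace ℝ (Fin n)}

lemma contDiffAt_vertCoord (i : Fin n) : ContDiffAt ℝ ∞ (vertCoord i) z := contDiffAt_const

lemma contDiffAt_horCoord (hφ : φ ∈ IsManifold.maximalAtlas (𝓡 n) ∞ M) (hz : z.1 ∈ φ.target)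
    (i : Fin n) : ContDiffAt ℝ ∞ (horCoord g φ i) z := by
  refine contDiffAt_const.prodMk ?_
  refine (EuclideanSpace.equiv (Fin n) ℝ).symm.contDiff.contDiffAt.comp z
    (contDiffAt_pi.2 fun h ↦ ContDiffAt.sum fun k _ ↦ ?_)
  have h1 : ContDiffAt ℝ ∞ (fun w : EuclideanSpace ℝ (Fin n) × EuclideanSpace ℝ (Fin n) ↦ w.2 k) z :=
    (EuclideanSpace.proj k : EuclideanSpace ℝ (Fin n) →L[ℝ] ℝ).contDiff.contDiffAt.comp z
      contDiffAt_snd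
  exact h1.mul ((contDiffAt_christoffel g hφ hz k i h).comp z contDiffAt_fst)

lemma fderiv_horCoord (hφ : φ ∈ IsManifold.maximalAtlas (𝓡 n) ∞ M) (hz : z.1 ∈ φ.target)
    (i : Fin n) (ζ : EuclideanSpace ℝ (Fin n) × EuclideanSpace ℝ (Fin n)) :
    fderiv ℝ (horCoord g φ i) z ζ =
      (0, WithLp.toLp 2 fun h ↦ ∑ k, (ζ.2 k * christoffel g φ k i h z.1
        + z.2 k * fderiv ℝ (christoffel g φ k i h) z.1 ζ.1)) := by
  have hd := ((contDiffAt_horCoord g hφ hz i).differentiableAt (by simp)).hasFDerivAt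
  refine Prod.ext ?_ ?_
  · have h1 := hd.fst.unique (hasFDerivAt_const (stdVec i) z)
    exact congr($h1 ζ)
  · ext h
    have h1 := (EuclideanSpace.proj h : EuclideanSpace ℝ (Fin n) →L[ℝ] ℝ).hasFDerivAt.comp z hd.snd
    have h2 : HasDifferentialAt (fun w ↦ ∑ k, w.2 k * christoffel g φ k i h w.1)
        (fun ζ ↦ ∑ k, (ζ.2 k * christoffel g φ k i h z.1
          + z.2 k * fderiv ℝ (christoffel g φ k i h) z.1 ζ.1)) z := by
      refine HasDifferentialAt.sum fun k _ ↦ HasDifferentialAt.mul ⟨_,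
        (EuclideanSpace.proj k : EuclideanSpace ℝ (Fin n) →L[ℝ] ℝ).hasFDerivAt.comp z
          hasFDerivAt_snd, fun ζ ↦ rfl⟩ (HasDifferentialAt.comp_fst (D := fun u ↦
            fderiv ℝ (christoffel g φ k i h) z.1 u) ⟨_, ((contDiffAt_christoffel g hφ hz k i
              h).differentiableAt (by simp)).hasFDerivAt, fun _ ↦ rfl⟩)
    exact congr($(h1.fderiv) ζ).symm.trans (h2.fderiv ζ)

lemma christoffel_symm (y : EuclideanSpace ℝ (Fin n)) (k i j : Fin n) :
    christoffel g φ k i j y = christoffel g φ k j i y := by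
  have h : (fun z ↦ metricCoeff g φ z i j) = fun z ↦ metricCoeff g φ z j i :=
    funext fun z ↦ metricCoeff_symm g z i j
  simp only [christoffel]
  congr 1
  refine Finset.sum_congr rfl fun l _ ↦ ?_
  rw [h]
  ring

variable (hφ : φ ∈ IsManifold.maximalAtlas (𝓡 n) ∞ M) (hp : p.proj ∈ φ.source)

include hφ hp

lemma mdifferentiableAt_dP (i : Fin n) :
    MDifferentiableAt (cotangentModel n) (cotangentModel n).tangent
      (fun q ↦ (⟨q, dP φ i q⟩ : TangentBundle (cotangentModel n) (CotangentBundle n M))) p :=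
  mdifferentiableAt_liftField hφ hp (contDiffAt_vertCoord i)

lemma mdifferentiableAt_delta (i : Fin n) :
    MDifferentiableAt (cotangentModel n) (cotangentModel n).tangent
      (fun q ↦ (⟨q, delta g φ i q⟩ : TangentBundle (cotangentModel n) (CotangentBundle n M))) p := by
  rw [delta_eq_liftField]
  exact mdifferentiableAt_liftField hφ hp (contDiffAt_horCoord g hφ (φ.map_source hp) i)

lemma inducedDiff_mlieBracket_dP_dP (i j : Fin n) :
    inducedDiff φ p (VectorField.mlieBracket (cotangentModel n) (dP φ i) (dP φ j) p) = 0 := by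
  rw [dP_eq_liftField, dP_eq_liftField, mlieBracket_liftField hφ hp (contDiffAt_vertCoord i)
    (contDiffAt_vertCoord j), (isInvertible_inducedDiff hφ hp).self_apply_inverse,
    VectorField.lieBracket]
  have h : ∀ i, fderiv ℝ (vertCoord i) (inducedChart φ p) = 0 := fun i ↦ fderiv_const_apply _
  simp [h]

/-- Since `∂ʲ` has constant coordinates, the bracket is minus the derivative of `δ_i` in the
direction of `p_j`, in which `δ_i` is linear. -/
lemma inducedDiff_mlieBracket_delta_dP (i j : Fin n) :
    inducedDiff φ p (VectorField.mlieBracket (cotangentModel n) (delta g φ i) (dP φ j) p) =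
      (0, WithLp.toLp 2 fun h ↦ -Gam g φ p j i h) := by
  rw [dP_eq_liftField, delta_eq_liftField, mlieBracket_liftField hφ hp
    (contDiffAt_horCoord g hφ (φ.map_source hp) i)
    (contDiffAt_vertCoord j), (isInvertible_inducedDiff hφ hp).self_apply_inverse,
    VectorField.lieBracket]
  have h : ∀ i, fderiv ℝ (vertCoord i) (inducedChart φ p) = 0 := fun i ↦ fderiv_const_apply _
  rw [h, fderiv_horCoord g hφ (φ.map_source hp), _root_.zero_apply]
  refine Prod.ext (by simp) ?_
  ext h
  simp [vertCoord, stdVec, inducedChart, Gam]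

/-- The curvature is the obstruction to integrability of the horizontal distribution: the bracket is
vertical with components `R^0_{hij}`. -/
lemma inducedDiff_mlieBracket_delta_delta (i j : Fin n) :
    inducedDiff φ p (VectorField.mlieBracket (cotangentModel n) (delta g φ i) (delta g φ j) p) =
      (0, WithLp.toLp 2 fun h ↦ R0 g φ p h i j) := by
  rw [delta_eq_liftField, delta_eq_liftField, mlieBracket_liftField hφ hp
    (contDiffAt_horCoord g hφ (φ.map_source hp) i) (contDiffAt_horCoord g hφ (φ.map_source hp) j),
    (isInvertible_inducedDiff hφ hp).self_apply_inverse, VectorField.lieBracket,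
    fderiv_horCoord g hφ (φ.map_source hp), fderiv_horCoord g hφ (φ.map_source hp)]
  refine Prod.ext (by simp) ?_
  ext h
  -- Collecting the factor `p_l`; what multiplies it, antisymmetrized in `a`, `b`, is the defining
  -- expression of the curvature.
  have h1 : ∀ a b, (∑ k, ((∑ l, mom φ p l * christoffel g φ l a k (φ p.proj))
      * christoffel g φ k b h (φ p.proj)
      + mom φ p k * pderiv (christoffel g φ k b h) a (φ p.proj))) =
      ∑ l, mom φ p l * (∑ k, christoffel g φ l a k (φ p.proj) * christoffel g φ k b h (φ p.proj)
        + pderiv (christoffel g φ l b h) a (φ p.proj)) := fun a b ↦ by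
    simp only [Finset.sum_mul, Finset.mul_sum, mul_add, Finset.sum_add_distrib]
    rw [Finset.sum_comm]
    congr 1
    exact Finset.sum_congr rfl fun _ _ ↦ Finset.sum_congr rfl fun _ _ ↦ mul_assoc _ _ _
  change (∑ k, ((∑ l, mom φ p l * christoffel g φ l i k (φ p.proj))
      * christoffel g φ k j h (φ p.proj)
      + mom φ p k * pderiv (christoffel g φ k j h) i (φ p.proj)))
    - (∑ k, ((∑ l, mom φ p l * christoffel g φ l j k (φ p.proj))
      * christoffel g φ k i h (φ p.proj)
      + mom φ p k * pderiv (christoffel g φ k i h) j (φ p.proj))) = R0 g φ p h i j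
  rw [h1, h1, R0, ← Finset.sum_sub_distrib]
  refine Finset.sum_congr rfl fun l _ ↦ ?_
  rw [curvature, Finset.sum_sub_distrib]
  ring

end Frame

/-! ### The lifted metric in the adapted frame -/

/-- The Sherman–Morrison identity for `a g + b p p`, where `2t` is the square length of `p`. -/
lemma rank_one_update_inv {a b t : ℝ} (ha : a ≠ 0) (hab : a + 2 * t * b ≠ 0) (k u v : ℝ) :
    1 / a * a * k + b / a * v * u - b / (a * (a + 2 * t * b)) * u * a * v
      - b / (a * (a + 2 * t * b)) * u * b * v * (2 * t) = k := by
  -- Naming the denominator keeps it atomic while the fractions are cleared.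
  obtain ⟨s, hs⟩ : ∃ s, s = a + 2 * t * b := ⟨_, rfl⟩
  rw [← hs] at hab ⊢
  field_simp
  rw [hs]
  ring

section Algebra

variable {n : ℕ} {M : Type*} [TopologicalSpace M] [ChartedSpace (EuclideanSpace ℝ (Fin n)) M]
  [IsManifold (𝓡 n) ∞ M]
  (g : ContMDiffRiemannianMetric (𝓡 n) ∞ (EuclideanSpace ℝ (Fin n))
      (fun x : M ↦ TangentSpace (𝓡 n) x))
  {φ : OpenPartialHomeomorph M (EuclideanSpace ℝ (Fin n))} {p : CotangentBundle n M}

lemma sum_gUp_mom (i : Fin n) : ∑ j, gUp g φ p i j * mom φ p j = pUp g φ p i :=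
  Finset.sum_congr rfl fun j _ ↦ by rw [gUp_symm, mul_comm]

lemma sum_pUp_mom : ∑ j, pUp g φ p j * mom φ p j = 2 * energy g φ p := by
  rw [energy_eq]
  ring

variable (C : Coefficients)

lemma G1_symm (i j : Fin n) : G1 g φ C p i j = G1 g φ C p j i := by
  rw [G1, G1, gLow_symm]
  ring

lemma G2_symm (i j : Fin n) : G2 g φ C p i j = G2 g φ C p j i := by
  rw [G2, G2, gUp_symm]
  ring

lemma H1_symm (i j : Fin n) : H1 g φ C p i j = H1 g φ C p j i := by
  simp only [H1]
  rw [gUp_symm]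
  ring

lemma H2_symm (i j : Fin n) : H2 g φ C p i j = H2 g φ C p j i := by
  simp only [H2]
  rw [gLow_symm]
  ring

variable (hφ : φ ∈ IsManifold.maximalAtlas (𝓡 n) ∞ M) (hp : p.proj ∈ φ.source)

include hφ hp

lemma energy_nonneg : 0 ≤ energy g φ p :=
  energyCoord_nonneg g (z := inducedChart φ p) hφ (φ.map_source hp)

lemma sum_gUp_gLow (i k : Fin n) : ∑ j, gUp g φ p i j * gLow g φ p j k = kron i k := by
  have h := Matrix.nonsing_inv_mul _
    ((Matrix.isUnit_iff_isUnit_det _).1 (isUnit_metricCoeff g hφ (φ.map_source hp)))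
  have h1 := congr($h i k)
  rw [Matrix.mul_apply, Matrix.one_apply] at h1
  exact h1

lemma sum_gLow_gUp (i k : Fin n) : ∑ j, gLow g φ p i j * gUp g φ p j k = kron i k := by
  have h := Matrix.mul_nonsing_inv _
    ((Matrix.isUnit_iff_isUnit_det _).1 (isUnit_metricCoeff g hφ (φ.map_source hp)))
  have h1 := congr($h i k)
  rw [Matrix.mul_apply, Matrix.one_apply] at h1
  exact h1

lemma sum_gLow_pUp (i : Fin n) : ∑ j, gLow g φ p i j * pUp g φ p j = mom φ p i := by
  simp only [← sum_gUp_mom, Finset.mul_sum, ← mul_assoc]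
  rw [Finset.sum_comm]
  simp only [← Finset.sum_mul, sum_gLow_gUp g hφ hp, sum_kron_mul]

variable (hpos : ∀ t : ℝ, 0 ≤ t → 0 < C.c₁ t ∧ 0 < C.c₂ t ∧
      0 < C.c₁ t + 2 * t * C.d₁ t ∧ 0 < C.c₂ t + 2 * t * C.d₂ t)

include hpos

lemma sum_H1_G1 (i k : Fin n) : ∑ j, H1 g φ C p i j * G1 g φ C p j k = kron i k := by
  obtain ⟨h1, -, h2, -⟩ := hpos _ (energy_nonneg g hφ hp)
  have h3 : ∑ j, pUp g φ p j * gLow g φ p j k = mom φ p k := by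
    rw [← sum_gLow_pUp g hφ hp]
    exact Finset.sum_congr rfl fun j _ ↦ by rw [gLow_symm, mul_comm]
  have h4 : ∑ j, pUp g φ p j * mom φ p j = 2 * energy g φ p := sum_pUp_mom g
  simp only [H1, G1]
  set t := energy g φ p
  set a := C.c₁ t
  set b := C.d₁ t
  have h : ∀ j, (1 / a * gUp g φ p i j - b / (a * (a + 2 * t * b)) * pUp g φ p i * pUp g φ p j)
      * (a * gLow g φ p j k + b * mom φ p j * mom φ p k) =
      (1 / a * a) * (gUp g φ p i j * gLow g φ p j k)
      + (b / a * mom φ p k) * (gUp g φ p i j * mom φ p j)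
      - (b / (a * (a + 2 * t * b)) * pUp g φ p i * a) * (pUp g φ p j * gLow g φ p j k)
      - (b / (a * (a + 2 * t * b)) * pUp g φ p i * b * mom φ p k) * (pUp g φ p j * mom φ p j) :=
    fun j ↦ by ring
  simp only [h, Finset.sum_add_distrib, Finset.sum_sub_distrib, ← Finset.mul_sum, h3,
    h4, sum_gUp_gLow g hφ hp, sum_gUp_mom]
  exact rank_one_update_inv h1.ne' h2.ne' _ _ _

lemma sum_H2_G2 (i k : Fin n) : ∑ j, H2 g φ C p i j * G2 g φ C p j k = kron i k := by
  obtain ⟨-, h1, -, h2⟩ := hpos _ (energy_nonneg g hφ hp)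
  have h3 : ∑ j, mom φ p j * gUp g φ p j k = pUp g φ p k := rfl
  have h4 : ∑ j, mom φ p j * pUp g φ p j = 2 * energy g φ p := by
    rw [← sum_pUp_mom]
    exact Finset.sum_congr rfl fun j _ ↦ mul_comm _ _
  simp only [H2, G2]
  set t := energy g φ p
  set a := C.c₂ t
  set b := C.d₂ t
  have h : ∀ j, (1 / a * gLow g φ p i j - b / (a * (a + 2 * t * b)) * mom φ p i * mom φ p j)
      * (a * gUp g φ p j k + b * pUp g φ p j * pUp g φ p k) =
      (1 / a * a) * (gLow g φ p i j * gUp g φ p j k)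
      + (b / a * pUp g φ p k) * (gLow g φ p i j * pUp g φ p j)
      - (b / (a * (a + 2 * t * b)) * mom φ p i * a) * (mom φ p j * gUp g φ p j k)
      - (b / (a * (a + 2 * t * b)) * mom φ p i * b * pUp g φ p k) * (mom φ p j * pUp g φ p j) :=
    fun j ↦ by ring
  simp only [h, Finset.sum_add_distrib, Finset.sum_sub_distrib, ← Finset.mul_sum, h3, h4,
    sum_gLow_gUp g hφ hp, sum_gLow_pUp g hφ hp]
  exact rank_one_update_inv h1.ne' h2.ne' _ _ _

/-- Raising an index with `H₍₁₎` and lowering it again with its inverse `G⁽¹⁾` does nothing. -/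
lemma sum_raise_G1 (X : Fin n → ℝ) (k : Fin n) :
    ∑ h, (∑ l, H1 g φ C p h l * X l) * G1 g φ C p h k = X k := by
  simp only [Finset.sum_mul]
  rw [Finset.sum_comm]
  have h : ∀ l, ∑ h, H1 g φ C p h l * X l * G1 g φ C p h k = kron k l * X l := fun l ↦ by
    rw [show (kron k l : ℝ) = kron l k by simp [kron, eq_comm], ← sum_H1_G1 g C hφ hp hpos l k,
      Finset.sum_mul]
    exact Finset.sum_congr rfl fun h _ ↦ by rw [H1_symm]; ring
  simp only [h, sum_kron_mul]

lemma sum_raise_G2 (X : Fin n → ℝ) (k : Fin n) :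
    ∑ h, (∑ l, H2 g φ C p h l * X l) * G2 g φ C p h k = X k := by
  simp only [Finset.sum_mul]
  rw [Finset.sum_comm]
  have h : ∀ l, ∑ h, H2 g φ C p h l * X l * G2 g φ C p h k = kron k l * X l := fun l ↦ by
    rw [show (kron k l : ℝ) = kron l k by simp [kron, eq_comm], ← sum_H2_G2 g C hφ hp hpos l k,
      Finset.sum_mul]
    exact Finset.sum_congr rfl fun h _ ↦ by rw [H2_symm]; ring
  simp only [h, sum_kron_mul]

lemma eq_of_sum_G1 {x y : Fin n → ℝ}
    (h : ∀ k, ∑ i, x i * G1 g φ C p i k = ∑ i, y i * G1 g φ C p i k) : x = y := by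
  have key : ∀ (x : Fin n → ℝ) l, ∑ k, (∑ i, x i * G1 g φ C p i k) * H1 g φ C p l k = x l :=
      fun x l ↦ by
    simp only [Finset.sum_mul]
    rw [Finset.sum_comm]
    have h : ∀ i, ∑ k, x i * G1 g φ C p i k * H1 g φ C p l k = kron l i * x i := fun i ↦ by
      rw [← sum_H1_G1 g C hφ hp hpos l i, Finset.sum_mul]
      exact Finset.sum_congr rfl fun k _ ↦ by rw [G1_symm]; ring
    simp only [h, sum_kron_mul]
  funext l
  rw [← key x l, ← key y l]
  simp only [h]

lemma eq_of_sum_G2 {x y : Fin n → ℝ}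
    (h : ∀ k, ∑ i, x i * G2 g φ C p i k = ∑ i, y i * G2 g φ C p i k) : x = y := by
  have key : ∀ (x : Fin n → ℝ) l, ∑ k, (∑ i, x i * G2 g φ C p i k) * H2 g φ C p l k = x l :=
      fun x l ↦ by
    simp only [Finset.sum_mul]
    rw [Finset.sum_comm]
    have h : ∀ i, ∑ k, x i * G2 g φ C p i k * H2 g φ C p l k = kron l i * x i := fun i ↦ by
      rw [← sum_H2_G2 g C hφ hp hpos l i, Finset.sum_mul]
      exact Finset.sum_congr rfl fun k _ ↦ by rw [G2_symm]; ring
    simp only [h, sum_kron_mul]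
  funext l
  rw [← key x l, ← key y l]
  simp only [h]

/-- Lowered, the coefficient `Q` is the Koszul expression of the metric `G₍₂₎` on a fibre. -/
lemma sum_Q_G2 (i j k : Fin n) :
    ∑ h, Q g φ C p i j h * G2 g φ C p h k = 1 / 2 *
      (pDeriv φ (fun q ↦ G2 g φ C q j k) i p + pDeriv φ (fun q ↦ G2 g φ C q i k) j p
        - pDeriv φ (fun q ↦ G2 g φ C q i j) k p) := by
  simp only [Q, mul_assoc, ← Finset.mul_sum]
  rw [sum_raise_G2 g C hφ hp hpos]

lemma sum_P_G1 (i j k : Fin n) :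
    ∑ h, P g φ C p h i j * G1 g φ C p h k = 1 / 2 *
      (pDeriv φ (fun q ↦ G1 g φ C q j k) i p - ∑ l, G2 g φ C p i l * R0 g φ p l j k) := by
  simp only [P, mul_assoc, ← Finset.mul_sum]
  rw [sum_raise_G1 g C hφ hp hpos]

/-- The curvature term of `S` already carries a lower index, so it is contracted with `G₍₂₎`, while
for the other term lowering undoes `H⁽²⁾`. -/
lemma sum_S_G2 (i j k : Fin n) :
    ∑ h, S g φ C p h i j * G2 g φ C p h k = -(1 / 2) *
      pDeriv φ (fun q ↦ G1 g φ C q i j) k p + 1 / 2 * ∑ h, R0 g φ p h i j * G2 g φ C p h k := by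
  simp only [S, add_mul, Finset.sum_add_distrib, mul_assoc, ← Finset.mul_sum]
  rw [sum_raise_G2 g C hφ hp hpos]

end Algebra

/-! ### The coframe `(dqⁱ, Dp_i)` dual to the adapted frame. -/

section Forms

variable {n : ℕ} {M : Type*} [TopologicalSpace M] [ChartedSpace (EuclideanSpace ℝ (Fin n)) M]
  [IsManifold (𝓡 n) ∞ M]
  (g : ContMDiffRiemannianMetric (𝓡 n) ∞ (EuclideanSpace ℝ (Fin n))
      (fun x : M ↦ TangentSpace (𝓡 n) x))
  {φ : OpenPartialHomeomorph M (EuclideanSpace ℝ (Fin n))} {p : CotangentBundle n M}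

lemma formDq_add (i : Fin n) (ξ η : TangentSpace (cotangentModel n) p) :
    formDq φ p i (ξ + η) = formDq φ p i ξ + formDq φ p i η := by
  rw [formDq, ContinuousLinearMap.map_add]; rfl

lemma formDq_neg (i : Fin n) (ξ : TangentSpace (cotangentModel n) p) :
    formDq φ p i (-ξ) = -formDq φ p i ξ := by
  rw [formDq, ContinuousLinearMap.map_neg]; rfl

lemma formDq_sum {ι : Type*} (s : Finset ι) (c : ι → ℝ)
    (ξ : ι → TangentSpace (cotangentModel n) p) (i : Fin n) :
    formDq φ p i (∑ a ∈ s, c a • ξ a) = ∑ a ∈ s, c a * formDq φ p i (ξ a) := by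
  rw [formDq, inducedDiff_sum, Prod.fst_sum, WithLp.ofLp_sum, Finset.sum_apply]
  rfl

lemma formDp_add (i : Fin n) (ξ η : TangentSpace (cotangentModel n) p) :
    formDp g φ p i (ξ + η) = formDp g φ p i ξ + formDp g φ p i η := by
  simp only [formDp, formDq_add, mul_add, Finset.sum_add_distrib, ContinuousLinearMap.map_add,
    Prod.snd_add, PiLp.add_apply]
  ring

lemma formDp_neg (i : Fin n) (ξ : TangentSpace (cotangentModel n) p) :
    formDp g φ p i (-ξ) = -formDp g φ p i ξ := by
  simp only [formDp, formDq_neg, mul_neg, Finset.sum_neg_distrib, ContinuousLinearMap.map_neg,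
    Prod.snd_neg, PiLp.neg_apply]
  ring

lemma formDp_sum {ι : Type*} (s : Finset ι) (c : ι → ℝ)
    (ξ : ι → TangentSpace (cotangentModel n) p) (i : Fin n) :
    formDp g φ p i (∑ a ∈ s, c a • ξ a) = ∑ a ∈ s, c a * formDp g φ p i (ξ a) := by
  simp only [formDp, formDq_sum, mul_sub, Finset.sum_sub_distrib, inducedDiff_sum, Prod.snd_sum,
    WithLp.ofLp_sum, Finset.sum_apply, Finset.mul_sum]
  congr 1
  rw [Finset.sum_comm]
  exact Finset.sum_congr rfl fun a _ ↦ Finset.sum_congr rfl fun b _ ↦ by ring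

variable (hφ : φ ∈ IsManifold.maximalAtlas (𝓡 n) ∞ M) (hp : p.proj ∈ φ.source)

include hφ hp

lemma formDq_dP (i j : Fin n) : formDq φ p i (dP φ j p) = 0 := by
  rw [formDq, inducedDiff_dP hφ hp]; rfl

lemma formDq_delta (i j : Fin n) : formDq φ p i (delta g φ j p) = kron i j := by
  rw [formDq, inducedDiff_delta g hφ hp]
  simp [stdVec, kron]

lemma formDp_dP (i j : Fin n) : formDp g φ p i (dP φ j p) = kron i j := by
  simp only [formDp, formDq_dP hφ hp, inducedDiff_dP hφ hp]
  simp [stdVec, kron]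

omit hφ hp in
lemma Gam_symm (k i j : Fin n) : Gam g φ p k i j = Gam g φ p k j i := christoffel_symm g _ k i j

/-- `Dp` and `δ` use the lower indices of the Christoffel symbols in opposite order, so this needs
their symmetry. -/
lemma formDp_delta (i j : Fin n) : formDp g φ p i (delta g φ j p) = 0 := by
  simp only [formDp, formDq_delta g hφ hp, inducedDiff_delta g hφ hp]
  have h : ∀ a, (kron a j : ℝ) = kron j a := fun a ↦ by simp [kron, eq_comm]
  simp only [h, sum_mul_kron, Gam0, Gam_symm g _ i j, sub_self]

/-- The forms `dq` and `Dp` together are a coframe: `dp` is recovered from them, and the induced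
differential is injective. -/
lemma tangent_ext {ξ η : TangentSpace (cotangentModel n) p}
    (h1 : ∀ i, formDq φ p i ξ = formDq φ p i η) (h2 : ∀ i, formDp g φ p i ξ = formDp g φ p i η) :
    ξ = η := by
  apply (isInvertible_inducedDiff hφ hp).injective
  refine Prod.ext ?_ ?_
  · ext i
    exact h1 i
  · ext i
    have h := h2 i
    simp only [formDp, h1] at h
    linarith

variable (C : Coefficients)

lemma localLift_dP (ξ : TangentSpace (cotangentModel n) p) (k : Fin n) :
    localLift g φ C p ξ (dP φ k p) = ∑ i, formDp g φ p i ξ * G2 g φ C p i k := by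
  simp only [localLift, formDq_dP hφ hp, formDp_dP g hφ hp, mul_zero, Finset.sum_const_zero,
    zero_add]
  refine Finset.sum_congr rfl fun i _ ↦ ?_
  have h : ∀ a, (kron a k : ℝ) = kron k a := fun a ↦ by simp [kron, eq_comm]
  simp only [h, sum_mul_kron]
  ring

lemma localLift_delta (ξ : TangentSpace (cotangentModel n) p) (k : Fin n) :
    localLift g φ C p ξ (delta g φ k p) = ∑ i, formDq φ p i ξ * G1 g φ C p i k := by
  simp only [localLift, formDq_delta g hφ hp, formDp_delta g hφ hp, mul_zero,
    Finset.sum_const_zero, add_zero]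
  refine Finset.sum_congr rfl fun i _ ↦ ?_
  have h : ∀ a, (kron a k : ℝ) = kron k a := fun a ↦ by simp [kron, eq_comm]
  simp only [h, sum_mul_kron]
  ring

omit hφ hp in
lemma localLift_symm (ξ η : TangentSpace (cotangentModel n) p) :
    localLift g φ C p ξ η = localLift g φ C p η ξ := by
  rw [localLift, localLift]
  congr 1
  · rw [Finset.sum_comm]
    exact Finset.sum_congr rfl fun i _ ↦ Finset.sum_congr rfl fun j _ ↦ by rw [G1_symm]; ring
  · rw [Finset.sum_comm]
    exact Finset.sum_congr rfl fun i _ ↦ Finset.sum_congr rfl fun j _ ↦ by rw [G2_symm]; ring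

end Forms

/-! ### The Levi-Civita connection in the adapted frame -/

/-- Koszul's uniqueness argument: a trilinear expression that is symmetric in the first two
arguments and skew in the last two vanishes. -/
lemma eq_zero_of_symm_of_skew {ι : Type*} {T : ι → ι → ι → ℝ} (h1 : ∀ a b c, T a b c = T b a c)
    (h2 : ∀ a b c, T a b c + T a c b = 0) (a b c : ι) : T a b c = 0 := by
  linarith [h1 a b c, h1 b c a, h1 c a b, h2 a b c, h2 b c a, h2 c a b]

section Connection

variable {n : ℕ} {M : Type*} [TopologicalSpace M] [ChartedSpace (EuclideanSpace ℝ (Fin n)) M]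
  [IsManifold (𝓡 n) ∞ M]
  (g : ContMDiffRiemannianMetric (𝓡 n) ∞ (EuclideanSpace ℝ (Fin n))
      (fun x : M ↦ TangentSpace (𝓡 n) x))
  {φ : OpenPartialHomeomorph M (EuclideanSpace ℝ (Fin n))} {p : CotangentBundle n M}
  (C : Coefficients)

variable (φ) in
/-- The adapted frame `(∂¹, …, ∂ⁿ, δ_1, …, δ_n)`. -/
def adaptedFrame (a : Fin n ⊕ Fin n) (q : CotangentBundle n M) :
    TangentSpace (cotangentModel n) q :=
  Sum.elim (fun i ↦ dP φ i q) (fun i ↦ delta g φ i q) a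

variable (φ) in
/-- The connection coefficients `∇_{e_a} e_b` of the adapted frame. -/
def connCoeff (p : CotangentBundle n M) :
    Fin n ⊕ Fin n → Fin n ⊕ Fin n → TangentSpace (cotangentModel n) p
  | .inl i, .inl j => ∑ h, Q g φ C p i j h • dP φ h p
  | .inr i, .inl j => -(∑ h, Gam g φ p j i h • dP φ h p) + ∑ h, P g φ C p h j i • delta g φ h p
  | .inl i, .inr j => ∑ h, P g φ C p h i j • delta g φ h p
  | .inr i, .inr j => (∑ h, Gam g φ p h i j • delta g φ h p) + ∑ h, S g φ C p h i j • dP φ h p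

lemma mvfderiv_congr {f f' : CotangentBundle n M → ℝ} (h : f =ᶠ[𝓝 p] f')
    (ξ : TangentSpace (cotangentModel n) p) :
    mvfderiv (cotangentModel n) f p ξ = mvfderiv (cotangentModel n) f' p ξ :=
  congr($(h.mfderiv_eq) ξ)

lemma mvfderiv_zero_fun (ξ : TangentSpace (cotangentModel n) p) :
    mvfderiv (cotangentModel n) (fun _ : CotangentBundle n M ↦ (0 : ℝ)) p ξ = 0 := by
  rw [mvfderiv_const]; rfl

variable (hφ : φ ∈ IsManifold.maximalAtlas (𝓡 n) ∞ M) (hp : p.proj ∈ φ.source)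

include hφ hp

lemma formDq_sum_dP (c : Fin n → ℝ) (i : Fin n) :
    formDq φ p i (∑ h, c h • dP φ h p) = 0 := by
  rw [formDq_sum]
  simp only [formDq_dP hφ hp, mul_zero, Finset.sum_const_zero]

lemma formDq_sum_delta (c : Fin n → ℝ) (i : Fin n) :
    formDq φ p i (∑ h, c h • delta g φ h p) = c i := by
  rw [formDq_sum]
  simp only [formDq_delta g hφ hp, sum_mul_kron]

lemma formDp_sum_dP (c : Fin n → ℝ) (i : Fin n) :
    formDp g φ p i (∑ h, c h • dP φ h p) = c i := by
  rw [formDp_sum]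
  simp only [formDp_dP g hφ hp, sum_mul_kron]

lemma formDp_sum_delta (c : Fin n → ℝ) (i : Fin n) :
    formDp g φ p i (∑ h, c h • delta g φ h p) = 0 := by
  rw [formDp_sum]
  simp only [formDp_delta g hφ hp, mul_zero, Finset.sum_const_zero]

lemma mdifferentiableAt_adaptedFrame (a : Fin n ⊕ Fin n) :
    MDifferentiableAt (cotangentModel n) (cotangentModel n).tangent
      (fun q ↦ (⟨q, adaptedFrame g φ a q⟩ :
        TangentBundle (cotangentModel n) (CotangentBundle n M))) p := by
  rcases a with i | i
  · exact mdifferentiableAt_dP hφ hp i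
  · exact mdifferentiableAt_delta g hφ hp i

omit hφ hp in
lemma sum_kron_mul_apply (A : Fin n → Fin n → ℝ) (j k : Fin n) :
    ∑ i, kron i j * A i k = A j k := by
  simp [kron]

/-- The block form of the metric is what leaves only derivatives of `G⁽¹⁾`, `G₍₂₎` and zero in the
metric compatibility. -/
lemma localLift_adaptedFrame (a b : Fin n ⊕ Fin n) :
    localLift g φ C p (adaptedFrame g φ a p) (adaptedFrame g φ b p) =
      match a, b with
      | .inl j, .inl k => G2 g φ C p j k
      | .inr j, .inr k => G1 g φ C p j k
      | _, _ => 0 := by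
  rcases a with j | j <;> rcases b with k | k
  · refine (localLift_dP g hφ hp C _ k).trans ?_
    simp only [adaptedFrame, Sum.elim_inl, formDp_dP g hφ hp, sum_kron_mul_apply]
  · refine (localLift_delta g hφ hp C _ k).trans ?_
    simp only [adaptedFrame, Sum.elim_inl, formDq_dP hφ hp, zero_mul, Finset.sum_const_zero]
  · refine (localLift_dP g hφ hp C _ k).trans ?_
    simp only [adaptedFrame, Sum.elim_inr, formDp_delta g hφ hp, zero_mul, Finset.sum_const_zero]
  · refine (localLift_delta g hφ hp C _ k).trans ?_
    simp only [adaptedFrame, Sum.elim_inr, formDq_delta g hφ hp, sum_kron_mul_apply]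

/-- The components of the connection coefficients, lowered with the lifted metric. -/
lemma localLift_connCoeff (a b c : Fin n ⊕ Fin n) :
    localLift g φ C p (connCoeff g φ C p a b) (adaptedFrame g φ c p) =
      match a, b, c with
      | .inl i, .inl j, .inl k => ∑ h, Q g φ C p i j h * G2 g φ C p h k
      | .inr i, .inl j, .inl k => -∑ h, Gam g φ p j i h * G2 g φ C p h k
      | .inr i, .inl j, .inr k => ∑ h, P g φ C p h j i * G1 g φ C p h k
      | .inl i, .inr j, .inr k => ∑ h, P g φ C p h i j * G1 g φ C p h k
      | .inr i, .inr j, .inl k => ∑ h, S g φ C p h i j * G2 g φ C p h k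
      | .inr i, .inr j, .inr k => ∑ h, Gam g φ p h i j * G1 g φ C p h k
      | _, _, _ => 0 := by
  rcases c with k | k
  · refine (localLift_dP g hφ hp C _ k).trans ?_
    rcases a with i | i <;> rcases b with j | j <;>
    simp only [connCoeff, formDp_add, formDp_neg, formDp_sum_dP g hφ hp,
      formDp_sum_delta g hφ hp, zero_add, add_zero, zero_mul, neg_mul,
      Finset.sum_neg_distrib, Finset.sum_const_zero]
  · refine (localLift_delta g hφ hp C _ k).trans ?_
    rcases a with i | i <;> rcases b with j | j <;>
    simp only [connCoeff, formDq_add, formDq_neg, formDq_sum_dP hφ hp,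
      formDq_sum_delta g hφ hp, neg_zero, zero_add, add_zero, zero_mul, Finset.sum_const_zero]

omit hφ hp in
lemma pDeriv_G1_symm (i j k : Fin n) :
    pDeriv φ (fun q ↦ G1 g φ C q j k) i p = pDeriv φ (fun q ↦ G1 g φ C q k j) i p :=
  congrArg (fun f ↦ pDeriv φ f i p) (funext fun _ ↦ G1_symm g C j k)

omit hφ hp in
lemma pDeriv_G2_symm (i j k : Fin n) :
    pDeriv φ (fun q ↦ G2 g φ C q j k) i p = pDeriv φ (fun q ↦ G2 g φ C q k j) i p :=
  congrArg (fun f ↦ pDeriv φ f i p) (funext fun _ ↦ G2_symm g C j k)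

omit hφ hp in
lemma Q_symm (i j h : Fin n) : Q g φ C p i j h = Q g φ C p j i h := by
  rw [Q, Q]
  congr 1
  refine Finset.sum_congr rfl fun k _ ↦ ?_
  rw [pDeriv_G2_symm g C k i j]
  ring

omit hφ hp in
lemma R0_swap (k i j : Fin n) : R0 g φ p k i j = -R0 g φ p k j i := by
  rw [R0, R0, ← Finset.sum_neg_distrib]
  refine Finset.sum_congr rfl fun h _ ↦ ?_
  rw [curvature, curvature, Finset.sum_sub_distrib, Finset.sum_sub_distrib]
  ring

omit hφ hp in
-- The derivative part of `S` is symmetric in `i`, `j` and its curvature part is skew; this is the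
-- torsion equation for `δ_i`, `δ_j`.
lemma S_sub_swap (h i j : Fin n) : S g φ C p h i j - S g φ C p h j i = R0 g φ p h i j := by
  have h1 : ∀ k, pDeriv φ (fun q ↦ G1 g φ C q i j) k p = pDeriv φ (fun q ↦ G1 g φ C q j i) k p :=
    fun k ↦ pDeriv_G1_symm g C k i j
  simp only [S, h1]
  rw [R0_swap g h j i]
  ring

omit hφ hp in
lemma forms_of_inducedDiff {ξ : TangentSpace (cotangentModel n) p} {w : Fin n → ℝ}
    (h : inducedDiff φ p ξ = (0, WithLp.toLp 2 w)) (i : Fin n) :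
    formDq φ p i ξ = 0 ∧ formDp g φ p i ξ = w i := by
  have h1 : ∀ i, formDq φ p i ξ = 0 := fun i ↦ by rw [formDq, h]; rfl
  refine ⟨h1 i, ?_⟩
  simp only [formDp, h1, h, mul_zero, Finset.sum_const_zero, sub_zero]

/-- The connection coefficients have no torsion. -/
lemma connCoeff_sub_connCoeff (a b : Fin n ⊕ Fin n) :
    connCoeff g φ C p a b - connCoeff g φ C p b a =
      VectorField.mlieBracket (cotangentModel n) (adaptedFrame g φ a) (adaptedFrame g φ b) p := by
  have hPP : ∀ i j k, _ ∧ _ := fun i j ↦ forms_of_inducedDiff g (w := 0)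
    (inducedDiff_mlieBracket_dP_dP hφ hp i j)
  have hDP : ∀ i j k, _ ∧ _ := fun i j ↦ forms_of_inducedDiff g
    (inducedDiff_mlieBracket_delta_dP g hφ hp i j)
  have hDD : ∀ i j k, _ ∧ _ := fun i j ↦ forms_of_inducedDiff g
    (inducedDiff_mlieBracket_delta_delta g hφ hp i j)
  rw [sub_eq_add_neg]
  refine tangent_ext g hφ hp (fun h ↦ ?_) fun h ↦ ?_
  · rw [formDq_add, formDq_neg]
    rcases a with i | i <;> rcases b with j | j
    · refine Eq.trans ?_ (hPP i j h).1.symm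
      simp only [connCoeff, formDq_sum_dP hφ hp, neg_zero, add_zero]
    -- Only the bracket of a horizontal with a vertical field was computed; the opposite order
    -- follows by antisymmetry.
    · rw [VectorField.mlieBracket_swap_apply, formDq_neg]
      refine Eq.trans ?_ (congrArg Neg.neg (hDP j i h).1).symm
      simp only [connCoeff, formDq_add, formDq_neg, formDq_sum_dP hφ hp,
        formDq_sum_delta g hφ hp]
      ring
    · refine Eq.trans ?_ (hDP i j h).1.symm
      simp only [connCoeff, formDq_add, formDq_neg, formDq_sum_dP hφ hp,
        formDq_sum_delta g hφ hp]
      ring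
    · refine Eq.trans ?_ (hDD i j h).1.symm
      simp only [connCoeff, formDq_add, formDq_sum_dP hφ hp, formDq_sum_delta g hφ hp]
      rw [Gam_symm]
      ring
  · rw [formDp_add, formDp_neg]
    rcases a with i | i <;> rcases b with j | j
    · refine Eq.trans ?_ (hPP i j h).2.symm
      simp only [connCoeff, formDp_sum_dP g hφ hp]
      rw [Q_symm]
      exact add_neg_cancel _
    · rw [VectorField.mlieBracket_swap_apply, formDp_neg]
      refine Eq.trans ?_ (congrArg Neg.neg (hDP j i h).2).symm
      simp only [connCoeff, formDp_add, formDp_neg, formDp_sum_dP g hφ hp,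
        formDp_sum_delta g hφ hp]
      ring
    · refine Eq.trans ?_ (hDP i j h).2.symm
      simp only [connCoeff, formDp_add, formDp_neg, formDp_sum_dP g hφ hp,
        formDp_sum_delta g hφ hp]
      ring
    · refine Eq.trans ?_ (hDD i j h).2.symm
      simp only [connCoeff, formDp_add, formDp_sum_dP g hφ hp, formDp_sum_delta g hφ hp]
      rw [← S_sub_swap g C]
      ring

/-- The connection coefficients are compatible with the lifted metric. -/
lemma mvfderiv_localLift_adaptedFrame
    (hc₁ : ContDiffOn ℝ ∞ C.c₁ (Ici 0)) (hc₂ : ContDiffOn ℝ ∞ C.c₂ (Ici 0))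
    (hd₁ : ContDiffOn ℝ ∞ C.d₁ (Ici 0)) (hd₂ : ContDiffOn ℝ ∞ C.d₂ (Ici 0))
    (hpos : ∀ t : ℝ, 0 ≤ t → 0 < C.c₁ t ∧ 0 < C.c₂ t ∧
      0 < C.c₁ t + 2 * t * C.d₁ t ∧ 0 < C.c₂ t + 2 * t * C.d₂ t)
    (a b c : Fin n ⊕ Fin n) :
    mvfderiv (cotangentModel n)
      (fun q ↦ localLift g φ C q (adaptedFrame g φ b q) (adaptedFrame g φ c q)) p
        (adaptedFrame g φ a p) =
      localLift g φ C p (connCoeff g φ C p a b) (adaptedFrame g φ c p)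
        + localLift g φ C p (connCoeff g φ C p a c) (adaptedFrame g φ b p) := by
  have hev : ∀ f : CotangentBundle n M → ℝ,
      (∀ q : CotangentBundle n M, q.proj ∈ φ.source →
        localLift g φ C q (adaptedFrame g φ b q) (adaptedFrame g φ c q) = f q) →
      mvfderiv (cotangentModel n)
        (fun q ↦ localLift g φ C q (adaptedFrame g φ b q) (adaptedFrame g φ c q)) p
          (adaptedFrame g φ a p) =
        mvfderiv (cotangentModel n) f p (adaptedFrame g φ a p) := fun f hf ↦ by
    refine mvfderiv_congr ?_ _
    filter_upwards [(isOpen_proj_preimage_source φ).mem_nhds hp] with q hq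
    exact hf q hq
  -- Near `p` the function being differentiated is a constant zero or an entry of one of the two
  -- blocks, according to the types of `b` and `c`.
  rw [hev _ fun q hq ↦ localLift_adaptedFrame g C hφ hq b c, localLift_connCoeff g C hφ hp,
    localLift_connCoeff g C hφ hp]
  rcases a with i | i <;> rcases b with j | j <;> rcases c with k | k
  · change pDeriv φ (fun q ↦ G2 g φ C q j k) i p = _
    simp only [sum_Q_G2 g C hφ hp hpos]
    rw [pDeriv_G2_symm g C i k j]
    ring
  · simpa only [add_zero] using mvfderiv_zero_fun _
  · simpa only [add_zero] using mvfderiv_zero_fun _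
  -- The two curvature terms cancel, `R^0_{ljk}` being skew in `j`, `k`; the derivative halves add
  -- up.
  · change pDeriv φ (fun q ↦ G1 g φ C q j k) i p = _
    simp only [sum_P_G1 g C hφ hp hpos]
    rw [pDeriv_G1_symm g C i k j]
    simp only [fun l ↦ R0_swap g (φ := φ) (p := p) l k j, mul_neg, Finset.sum_neg_distrib]
    ring
  · refine (mvfderiv_G2_delta g C hφ hp hc₂ hd₂ i j k).trans ?_
    simp only [Finset.sum_add_distrib, fun h ↦ G2_symm g (φ := φ) (p := p) C j h]
    ring
  -- Vertical and horizontal fields are orthogonal, so the left side is zero. On the right, `P` and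
  -- `S` contribute opposite derivative terms and opposite curvature terms; this fixes the constants
  -- in `S`.
  · refine (mvfderiv_zero_fun _).trans ?_
    simp only [sum_P_G1 g C hφ hp hpos, sum_S_G2 g C hφ hp hpos,
      fun l ↦ G2_symm g (φ := φ) (p := p) C j l, fun l ↦ mul_comm (R0 g φ p l i k)]
    ring
  · refine (mvfderiv_zero_fun _).trans ?_
    simp only [sum_P_G1 g C hφ hp hpos, sum_S_G2 g C hφ hp hpos,
      fun l ↦ G2_symm g (φ := φ) (p := p) C k l, fun l ↦ mul_comm (R0 g φ p l i j)]
    ring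
  · refine (mvfderiv_G1_delta g C hφ hp hc₁ hd₁ i j k).trans ?_
    simp only [Finset.sum_add_distrib, fun h ↦ G1_symm g (φ := φ) (p := p) C j h]

/-- Nondegeneracy of the lift: pairing with `δ_k` recovers `dq` through `G⁽¹⁾`, pairing with `∂ᵏ`
recovers `Dp` through `G₍₂₎`. -/
lemma eq_of_localLift_adaptedFrame
    (hpos : ∀ t : ℝ, 0 ≤ t → 0 < C.c₁ t ∧ 0 < C.c₂ t ∧
      0 < C.c₁ t + 2 * t * C.d₁ t ∧ 0 < C.c₂ t + 2 * t * C.d₂ t)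
    {ξ η : TangentSpace (cotangentModel n) p}
    (h : ∀ c, localLift g φ C p ξ (adaptedFrame g φ c p) =
      localLift g φ C p η (adaptedFrame g φ c p)) : ξ = η := by
  refine tangent_ext g hφ hp (congrFun (eq_of_sum_G1 g C hφ hp hpos fun k ↦ ?_))
    (congrFun (eq_of_sum_G2 g C hφ hp hpos fun k ↦ ?_))
  · exact (localLift_delta g hφ hp C ξ k).symm.trans
      ((h (.inr k)).trans (localLift_delta g hφ hp C η k))
  · exact (localLift_dP g hφ hp C ξ k).symm.trans
      ((h (.inl k)).trans (localLift_dP g hφ hp C η k))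

omit hφ hp in
lemma localLift_add_left (ξ ξ' η : TangentSpace (cotangentModel n) p) :
    localLift g φ C p (ξ + ξ') η = localLift g φ C p ξ η + localLift g φ C p ξ' η := by
  simp only [localLift, formDq_add, formDp_add, mul_add, add_mul, Finset.sum_add_distrib]
  ring

omit hφ hp in
lemma localLift_neg_left (ξ η : TangentSpace (cotangentModel n) p) :
    localLift g φ C p (-ξ) η = -localLift g φ C p ξ η := by
  simp only [localLift, formDq_neg, formDp_neg, mul_neg, neg_mul, Finset.sum_neg_distrib]
  ring

omit hφ hp in
lemma localLift_sub_left (ξ ξ' η : TangentSpace (cotangentModel n) p) :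
    localLift g φ C p (ξ - ξ') η = localLift g φ C p ξ η - localLift g φ C p ξ' η := by
  rw [sub_eq_add_neg, localLift_add_left, localLift_neg_left, sub_eq_add_neg]

set_option maxHeartbeats 1600000 in
-- `T` below is the difference of the two connections, lowered with the lift. Equal torsion makes it
-- symmetric in the first pair, metric compatibility of both makes it skew in the last pair, so it
-- vanishes.
theorem leviCivita_adaptedFrame
    (hc₁ : ContDiffOn ℝ ∞ C.c₁ (Ici 0)) (hc₂ : ContDiffOn ℝ ∞ C.c₂ (Ici 0))
    (hd₁ : ContDiffOn ℝ ∞ C.d₁ (Ici 0)) (hd₂ : ContDiffOn ℝ ∞ C.d₂ (Ici 0))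
    (hpos : ∀ t : ℝ, 0 ≤ t → 0 < C.c₁ t ∧ 0 < C.c₂ t ∧
      0 < C.c₁ t + 2 * t * C.d₁ t ∧ 0 < C.c₂ t + 2 * t * C.d₂ t)
    (nabla : CovariantDerivative (cotangentModel n) (CotangentModel n)
        (TangentSpace (cotangentModel n) : CotangentBundle n M → Type _))
    (hnabla : IsLeviCivita (naturalLift g C) nabla) (a b : Fin n ⊕ Fin n) :
    nabla (adaptedFrame g φ b) p (adaptedFrame g φ a p) = connCoeff g φ C p a b := by
  obtain ⟨htor, hmet⟩ := hnabla
  let T : Fin n ⊕ Fin n → Fin n ⊕ Fin n → Fin n ⊕ Fin n → ℝ := fun a b c ↦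
    localLift g φ C p (nabla (adaptedFrame g φ b) p (adaptedFrame g φ a p))
        (adaptedFrame g φ c p)
      - localLift g φ C p (connCoeff g φ C p a b) (adaptedFrame g φ c p)
  have h1 : ∀ a b c, T a b c = T b a c := fun a b c ↦ by
    have h := nabla.torsion_eq_zero_iff.1 htor (mdifferentiableAt_adaptedFrame g hφ hp a)
      (mdifferentiableAt_adaptedFrame g hφ hp b)
    rw [← connCoeff_sub_connCoeff g C hφ hp] at h
    have h' := congrArg (fun ξ ↦ localLift g φ C p ξ (adaptedFrame g φ c p)) h
    simp only [localLift_sub_left] at h'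
    simp only [T]
    linarith
  have h2 : ∀ a b c, T a b c + T a c b = 0 := fun a b c ↦ by
    have h := hmet p (adaptedFrame g φ a p) _ _ (mdifferentiableAt_adaptedFrame g hφ hp b)
      (mdifferentiableAt_adaptedFrame g hφ hp c)
    -- The lift is evaluated in a chart that varies with `q`; chart independence replaces it by the
    -- fixed `φ` near `p` before differentiating.
    have hev : (fun q ↦ naturalLift g C q (adaptedFrame g φ b q) (adaptedFrame g φ c q)) =ᶠ[𝓝 p]
        fun q ↦ localLift g φ C q (adaptedFrame g φ b q) (adaptedFrame g φ c q) := by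
      filter_upwards [(isOpen_proj_preimage_source φ).mem_nhds hp] with q hq
      exact naturalLift_eq g C hφ hq _ _
    rw [mvfderiv_congr hev, mvfderiv_localLift_adaptedFrame g C hφ hp hc₁ hc₂ hd₁ hd₂ hpos,
      naturalLift_eq g C hφ hp, naturalLift_eq g C hφ hp,
      localLift_symm g C (adaptedFrame g φ b p)] at h
    simp only [T]
    linarith
  refine eq_of_localLift_adaptedFrame g C hφ hp hpos fun c ↦ ?_
  exact sub_eq_zero.1 (eq_zero_of_symm_of_skew h1 h2 a b c)

end Connection

/-! ### Transformation laws of families of components -/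

section Transforms

variable {n : ℕ} {L L₁ L₂ L₃ L₄ L₅ : Fin n → Fin n → ℝ}

/-- The components `u'` arise from `u` by the matrix `L`. -/
def Transforms₁ (L : Fin n → Fin n → ℝ) (u u' : Fin n → ℝ) : Prop :=
  ∀ i, u' i = ∑ a, L i a * u a

/-- The components `X'` arise from `X` by the matrices `L₁` and `L₂`. -/
def Transforms₂ (L₁ L₂ : Fin n → Fin n → ℝ) (X X' : Fin n → Fin n → ℝ) : Prop :=
  ∀ i j, X' i j = ∑ a, ∑ b, L₁ i a * L₂ j b * X a b

/-- The components `X'` arise from `X` by the matrices `L₁`, `L₂` and `L₃`. -/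
def Transforms₃ (L₁ L₂ L₃ : Fin n → Fin n → ℝ) (X X' : Fin n → Fin n → Fin n → ℝ) : Prop :=
  ∀ i j k, X' i j k = ∑ a, ∑ b, ∑ c, L₁ i a * L₂ j b * L₃ k c * X a b c

lemma Transforms₁.mul {u u' v v' : Fin n → ℝ} (hu : Transforms₁ L₁ u u')
    (hv : Transforms₁ L₂ v v') :
    Transforms₂ L₁ L₂ (fun a b ↦ u a * v b) (fun a b ↦ u' a * v' b) := fun i j ↦ by
  beta_reduce
  rw [hu, hv, Finset.sum_mul_sum]
  exact Finset.sum_congr rfl fun a _ ↦ Finset.sum_congr rfl fun b _ ↦ by ring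

lemma Transforms₂.add {X X' Y Y' : Fin n → Fin n → ℝ} (hX : Transforms₂ L₁ L₂ X X')
    (hY : Transforms₂ L₁ L₂ Y Y') :
    Transforms₂ L₁ L₂ (fun a b ↦ X a b + Y a b) (fun a b ↦ X' a b + Y' a b) := fun i j ↦ by
  simp only [hX i j, hY i j, mul_add, Finset.sum_add_distrib]

lemma Transforms₂.const_mul {X X' : Fin n → Fin n → ℝ} (hX : Transforms₂ L₁ L₂ X X') (r : ℝ) :
    Transforms₂ L₁ L₂ (fun a b ↦ r * X a b) (fun a b ↦ r * X' a b) := fun i j ↦ by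
  simp only [hX i j, Finset.mul_sum]
  exact Finset.sum_congr rfl fun a _ ↦ Finset.sum_congr rfl fun b _ ↦ by ring

lemma Transforms₁.mul₂ {u u' : Fin n → ℝ} {X X' : Fin n → Fin n → ℝ} (hu : Transforms₁ L₁ u u')
    (hX : Transforms₂ L₂ L₃ X X') :
    Transforms₃ L₁ L₂ L₃ (fun a b c ↦ u a * X b c) (fun a b c ↦ u' a * X' b c) := fun i j k ↦ by
  beta_reduce
  rw [hu, hX, Finset.sum_mul]
  refine Finset.sum_congr rfl fun a _ ↦ ?_
  simp only [Finset.mul_sum]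
  exact Finset.sum_congr rfl fun b _ ↦ Finset.sum_congr rfl fun c _ ↦ by ring

namespace Transforms₃

variable {X X' Y Y' : Fin n → Fin n → Fin n → ℝ}

lemma add (hX : Transforms₃ L₁ L₂ L₃ X X') (hY : Transforms₃ L₁ L₂ L₃ Y Y') :
    Transforms₃ L₁ L₂ L₃ (fun a b c ↦ X a b c + Y a b c) (fun a b c ↦ X' a b c + Y' a b c) :=
  fun i j k ↦ by simp only [hX i j k, hY i j k, mul_add, Finset.sum_add_distrib]

lemma const_mul (hX : Transforms₃ L₁ L₂ L₃ X X') (r : ℝ) :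
    Transforms₃ L₁ L₂ L₃ (fun a b c ↦ r * X a b c) (fun a b c ↦ r * X' a b c) := fun i j k ↦ by
  simp only [hX i j k, Finset.mul_sum]
  exact Finset.sum_congr rfl fun a _ ↦ Finset.sum_congr rfl fun b _ ↦
    Finset.sum_congr rfl fun c _ ↦ by ring

lemma sub (hX : Transforms₃ L₁ L₂ L₃ X X') (hY : Transforms₃ L₁ L₂ L₃ Y Y') :
    Transforms₃ L₁ L₂ L₃ (fun a b c ↦ X a b c - Y a b c) (fun a b c ↦ X' a b c - Y' a b c) :=
  fun i j k ↦ by simp only [hX i j k, hY i j k, mul_sub, Finset.sum_sub_distrib]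

lemma swap₁₂ (hX : Transforms₃ L₁ L₂ L₃ X X') :
    Transforms₃ L₂ L₁ L₃ (fun b a c ↦ X a b c) (fun b a c ↦ X' a b c) := fun i j k ↦ by
  beta_reduce
  rw [hX, Finset.sum_comm]
  exact Finset.sum_congr rfl fun a _ ↦ Finset.sum_congr rfl fun b _ ↦
    Finset.sum_congr rfl fun c _ ↦ by ring

lemma swap₂₃ (hX : Transforms₃ L₁ L₂ L₃ X X') :
    Transforms₃ L₁ L₃ L₂ (fun a c b ↦ X a b c) (fun a c b ↦ X' a b c) := fun i j k ↦ by
  beta_reduce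
  rw [hX]
  refine Finset.sum_congr rfl fun a _ ↦ ?_
  rw [Finset.sum_comm]
  exact Finset.sum_congr rfl fun b _ ↦ Finset.sum_congr rfl fun c _ ↦ by ring

/-- Contraction is natural when the two contracted slots transform by mutually inverse matrices,
which is the condition `hL`. -/
lemma contract {Z Z' : Fin n → Fin n → ℝ} (hY : Transforms₃ L₃ L₄ L₅ Y Y')
    (hZ : Transforms₂ L₁ L₂ Z Z') (hL : ∀ b c, ∑ l, L₂ l b * L₃ l c = if b = c then 1 else 0) :
    Transforms₃ L₁ L₄ L₅ (fun i j k ↦ ∑ l, Z i l * Y l j k) (fun i j k ↦ ∑ l, Z' i l * Y' l j k) :=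
  fun i j k ↦ by
  set W : Fin n → ℝ := fun b ↦ ∑ a, L₁ i a * Z a b with hW
  set V : Fin n → ℝ := fun c ↦ ∑ d, ∑ e, L₄ j d * L₅ k e * Y c d e with hV
  have h1 : ∀ l, Z' i l = ∑ b, W b * L₂ l b := fun l ↦ by
    rw [hZ, Finset.sum_comm]
    simp only [hW, Finset.sum_mul]
    exact Finset.sum_congr rfl fun b _ ↦ Finset.sum_congr rfl fun a _ ↦ by ring
  have h2 : ∀ l, Y' l j k = ∑ c, L₃ l c * V c := fun l ↦ by
    rw [hY]
    simp only [hV, Finset.mul_sum]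
    exact Finset.sum_congr rfl fun b _ ↦ Finset.sum_congr rfl fun a _ ↦
      Finset.sum_congr rfl fun c _ ↦ by ring
  have h3 : ∑ l, Z' i l * Y' l j k = ∑ b, W b * V b := by
    simp only [h1, h2, Finset.sum_mul_sum]
    rw [Finset.sum_comm]
    refine Finset.sum_congr rfl fun b _ ↦ ?_
    rw [Finset.sum_comm]
    have h4 : ∀ c, ∑ l, W b * L₂ l b * (L₃ l c * V c) = if b = c then W b * V c else 0 := by
      intro c
      have h5 := congrArg (fun r ↦ W b * V c * r) (hL b c)
      simp only [Finset.mul_sum, mul_ite, mul_one, mul_zero] at h5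
      rw [← h5]
      exact Finset.sum_congr rfl fun l _ ↦ by ring
    simp [h4]
  beta_reduce
  rw [h3]
  simp only [hW, Finset.sum_mul]
  rw [Finset.sum_comm]
  refine Finset.sum_congr rfl fun a _ ↦ ?_
  simp only [hV, Finset.mul_sum]
  rw [Finset.sum_comm]
  refine Finset.sum_congr rfl fun d _ ↦ ?_
  rw [Finset.sum_comm]
  exact Finset.sum_congr rfl fun e _ ↦ Finset.sum_congr rfl fun b _ ↦ by ring

end Transforms₃

lemma sum_fin_succ_fun {m : ℕ} (f : (Fin (m + 1) → Fin n) → ℝ) :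
    ∑ a, f a = ∑ x, ∑ b : Fin m → Fin n, f (Fin.cons x b) := by
  rw [← (Fin.consEquiv fun _ ↦ Fin n).sum_comp, Fintype.sum_prod_type]
  rfl

/-- Translation between explicit triple sums and the sums over multi-indices in `IsMTensor`. Lower
slots use the transposed matrix, since there the old index comes first. -/
lemma Transforms₃.sum_pi_two_one {J K : Fin n → Fin n → ℝ} {X X' : Fin n → Fin n → Fin n → ℝ}
    (h : Transforms₃ J J (fun i b ↦ K b i) X X') (up : Fin 2 → Fin n) (lo : Fin 1 → Fin n) :
    X' (up 0) (up 1) (lo 0) = ∑ a : Fin 2 → Fin n, ∑ b : Fin 1 → Fin n,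
      (∏ k, J (up k) (a k)) * (∏ k, K (b k) (lo k)) * X (a 0) (a 1) (b 0) := by
  rw [h]
  simp [sum_fin_succ_fun]

lemma Transforms₃.sum_pi_zero_three {J K : Fin n → Fin n → ℝ} {X X' : Fin n → Fin n → Fin n → ℝ}
    (h : Transforms₃ (fun i b ↦ K b i) (fun i b ↦ K b i) (fun i b ↦ K b i) X X')
    (up : Fin 0 → Fin n) (lo : Fin 3 → Fin n) :
    X' (lo 0) (lo 1) (lo 2) = ∑ a : Fin 0 → Fin n, ∑ b : Fin 3 → Fin n,
      (∏ k, J (up k) (a k)) * (∏ k, K (b k) (lo k)) * X (b 0) (b 1) (b 2) := by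
  rw [h]
  simp [sum_fin_succ_fun, Fin.prod_univ_three]
  rfl

end Transforms

/-! ### Transformation laws of the ingredients of the lift and of `Q`, `P`, `S`. -/

section Law

section

variable {n : ℕ} {M : Type*} [TopologicalSpace M] [ChartedSpace (EuclideanSpace ℝ (Fin n)) M]
  {φ ψ : OpenPartialHomeomorph M (EuclideanSpace ℝ (Fin n))} {x : M}
  (hφ : φ ∈ IsManifold.maximalAtlas (𝓡 n) ∞ M) (hψ : ψ ∈ IsManifold.maximalAtlas (𝓡 n) ∞ M)
  (hx : x ∈ φ.source) (hx' : x ∈ ψ.source)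

include hφ hψ hx hx'

lemma kron_transforms :
    Transforms₂ (jacobian φ ψ x) (fun i b ↦ jacobian ψ φ x b i) kron kron :=
  kron_change hφ hψ hx hx'

lemma sum_jacobian_mul_transpose (b c : Fin n) :
    ∑ l, jacobian φ ψ x l b * jacobian ψ φ x c l = if b = c then 1 else 0 := by
  rw [Finset.sum_congr rfl fun l _ ↦ mul_comm _ _, sum_jacobian_mul hψ hφ hx' hx]
  simp only [eq_comm]

end

variable {n : ℕ} {M : Type*} [TopologicalSpace M] [ChartedSpace (EuclideanSpace ℝ (Fin n)) M]
  [IsManifold (𝓡 n) ∞ M]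
  (g : ContMDiffRiemannianMetric (𝓡 n) ∞ (EuclideanSpace ℝ (Fin n))
      (fun x : M ↦ TangentSpace (𝓡 n) x))
  {φ ψ : OpenPartialHomeomorph M (EuclideanSpace ℝ (Fin n))} {p : CotangentBundle n M}
  (hφ : φ ∈ IsManifold.maximalAtlas (𝓡 n) ∞ M) (hψ : ψ ∈ IsManifold.maximalAtlas (𝓡 n) ∞ M)
  (hp : p.proj ∈ φ.source) (hp' : p.proj ∈ ψ.source)

include hφ hψ hp hp'

/-- The change formula expresses the old momenta through the new ones, so it is used with the two
charts exchanged. -/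
lemma mom_transforms :
    Transforms₁ (fun i b ↦ jacobian ψ φ p.proj b i) (mom φ p) (mom ψ p) :=
  mom_change hψ hφ hp' hp

lemma pUp_transforms : Transforms₁ (jacobian φ ψ p.proj) (pUp g φ p) (pUp g ψ p) :=
  pUp_change g hφ hψ hp hp'

lemma gLow_transforms :
    Transforms₂ (fun i b ↦ jacobian ψ φ p.proj b i) (fun i b ↦ jacobian ψ φ p.proj b i)
      (gLow g φ p) (gLow g ψ p) :=
  gLow_change g hψ hφ hp' hp

lemma gUp_transforms :
    Transforms₂ (jacobian φ ψ p.proj) (jacobian φ ψ p.proj) (gUp g φ p) (gUp g ψ p) :=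
  gUp_change g hφ hψ hp hp'

lemma R0_transforms :
    Transforms₃ (fun i b ↦ jacobian ψ φ p.proj b i) (fun i b ↦ jacobian ψ φ p.proj b i)
      (fun i b ↦ jacobian ψ φ p.proj b i) (R0 g φ p) (R0 g ψ p) :=
  R0_change g hψ hφ hp' hp

variable (C : Coefficients)

lemma G2_transforms :
    Transforms₂ (jacobian φ ψ p.proj) (jacobian φ ψ p.proj) (G2 g φ C p) (G2 g ψ C p) :=
  G2_change g C hφ hψ hp hp'

lemma H1_transforms :
    Transforms₂ (jacobian φ ψ p.proj) (jacobian φ ψ p.proj) (H1 g φ C p) (H1 g ψ C p) := by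
  have h := pUp_transforms g hφ hψ hp hp'
  intro i j
  simpa [H1, energy_change g hφ hψ hp hp', mul_assoc, sub_eq_add_neg] using
    (((gUp_transforms g hφ hψ hp hp').const_mul (1 / C.c₁ (energy g φ p))).add
      ((h.mul h).const_mul (-(C.d₁ (energy g φ p) / (C.c₁ (energy g φ p) *
        (C.c₁ (energy g φ p) + 2 * energy g φ p * C.d₁ (energy g φ p))))))) i j

lemma H2_transforms :
    Transforms₂ (fun i b ↦ jacobian ψ φ p.proj b i) (fun i b ↦ jacobian ψ φ p.proj b i)
      (H2 g φ C p) (H2 g ψ C p) := by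
  have h := mom_transforms hφ hψ hp hp'
  intro i j
  simpa [H2, energy_change g hφ hψ hp hp', mul_assoc, sub_eq_add_neg] using
    (((gLow_transforms g hφ hψ hp hp').const_mul (1 / C.c₂ (energy g φ p))).add
      ((h.mul h).const_mul (-(C.d₂ (energy g φ p) / (C.c₂ (energy g φ p) *
        (C.c₂ (energy g φ p) + 2 * energy g φ p * C.d₂ (energy g φ p))))))) i j

/-- The closed formula for the derivative is a sum of products of tensors with functions of the
invariant `t`, so the frame `∂ⁱ` itself need not be transformed. -/
lemma pDeriv_G1_transforms (hc₁ : ContDiffOn ℝ ∞ C.c₁ (Ici 0))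
    (hd₁ : ContDiffOn ℝ ∞ C.d₁ (Ici 0)) :
    Transforms₃ (jacobian φ ψ p.proj) (fun i b ↦ jacobian ψ φ p.proj b i)
      (fun i b ↦ jacobian ψ φ p.proj b i)
      (fun i j k ↦ pDeriv φ (fun q ↦ G1 g φ C q j k) i p)
      (fun i j k ↦ pDeriv ψ (fun q ↦ G1 g ψ C q j k) i p) := by
  have h := mom_transforms hφ hψ hp hp'
  have hU := pUp_transforms g hφ hψ hp hp'
  have hk := kron_transforms hφ hψ hp hp'
  simp only [pDeriv_G1 g C hφ hp hc₁ hd₁, pDeriv_G1 g C hψ hp' hc₁ hd₁,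
    energy_change g hφ hψ hp hp']
  intro i j k
  simpa [mul_assoc, mul_comm, mul_left_comm] using
    ((((hU.mul₂ (gLow_transforms g hφ hψ hp hp')).const_mul (tDeriv C.c₁ (energy g φ p))).add
      ((hU.mul₂ (h.mul h)).const_mul (tDeriv C.d₁ (energy g φ p)))).add
      (((h.mul₂ hk).swap₁₂.swap₂₃.add (h.mul₂ hk).swap₁₂).const_mul
        (C.d₁ (energy g φ p)))) i j k

lemma pDeriv_G2_transforms (hc₂ : ContDiffOn ℝ ∞ C.c₂ (Ici 0))
    (hd₂ : ContDiffOn ℝ ∞ C.d₂ (Ici 0)) :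
    Transforms₃ (jacobian φ ψ p.proj) (jacobian φ ψ p.proj) (jacobian φ ψ p.proj)
      (fun i j k ↦ pDeriv φ (fun q ↦ G2 g φ C q j k) i p)
      (fun i j k ↦ pDeriv ψ (fun q ↦ G2 g ψ C q j k) i p) := by
  have hU := pUp_transforms g hφ hψ hp hp'
  have hg := gUp_transforms g hφ hψ hp hp'
  simp only [pDeriv_G2 g C hφ hp hc₂ hd₂, pDeriv_G2 g C hψ hp' hc₂ hd₂,
    energy_change g hφ hψ hp hp']
  intro i j k
  simpa [mul_assoc, mul_comm, mul_left_comm] using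
    ((((hU.mul₂ hg).const_mul (tDeriv C.c₂ (energy g φ p))).add
      ((hU.mul₂ (hU.mul hU)).const_mul (tDeriv C.d₂ (energy g φ p)))).add
      (((hU.mul₂ hg).swap₁₂.swap₂₃.add (hU.mul₂ hg).swap₁₂).const_mul
        (C.d₂ (energy g φ p)))) i j k

lemma Q_transforms (hc₂ : ContDiffOn ℝ ∞ C.c₂ (Ici 0)) (hd₂ : ContDiffOn ℝ ∞ C.d₂ (Ici 0)) :
    Transforms₃ (jacobian φ ψ p.proj) (jacobian φ ψ p.proj)
      (fun i b ↦ jacobian ψ φ p.proj b i) (Q g φ C p) (Q g ψ C p) := by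
  have hd := pDeriv_G2_transforms g hφ hψ hp hp' C hc₂ hd₂
  -- The permutations bring the three derivatives to slot order `k, i, j`, so that `k` can be
  -- contracted with `H⁽²⁾`; the last two swaps move `h` to the end.
  exact (((hd.swap₂₃.swap₁₂.add hd.swap₁₂.swap₂₃.swap₁₂).sub hd).contract
    (H2_transforms g hφ hψ hp hp' C) (sum_jacobian_mul hψ hφ hp' hp)
      |>.swap₁₂.swap₂₃).const_mul (1 / 2)

lemma P_transforms (hc₁ : ContDiffOn ℝ ∞ C.c₁ (Ici 0)) (hd₁ : ContDiffOn ℝ ∞ C.d₁ (Ici 0)) :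
    Transforms₃ (jacobian φ ψ p.proj) (jacobian φ ψ p.proj)
      (fun i b ↦ jacobian ψ φ p.proj b i) (P g φ C p) (P g ψ C p) := by
  have hd := pDeriv_G1_transforms g hφ hψ hp hp' C hc₁ hd₁
  have hR := (R0_transforms g hφ hψ hp hp').contract (G2_transforms g hφ hψ hp hp' C)
    (sum_jacobian_mul_transpose hφ hψ hp hp')
  exact ((hd.sub hR).swap₂₃.swap₁₂.contract (H1_transforms g hφ hψ hp hp' C)
    (sum_jacobian_mul_transpose hφ hψ hp hp')).const_mul (1 / 2)

lemma S_transforms (hc₁ : ContDiffOn ℝ ∞ C.c₁ (Ici 0)) (hd₁ : ContDiffOn ℝ ∞ C.d₁ (Ici 0)) :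
    Transforms₃ (fun i b ↦ jacobian ψ φ p.proj b i) (fun i b ↦ jacobian ψ φ p.proj b i)
      (fun i b ↦ jacobian ψ φ p.proj b i) (S g φ C p) (S g ψ C p) :=
  (((pDeriv_G1_transforms g hφ hψ hp hp' C hc₁ hd₁).contract
    (H2_transforms g hφ hψ hp hp' C) (sum_jacobian_mul hψ hφ hp' hp)).const_mul (-(1 / 2))).add
    ((R0_transforms g hφ hψ hp hp').const_mul (1 / 2))

end Law

/-! ### Smoothness of the components -/

section Smooth

variable {n : ℕ} {M : Type*} [TopologicalSpace M] [ChartedSpace (EuclideanSpace ℝ (Fin n)) M]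
  [IsManifold (𝓡 n) ∞ M]
  (g : ContMDiffRiemannianMetric (𝓡 n) ∞ (EuclideanSpace ℝ (Fin n))
      (fun x : M ↦ TangentSpace (𝓡 n) x))
  {φ : OpenPartialHomeomorph M (EuclideanSpace ℝ (Fin n))}

/-- One-sided derivatives are unique on `[0, ∞)`, so smoothness passes to `tDeriv`, including at
`0`. -/
lemma contDiffOn_tDeriv {f : ℝ → ℝ} (hf : ContDiffOn ℝ ∞ f (Ici 0)) :
    ContDiffOn ℝ ∞ (tDeriv f) (Ici 0) :=
  hf.derivWithin (uniqueDiffOn_Ici 0) (by simp)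

variable (φ) in
/-- The function `f` on the cotangent bundle is smooth on the domain of the chart induced by `φ`. -/
def SmoothOver (f : CotangentBundle n M → ℝ) : Prop :=
  ContMDiffOn (cotangentModel n) 𝓘(ℝ, ℝ) ∞ f {p | p.proj ∈ φ.source}

namespace SmoothOver

variable {f f' : CotangentBundle n M → ℝ}

lemma add (hf : SmoothOver φ f) (hf' : SmoothOver φ f') : SmoothOver φ (fun p ↦ f p + f' p) :=
  ContMDiffOn.add hf hf'

lemma sub (hf : SmoothOver φ f) (hf' : SmoothOver φ f') : SmoothOver φ (fun p ↦ f p - f' p) :=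
  ContMDiffOn.sub hf hf'

lemma mul (hf : SmoothOver φ f) (hf' : SmoothOver φ f') : SmoothOver φ (fun p ↦ f p * f' p) :=
  ContMDiffOn.mul hf hf'

lemma const (r : ℝ) : SmoothOver φ (fun _ : CotangentBundle n M ↦ r) :=
  contMDiffOn_const

lemma div (hf : SmoothOver φ f) (hf' : SmoothOver φ f') (h : ∀ p, p.proj ∈ φ.source → f' p ≠ 0) :
    SmoothOver φ (fun p ↦ f p / f' p) :=
  ContMDiffOn.div₀ hf hf' h

lemma sum {F : Fin n → CotangentBundle n M → ℝ} (h : ∀ i, SmoothOver φ (F i)) :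
    SmoothOver φ (fun p ↦ ∑ i, F i p) :=
  contMDiffOn_finsetSum fun i _ ↦ h i

lemma congr (hf : SmoothOver φ f) (h : ∀ p, p.proj ∈ φ.source → f' p = f p) : SmoothOver φ f' :=
  ContMDiffOn.congr hf h

end SmoothOver

variable (hφ : φ ∈ IsManifold.maximalAtlas (𝓡 n) ∞ M)

include hφ

lemma smoothOver_comp_inducedChart {f : EuclideanSpace ℝ (Fin n) × EuclideanSpace ℝ (Fin n) → ℝ}
    (hf : ∀ z, z.1 ∈ φ.target → ContDiffAt ℝ ∞ f z) :
    SmoothOver φ (fun p ↦ f (inducedChart φ p)) := fun p hp ↦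
  ((hf _ (φ.map_source hp)).contMDiffAt.comp p
    (contMDiffAt_inducedChart hφ hp)).contMDiffWithinAt

lemma smoothOver_mom (i : Fin n) : SmoothOver φ (fun p ↦ mom φ p i) :=
  smoothOver_comp_inducedChart hφ (f := fun z ↦ z.2 i) fun _ _ ↦
    ((EuclideanSpace.proj i : EuclideanSpace ℝ (Fin n) →L[ℝ] ℝ).contDiff.comp
      contDiff_snd).contDiffAt

lemma smoothOver_base {f : EuclideanSpace ℝ (Fin n) → ℝ}
    (hf : ∀ y ∈ φ.target, ContDiffAt ℝ ∞ f y) :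
    SmoothOver φ (fun p : CotangentBundle n M ↦ f (φ p.proj)) :=
  smoothOver_comp_inducedChart hφ (f := fun z ↦ f z.1) fun z hz ↦
    (hf _ hz).comp z contDiffAt_fst

lemma smoothOver_gLow (i j : Fin n) : SmoothOver φ (fun p ↦ gLow g φ p i j) :=
  smoothOver_base hφ fun _ hy ↦ contMDiffAt_metricCoeff g hφ hy i j

lemma smoothOver_gUp (i j : Fin n) : SmoothOver φ (fun p ↦ gUp g φ p i j) :=
  smoothOver_base hφ fun _ hy ↦ contDiffAt_metricCoeff_inv g hφ hy i j

lemma smoothOver_R0 (k i j : Fin n) : SmoothOver φ (fun p ↦ R0 g φ p k i j) :=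
  .sum fun h ↦ (smoothOver_mom hφ h).mul
    (smoothOver_base hφ fun _ hy ↦ contDiffAt_curvature g hφ hy h k i j)

lemma smoothOver_pUp (i : Fin n) : SmoothOver φ (fun p ↦ pUp g φ p i) :=
  .sum fun h ↦ (smoothOver_mom hφ h).mul (smoothOver_gUp g hφ h i)

lemma smoothOver_energy : SmoothOver φ (energy g φ) :=
  .mul (.const _) (.sum fun i ↦ .sum fun k ↦
    ((smoothOver_gUp g hφ i k).mul (smoothOver_mom hφ i)).mul (smoothOver_mom hφ k))

/-- Smoothness of `f` on `[0, ∞)` is enough because `t` takes only nonnegative values. -/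
lemma smoothOver_comp_energy {f : ℝ → ℝ} (hf : ContDiffOn ℝ ∞ f (Ici 0)) :
    SmoothOver φ (fun p ↦ f (energy g φ p)) :=
  hf.contMDiffOn.comp (smoothOver_energy g hφ) fun _ hp ↦ energy_nonneg g hφ hp

variable (C : Coefficients)

lemma smoothOver_G2 (hc₂ : ContDiffOn ℝ ∞ C.c₂ (Ici 0)) (hd₂ : ContDiffOn ℝ ∞ C.d₂ (Ici 0))
    (i j : Fin n) : SmoothOver φ (fun p ↦ G2 g φ C p i j) :=
  ((smoothOver_comp_energy g hφ hc₂).mul (smoothOver_gUp g hφ i j)).add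
    (((smoothOver_comp_energy g hφ hd₂).mul (smoothOver_pUp g hφ i)).mul (smoothOver_pUp g hφ j))

/-- Smoothness is read off from the closed formula, which holds over the whole domain of the chart.
-/
lemma smoothOver_pDeriv_G1 (hc₁ : ContDiffOn ℝ ∞ C.c₁ (Ici 0))
    (hd₁ : ContDiffOn ℝ ∞ C.d₁ (Ici 0)) (i j k : Fin n) :
    SmoothOver φ (fun p ↦ pDeriv φ (fun q ↦ G1 g φ C q j k) i p) := by
  have hp := smoothOver_mom hφ
  have hU := smoothOver_pUp g hφ i
  refine .congr (.add (.add ?_ ?_) ?_) fun p hp ↦ pDeriv_G1 g C hφ hp hc₁ hd₁ i j k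
  · exact ((smoothOver_comp_energy g hφ (contDiffOn_tDeriv hc₁)).mul hU).mul
      (smoothOver_gLow g hφ j k)
  · exact (((smoothOver_comp_energy g hφ (contDiffOn_tDeriv hd₁)).mul hU).mul (hp j)).mul (hp k)
  · exact (smoothOver_comp_energy g hφ hd₁).mul
      (((SmoothOver.const _).mul (hp k)).add ((hp j).mul (.const _)))

lemma smoothOver_pDeriv_G2 (hc₂ : ContDiffOn ℝ ∞ C.c₂ (Ici 0))
    (hd₂ : ContDiffOn ℝ ∞ C.d₂ (Ici 0)) (i j k : Fin n) :
    SmoothOver φ (fun p ↦ pDeriv φ (fun q ↦ G2 g φ C q j k) i p) := by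
  have hg := smoothOver_gUp g hφ
  have hU := smoothOver_pUp g hφ
  refine .congr (.add (.add ?_ ?_) ?_) fun p hp ↦ pDeriv_G2 g C hφ hp hc₂ hd₂ i j k
  · exact ((smoothOver_comp_energy g hφ (contDiffOn_tDeriv hc₂)).mul (hU i)).mul (hg j k)
  · exact (((smoothOver_comp_energy g hφ (contDiffOn_tDeriv hd₂)).mul (hU i)).mul (hU j)).mul (hU k)
  · exact (smoothOver_comp_energy g hφ hd₂).mul
      (((hg i j).mul (hU k)).add ((hU j).mul (hg i k)))

variable (hc₁ : ContDiffOn ℝ ∞ C.c₁ (Ici 0)) (hc₂ : ContDiffOn ℝ ∞ C.c₂ (Ici 0))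
  (hd₁ : ContDiffOn ℝ ∞ C.d₁ (Ici 0)) (hd₂ : ContDiffOn ℝ ∞ C.d₂ (Ici 0))
  (hpos : ∀ t : ℝ, 0 ≤ t → 0 < C.c₁ t ∧ 0 < C.c₂ t ∧
      0 < C.c₁ t + 2 * t * C.d₁ t ∧ 0 < C.c₂ t + 2 * t * C.d₂ t)

include hpos

include hc₁ hd₁ in
lemma smoothOver_H1 (i j : Fin n) : SmoothOver φ (fun p ↦ H1 g φ C p i j) := by
  have hc := smoothOver_comp_energy g hφ hc₁
  have hd := smoothOver_comp_energy g hφ hd₁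
  have hpos' := fun (p : CotangentBundle n M) hp ↦ hpos _ (energy_nonneg g (p := p) hφ hp)
  refine (((SmoothOver.const 1).div hc fun p hp ↦ (hpos' p hp).1.ne').mul
    (smoothOver_gUp g hφ i j)).sub (((hd.div (hc.mul (hc.add
      (((SmoothOver.const 2).mul (smoothOver_energy g hφ)).mul hd))) fun p hp ↦ ?_).mul
        (smoothOver_pUp g hφ i)).mul (smoothOver_pUp g hφ j))
  exact (mul_pos (hpos' p hp).1 (hpos' p hp).2.2.1).ne'

include hc₂ hd₂ in
lemma smoothOver_H2 (i j : Fin n) : SmoothOver φ (fun p ↦ H2 g φ C p i j) := by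
  have hc := smoothOver_comp_energy g hφ hc₂
  have hd := smoothOver_comp_energy g hφ hd₂
  have hpos' := fun (p : CotangentBundle n M) hp ↦ hpos _ (energy_nonneg g (p := p) hφ hp)
  refine (((SmoothOver.const 1).div hc fun p hp ↦ (hpos' p hp).2.1.ne').mul
    (smoothOver_gLow g hφ i j)).sub (((hd.div (hc.mul (hc.add
      (((SmoothOver.const 2).mul (smoothOver_energy g hφ)).mul hd))) fun p hp ↦ ?_).mul
        (smoothOver_mom hφ i)).mul (smoothOver_mom hφ j))
  exact (mul_pos (hpos' p hp).2.1 (hpos' p hp).2.2.2).ne'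

include hc₂ hd₂ in
lemma smoothOver_Q (i j h : Fin n) : SmoothOver φ (fun p ↦ Q g φ C p i j h) := by
  have hd := smoothOver_pDeriv_G2 g hφ C hc₂ hd₂
  exact .mul (.const _) (.sum fun k ↦ (smoothOver_H2 g hφ C hc₂ hd₂ hpos h k).mul
    (((hd i j k).add (hd j i k)).sub (hd k i j)))

include hc₁ hc₂ hd₁ hd₂ in
lemma smoothOver_P (h i j : Fin n) : SmoothOver φ (fun p ↦ P g φ C p h i j) :=
  .mul (.const _) (.sum fun k ↦ (smoothOver_H1 g hφ C hc₁ hd₁ hpos h k).mul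
    ((smoothOver_pDeriv_G1 g hφ C hc₁ hd₁ i j k).sub (.sum fun l ↦
      (smoothOver_G2 g hφ C hc₂ hd₂ i l).mul (smoothOver_R0 g hφ l j k))))

include hc₁ hc₂ hd₁ hd₂ in
lemma smoothOver_S (h i j : Fin n) : SmoothOver φ (fun p ↦ S g φ C p h i j) :=
  .add (.mul (.const _) (.sum fun k ↦ (smoothOver_H2 g hφ C hc₂ hd₂ hpos h k).mul
    (smoothOver_pDeriv_G1 g hφ C hc₁ hd₁ k i j))) (.mul (.const _) (smoothOver_R0 g hφ h i j))

end Smooth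

/-! ### `Q`, `P` and `S` as `M`-tensor fields. -/

section MTensor

variable {n : ℕ} {M : Type*} [TopologicalSpace M] [ChartedSpace (EuclideanSpace ℝ (Fin n)) M]
  [IsManifold (𝓡 n) ∞ M]
  (g : ContMDiffRiemannianMetric (𝓡 n) ∞ (EuclideanSpace ℝ (Fin n))
      (fun x : M ↦ TangentSpace (𝓡 n) x)) (C : Coefficients)
  (hc₁ : ContDiffOn ℝ ∞ C.c₁ (Ici 0)) (hc₂ : ContDiffOn ℝ ∞ C.c₂ (Ici 0))
  (hd₁ : ContDiffOn ℝ ∞ C.d₁ (Ici 0)) (hd₂ : ContDiffOn ℝ ∞ C.d₂ (Ici 0))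
  (hpos : ∀ t : ℝ, 0 ≤ t → 0 < C.c₁ t ∧ 0 < C.c₂ t ∧
      0 < C.c₁ t + 2 * t * C.d₁ t ∧ 0 < C.c₂ t + 2 * t * C.d₂ t)

include hc₂ hd₂ hpos

lemma isMTensor_Q :
    IsMTensor 2 1 (fun φ (p : CotangentBundle n M) up lo ↦ Q g φ C p (up 0) (up 1) (lo 0)) :=
  ⟨fun _ hφ _ _ ↦ smoothOver_Q g hφ C hc₂ hd₂ hpos _ _ _, fun _ hφ _ hψ _ hp hp' ↦
    (Q_transforms g hφ hψ hp hp' C hc₂ hd₂).sum_pi_two_one⟩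

include hc₁ hd₁

lemma isMTensor_P :
    IsMTensor 2 1 (fun φ (p : CotangentBundle n M) up lo ↦ P g φ C p (up 0) (up 1) (lo 0)) :=
  ⟨fun _ hφ _ _ ↦ smoothOver_P g hφ C hc₁ hc₂ hd₁ hd₂ hpos _ _ _, fun _ hφ _ hψ _ hp hp' ↦
    (P_transforms g hφ hψ hp hp' C hc₁ hd₁).sum_pi_two_one⟩

lemma isMTensor_S :
    IsMTensor 0 3 (fun φ (p : CotangentBundle n M) _ lo ↦ S g φ C p (lo 0) (lo 1) (lo 2)) :=
  ⟨fun _ hφ _ _ ↦ smoothOver_S g hφ C hc₁ hc₂ hd₁ hd₂ hpos _ _ _, fun _ hφ _ hψ _ hp hp' ↦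
    (S_transforms g hφ hψ hp hp' C hc₁ hd₁).sum_pi_zero_three⟩

end MTensor

/-! ### Constant sectional curvature -/

section ConstantCurvature

variable {n : ℕ} {M : Type*} [TopologicalSpace M] [ChartedSpace (EuclideanSpace ℝ (Fin n)) M]
  [IsManifold (𝓡 n) ∞ M]
  (g : ContMDiffRiemannianMetric (𝓡 n) ∞ (EuclideanSpace ℝ (Fin n))
      (fun x : M ↦ TangentSpace (𝓡 n) x))
  {φ : OpenPartialHomeomorph M (EuclideanSpace ℝ (Fin n))} {y : EuclideanSpace ℝ (Fin n)}

lemma innerCoord_eq_metricMap (u v : Fin n → ℝ) :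
    innerCoord g φ y u v = metricMap g φ y (WithLp.toLp 2 u) (WithLp.toLp 2 v) := by
  simp only [innerCoord, metricMap, bilinOfCoeff_apply, smul_eq_mul]
  exact Finset.sum_congr rfl fun i _ ↦ Finset.sum_congr rfl fun j _ ↦ by ring

lemma curvatureMap_toLp (hφ : φ ∈ IsManifold.maximalAtlas (𝓡 n) ∞ M) (hy : y ∈ φ.target)
    (u v w : Fin n → ℝ) :
    curvatureMap (christoffelMap g φ) y (WithLp.toLp 2 u) (WithLp.toLp 2 v) (WithLp.toLp 2 w) =
      WithLp.toLp 2 fun h ↦ ∑ i, ∑ j, ∑ k, curvature g φ h k i j y * u i * v j * w k := by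
  ext h
  have key := curvatureMap_sum (christoffelMap g φ) y
    (EuclideanSpace.proj h : EuclideanSpace ℝ (Fin n) →L[ℝ] ℝ) u v w
  have hs : ∀ u : Fin n → ℝ, ∑ i, u i • stdVec i = WithLp.toLp 2 u := fun u ↦
    (eq_sum_stdVec (WithLp.toLp 2 u)).symm
  rw [hs, hs, hs] at key
  rw [Finset.sum_comm] at key
  refine key.trans (Finset.sum_congr rfl fun i _ ↦ ?_)
  rw [Finset.sum_comm]
  refine Finset.sum_congr rfl fun j _ ↦ Finset.sum_congr rfl fun k _ ↦ ?_
  rw [← curvatureMap_stdVec g hφ hy, PiLp.proj_apply]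
  ring

/-- Strict Cauchy–Schwarz: the nonzero vector `w = g(u,u) v - g(u,v) u` has square length `g(u,u)`
times the Gram determinant. -/
lemma gram_det_pos (hφ : φ ∈ IsManifold.maximalAtlas (𝓡 n) ∞ M) (hy : y ∈ φ.target)
    {u v : EuclideanSpace ℝ (Fin n)} (hu : u ≠ 0) (h : ∀ a : ℝ, a • u ≠ v) :
    0 < metricMap g φ y u u * metricMap g φ y v v - metricMap g φ y u v ^ 2 := by
  have h1 := metricMap_pos g hφ hy hu
  have hw : metricMap g φ y u u • v - metricMap g φ y u v • u ≠ 0 := fun hw ↦ by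
    refine h ((metricMap g φ y u u)⁻¹ * metricMap g φ y u v) ?_
    rw [mul_smul, ← sub_eq_zero.1 hw, smul_smul, inv_mul_cancel₀ h1.ne', one_smul]
  have h2 := metricMap_pos g hφ hy hw
  simp only [map_sub, map_smul, _root_.sub_apply, _root_.smul_apply, smul_eq_mul,
    metricMap_symm g v u] at h2
  refine pos_of_mul_pos_right (a := metricMap g φ y u u) ?_ h1.le
  linarith

variable {c : ℝ} (hc : HasConstantSectionalCurvature g c)
  (hφ : φ ∈ IsManifold.maximalAtlas (𝓡 n) ∞ M)

include hc hφ

/-- For independent vectors this is the hypothesis cleared of its denominator; for dependent ones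
both sides vanish. In dimension one the hypothesis is vacuous and only the second case occurs. -/
lemma metricMap_curvatureMap_of_constant (hy : y ∈ φ.target) (u v : EuclideanSpace ℝ (Fin n)) :
    metricMap g φ y (curvatureMap (christoffelMap g φ) y u v v) u =
      c * (metricMap g φ y u u * metricMap g φ y v v - metricMap g φ y u v ^ 2) := by
  have hself : ∀ w, curvatureMap (christoffelMap g φ) y u u w = 0 := fun w ↦ by
    simp only [curvatureMap, sub_self, zero_add]
  by_cases hu : u = 0
  · simp [hu]
  by_cases h : ∃ a : ℝ, a • u = v
  · obtain ⟨a, rfl⟩ := h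
    have h0 : curvatureMap (christoffelMap g φ) y u (a • u) (a • u) =
        a • curvatureMap (christoffelMap g φ) y u u (a • u) := by
      simp only [curvatureMap, map_smul, _root_.smul_apply, smul_sub, smul_add]
    rw [h0, hself]
    simp only [map_smul, _root_.smul_apply, smul_eq_mul, smul_zero, map_zero, _root_.zero_apply]
    ring
  · push Not at h
    have hpos := gram_det_pos g hφ hy hu h
    have hK := hc φ hφ y hy u v ((LinearIndependent.pair_iff' (by simpa using hu)).2
      fun a ha ↦ h a (WithLp.ofLp_injective 2 ha))
    rw [sectionalCurvature] at hK
    simp only [innerCoord_eq_metricMap, ← curvatureMap_toLp g hφ hy, WithLp.toLp_ofLp] at hK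
    rw [← hK, div_mul_cancel₀ _ hpos.ne']

/-- The identity `R(u,v)w = c (g(v,w) u - g(u,w) v)` on coordinate vectors, paired with `p`. -/
lemma R0_of_constant {p : CotangentBundle n M} (hp : p.proj ∈ φ.source) (k i j : Fin n) :
    R0 g φ p k i j = c * (gLow g φ p j k * mom φ p i - gLow g φ p i k * mom φ p j) := by
  have hy := φ.map_source hp
  rw [R0_eq g hφ hp, (isLocalMetric_metricMap g hφ).curvature_eq_of_sectional hy c
    (metricMap_curvatureMap_of_constant g hc hφ hy), map_smul, map_sub, map_smul, map_smul,
    momForm_stdVec, momForm_stdVec, gLow_eq, gLow_eq]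
  rfl

end ConstantCurvature

/-! ### Contractions with the inverse blocks, and the explicit coefficients. -/

section Contractions

/-- On the direction of `p` the form `a g + b p p` acts as multiplication by `a + 2tb`, so its
inverse divides by that number. -/
lemma rank_one_update_inv_apply {a b t : ℝ} (ha : a ≠ 0) (hD : a + 2 * t * b ≠ 0) (x : ℝ) :
    1 / a * x - b / (a * (a + 2 * t * b)) * (x * (2 * t)) = x / (a + 2 * t * b) := by
  obtain ⟨D, h⟩ : ∃ D, D = a + 2 * t * b := ⟨_, rfl⟩
  rw [← h] at hD ⊢
  field_simp
  linear_combination x * h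

variable {n : ℕ} {M : Type*} [TopologicalSpace M] [ChartedSpace (EuclideanSpace ℝ (Fin n)) M]
  [IsManifold (𝓡 n) ∞ M]
  (g : ContMDiffRiemannianMetric (𝓡 n) ∞ (EuclideanSpace ℝ (Fin n))
      (fun x : M ↦ TangentSpace (𝓡 n) x))
  {φ : OpenPartialHomeomorph M (EuclideanSpace ℝ (Fin n))} {p : CotangentBundle n M}
  (C : Coefficients)
  (hφ : φ ∈ IsManifold.maximalAtlas (𝓡 n) ∞ M) (hp : p.proj ∈ φ.source)

include hφ hp

lemma sum_H1_gLow (h j : Fin n) :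
    ∑ k, H1 g φ C p h k * gLow g φ p j k = 1 / C.c₁ (energy g φ p) * kron h j
      - C.d₁ (energy g φ p) / (C.c₁ (energy g φ p) *
        (C.c₁ (energy g φ p) + 2 * energy g φ p * C.d₁ (energy g φ p)))
          * pUp g φ p h * mom φ p j := by
  simp only [H1, sub_mul, Finset.sum_sub_distrib, mul_assoc, ← Finset.mul_sum]
  simp only [gLow_symm g p j, sum_gUp_gLow g hφ hp]
  simp only [← gLow_symm g p j, mul_comm (pUp g φ p _) (gLow g φ p _ _), sum_gLow_pUp g hφ hp]

lemma sum_H2_gUp (h j : Fin n) :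
    ∑ k, H2 g φ C p h k * gUp g φ p j k = 1 / C.c₂ (energy g φ p) * kron h j
      - C.d₂ (energy g φ p) / (C.c₂ (energy g φ p) *
        (C.c₂ (energy g φ p) + 2 * energy g φ p * C.d₂ (energy g φ p)))
          * mom φ p h * pUp g φ p j := by
  simp only [H2, sub_mul, Finset.sum_sub_distrib, mul_assoc, ← Finset.mul_sum]
  simp only [gUp_symm g p j, sum_gLow_gUp g hφ hp]
  rfl

lemma sum_G2_gLow (i k : Fin n) :
    ∑ l, G2 g φ C p i l * gLow g φ p k l =
      C.c₂ (energy g φ p) * kron i k + C.d₂ (energy g φ p) * pUp g φ p i * mom φ p k := by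
  simp only [G2, add_mul, Finset.sum_add_distrib, mul_assoc, ← Finset.mul_sum]
  simp only [gLow_symm g p k, sum_gUp_gLow g hφ hp]
  simp only [← gLow_symm g p k, mul_comm (pUp g φ p _) (gLow g φ p _ _), sum_gLow_pUp g hφ hp]

variable (hpos : ∀ t : ℝ, 0 ≤ t → 0 < C.c₁ t ∧ 0 < C.c₂ t ∧
      0 < C.c₁ t + 2 * t * C.d₁ t ∧ 0 < C.c₂ t + 2 * t * C.d₂ t)

include hpos

lemma sum_H1_mom (h : Fin n) :
    ∑ k, H1 g φ C p h k * mom φ p k =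
      pUp g φ p h / (C.c₁ (energy g φ p) + 2 * energy g φ p * C.d₁ (energy g φ p)) := by
  obtain ⟨h1, -, h2, -⟩ := hpos _ (energy_nonneg g hφ hp)
  have hk : ∀ k, H1 g φ C p h k * mom φ p k = 1 / C.c₁ (energy g φ p) *
      (gUp g φ p h k * mom φ p k) - C.d₁ (energy g φ p) / (C.c₁ (energy g φ p) *
        (C.c₁ (energy g φ p) + 2 * energy g φ p * C.d₁ (energy g φ p))) * pUp g φ p h *
          (pUp g φ p k * mom φ p k) := fun k ↦ by
    simp only [H1]
    ring
  simp only [hk, Finset.sum_sub_distrib, ← Finset.mul_sum, sum_gUp_mom, sum_pUp_mom]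
  rw [← rank_one_update_inv_apply h1.ne' h2.ne']
  ring

lemma sum_H2_pUp (h : Fin n) :
    ∑ k, H2 g φ C p h k * pUp g φ p k =
      mom φ p h / (C.c₂ (energy g φ p) + 2 * energy g φ p * C.d₂ (energy g φ p)) := by
  obtain ⟨-, h1, -, h2⟩ := hpos _ (energy_nonneg g hφ hp)
  have hk : ∀ k, H2 g φ C p h k * pUp g φ p k = 1 / C.c₂ (energy g φ p) *
      (gLow g φ p h k * pUp g φ p k) - C.d₂ (energy g φ p) / (C.c₂ (energy g φ p) *
        (C.c₂ (energy g φ p) + 2 * energy g φ p * C.d₂ (energy g φ p))) * mom φ p h *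
          (pUp g φ p k * mom φ p k) := fun k ↦ by
    simp only [H2]
    ring
  simp only [hk, Finset.sum_sub_distrib, ← Finset.mul_sum, sum_gLow_pUp g hφ hp, sum_pUp_mom]
  rw [← rank_one_update_inv_apply h1.ne' h2.ne']
  ring

omit hpos in
-- The derivatives are grouped by the factor carrying the summation index, so that only contractions
-- of `H⁽²⁾` with `g^{jk}` and with `g^{0k}` remain. The two mixed terms with `d₂` cancel and the
-- third doubles.
lemma Q_eq (hc₂ : ContDiffOn ℝ ∞ C.c₂ (Ici 0)) (hd₂ : ContDiffOn ℝ ∞ C.d₂ (Ici 0))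
    (i j h : Fin n) :
    Q g φ C p i j h =
      1 / 2 * (tDeriv C.c₂ (energy g φ p) * pUp g φ p i * ∑ k, H2 g φ C p h k * gUp g φ p j k
        + tDeriv C.c₂ (energy g φ p) * pUp g φ p j * ∑ k, H2 g φ C p h k * gUp g φ p i k
        + (tDeriv C.d₂ (energy g φ p) * pUp g φ p i * pUp g φ p j
          + (2 * C.d₂ (energy g φ p) - tDeriv C.c₂ (energy g φ p)) * gUp g φ p i j)
            * ∑ k, H2 g φ C p h k * pUp g φ p k) := by
  simp only [Q, pDeriv_G2 g C hφ hp hc₂ hd₂, Finset.mul_sum, ← Finset.sum_add_distrib]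
  refine Finset.sum_congr rfl fun k _ ↦ ?_
  rw [gUp_symm g p j i, gUp_symm g p k i, gUp_symm g p k j]
  ring

lemma Q_formula (hc₂ : ContDiffOn ℝ ∞ C.c₂ (Ici 0)) (hd₂ : ContDiffOn ℝ ∞ C.d₂ (Ici 0))
    (i j h : Fin n) :
    Q g φ C p i j h =
      -((tDeriv C.c₂ (energy g φ p) - 2 * C.d₂ (energy g φ p))
          / (2 * (C.c₂ (energy g φ p) + 2 * C.d₂ (energy g φ p) * energy g φ p)))
          * gUp g φ p i j * mom φ p h
        + tDeriv C.c₂ (energy g φ p) / (2 * C.c₂ (energy g φ p))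
          * (kron h j * pUp g φ p i + kron h i * pUp g φ p j)
        + (-2 * tDeriv C.c₂ (energy g φ p) * C.d₂ (energy g φ p)
            + C.c₂ (energy g φ p) * tDeriv C.d₂ (energy g φ p))
          / (2 * C.c₂ (energy g φ p) *
            (C.c₂ (energy g φ p) + 2 * C.d₂ (energy g φ p) * energy g φ p))
          * mom φ p h * pUp g φ p i * pUp g φ p j := by
  obtain ⟨-, h1, -, h2⟩ := hpos _ (energy_nonneg g hφ hp)
  rw [Q_eq g C hφ hp hc₂ hd₂, sum_H2_gUp g C hφ hp, sum_H2_gUp g C hφ hp,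
    sum_H2_pUp g C hφ hp hpos, mul_right_comm 2 (C.d₂ _) (energy g φ p)]
  -- After the contractions the formula is an identity in which this denominator can be an
  -- independent nonzero quantity.
  generalize C.c₂ (energy g φ p) + 2 * energy g φ p * C.d₂ (energy g φ p) = D at h2 ⊢
  have h1' := h1.ne'
  have h2' := h2.ne'
  field_simp
  ring

variable {c : ℝ} (hc : HasConstantSectionalCurvature g c)

include hc

lemma P_formula (hc₁ : ContDiffOn ℝ ∞ C.c₁ (Ici 0)) (hd₁ : ContDiffOn ℝ ∞ C.d₁ (Ici 0))
    (h i j : Fin n) :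
    P g φ C p h i j =
      -((c * C.c₂ (energy g φ p) - C.d₁ (energy g φ p)) / (2 * C.c₁ (energy g φ p)))
          * gUp g φ p h i * mom φ p j
        + (c * C.c₂ (energy g φ p) + C.d₁ (energy g φ p))
          / (2 * (C.c₁ (energy g φ p) + 2 * C.d₁ (energy g φ p) * energy g φ p))
          * kron i j * pUp g φ p h
        + tDeriv C.c₁ (energy g φ p) / (2 * C.c₁ (energy g φ p)) * kron h j * pUp g φ p i
        + (-tDeriv C.c₁ (energy g φ p) * C.d₁ (energy g φ p)
            + c * C.c₂ (energy g φ p) * C.d₁ (energy g φ p) - C.d₁ (energy g φ p) ^ 2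
            + C.c₁ (energy g φ p) * tDeriv C.d₁ (energy g φ p))
          / (2 * C.c₁ (energy g φ p) *
            (C.c₁ (energy g φ p) + 2 * C.d₁ (energy g φ p) * energy g φ p))
          * mom φ p j * pUp g φ p h * pUp g φ p i := by
  obtain ⟨h1, -, h2, -⟩ := hpos _ (energy_nonneg g hφ hp)
  -- The contributions of `d₂` cancel because the curvature is skew in `j`, `k`; this is why `d₂`
  -- does not appear in `P`.
  have hR : ∀ k, ∑ l, G2 g φ C p i l * R0 g φ p l j k =
      c * C.c₂ (energy g φ p) * (mom φ p j * kron i k - kron i j * mom φ p k) := fun k ↦ by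
    simp only [R0_of_constant g hc hφ hp, mul_sub, Finset.sum_sub_distrib, mul_left_comm _ c,
      ← Finset.mul_sum, ← mul_assoc (G2 g φ C p i _), ← Finset.sum_mul, sum_G2_gLow g C hφ hp]
    ring
  have hP : P g φ C p h i j = 1 / 2 * (tDeriv C.c₁ (energy g φ p) * pUp g φ p i
        * ∑ k, H1 g φ C p h k * gLow g φ p j k
      + (tDeriv C.d₁ (energy g φ p) * pUp g φ p i * mom φ p j
        + (C.d₁ (energy g φ p) + c * C.c₂ (energy g φ p)) * kron i j)
          * ∑ k, H1 g φ C p h k * mom φ p k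
      + (C.d₁ (energy g φ p) - c * C.c₂ (energy g φ p)) * mom φ p j
          * ∑ k, H1 g φ C p h k * kron i k) := by
    simp only [P, pDeriv_G1 g C hφ hp hc₁ hd₁, hR, Finset.mul_sum, ← Finset.sum_add_distrib]
    exact Finset.sum_congr rfl fun k _ ↦ by ring
  rw [hP, sum_H1_gLow g C hφ hp, sum_H1_mom g C hφ hp hpos, sum_mul_kron, H1,
    mul_right_comm 2 (C.d₁ _) (energy g φ p)]
  generalize C.c₁ (energy g φ p) + 2 * energy g φ p * C.d₁ (energy g φ p) = D at h2 ⊢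
  have h1' := h1.ne'
  have h2' := h2.ne'
  field_simp
  ring

lemma S_formula (hc₁ : ContDiffOn ℝ ∞ C.c₁ (Ici 0)) (hd₁ : ContDiffOn ℝ ∞ C.d₁ (Ici 0))
    (h i j : Fin n) :
    S g φ C p h i j =
      -tDeriv C.c₁ (energy g φ p)
          / (2 * (C.c₂ (energy g φ p) + 2 * C.d₂ (energy g φ p) * energy g φ p))
          * gLow g φ p i j * mom φ p h
        + (c * C.c₂ (energy g φ p) - C.d₁ (energy g φ p)) / (2 * C.c₂ (energy g φ p))
          * gLow g φ p h j * mom φ p i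
        - (c * C.c₂ (energy g φ p) + C.d₁ (energy g φ p)) / (2 * C.c₂ (energy g φ p))
          * gLow g φ p h i * mom φ p j
        - (C.c₂ (energy g φ p) * tDeriv C.d₁ (energy g φ p)
            - 2 * C.d₁ (energy g φ p) * C.d₂ (energy g φ p))
          / (2 * C.c₂ (energy g φ p) *
            (C.c₂ (energy g φ p) + 2 * C.d₂ (energy g φ p) * energy g φ p))
          * mom φ p h * mom φ p i * mom φ p j := by
  obtain ⟨-, h1, -, h2⟩ := hpos _ (energy_nonneg g hφ hp)
  have hS : ∑ k, H2 g φ C p h k * pDeriv φ (fun q ↦ G1 g φ C q i j) k p =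
      (tDeriv C.c₁ (energy g φ p) * gLow g φ p i j
        + tDeriv C.d₁ (energy g φ p) * mom φ p i * mom φ p j)
          * ∑ k, H2 g φ C p h k * pUp g φ p k
      + C.d₁ (energy g φ p) * mom φ p j * ∑ k, H2 g φ C p h k * kron i k
      + C.d₁ (energy g φ p) * mom φ p i * ∑ k, H2 g φ C p h k * kron j k := by
    simp only [pDeriv_G1 g C hφ hp hc₁ hd₁, Finset.mul_sum, ← Finset.sum_add_distrib]
    refine Finset.sum_congr rfl fun k _ ↦ ?_
    -- The summation index is put second in the Kronecker symbols, as in the sums on the right.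
    simp only [kron, eq_comm (a := k)]
    ring
  rw [S, hS, sum_H2_pUp g C hφ hp hpos, sum_mul_kron, sum_mul_kron, H2, H2,
    R0_of_constant g hc hφ hp, gLow_symm g p i h, gLow_symm g p j h,
    mul_right_comm 2 (C.d₂ _) (energy g φ p)]
  generalize C.c₂ (energy g φ p) + 2 * energy g φ p * C.d₂ (energy g φ p) = D at h2 ⊢
  have h1' := h1.ne'
  have h2' := h2.ne'
  field_simp
  ring

end Contractions

end

end CotangentLift

end

/-! ### The connection, the tensor property and the constant curvature formulas together. -/

theorem theorem8 {n : ℕ} {M : Type*} [TopologicalSpace M]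
    [ChartedSpace (EuclideanSpace ℝ (Fin n)) M] [IsManifold (𝓡 n) ∞ M]
    (g : ContMDiffRiemannianMetric (𝓡 n) ∞ (EuclideanSpace ℝ (Fin n))
      (fun x : M ↦ TangentSpace (𝓡 n) x))
    (C : CotangentLift.Coefficients)
    (hc₁ : ContDiffOn ℝ ∞ C.c₁ (Ici 0)) (hc₂ : ContDiffOn ℝ ∞ C.c₂ (Ici 0))
    (hd₁ : ContDiffOn ℝ ∞ C.d₁ (Ici 0)) (hd₂ : ContDiffOn ℝ ∞ C.d₂ (Ici 0))
    (hpos : ∀ t : ℝ, 0 ≤ t → 0 < C.c₁ t ∧ 0 < C.c₂ t ∧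
      0 < C.c₁ t + 2 * t * C.d₁ t ∧ 0 < C.c₂ t + 2 * t * C.d₂ t) :
    -- the Levi-Civita connection in the adapted frame
    (∀ nabla : CovariantDerivative (CotangentLift.cotangentModel n)
        (CotangentLift.CotangentModel n)
        (TangentSpace (CotangentLift.cotangentModel n) :
          CotangentLift.CotangentBundle n M → Type _),
      CotangentLift.IsLeviCivita (CotangentLift.naturalLift g C) nabla →
      ∀ φ ∈ IsManifold.maximalAtlas (𝓡 n) ∞ M,
      ∀ p : CotangentLift.CotangentBundle n M, p.proj ∈ φ.source → ∀ i j : Fin n,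
        nabla (CotangentLift.dP φ j) p (CotangentLift.dP φ i p)
          = ∑ h, CotangentLift.Q g φ C p i j h • CotangentLift.dP φ h p ∧
        nabla (CotangentLift.dP φ j) p (CotangentLift.delta g φ i p)
          = -(∑ h, CotangentLift.Gam g φ p j i h • CotangentLift.dP φ h p)
            + ∑ h, CotangentLift.P g φ C p h j i • CotangentLift.delta g φ h p ∧
        nabla (CotangentLift.delta g φ j) p (CotangentLift.dP φ i p)
          = ∑ h, CotangentLift.P g φ C p h i j • CotangentLift.delta g φ h p ∧
        nabla (CotangentLift.delta g φ j) p (CotangentLift.delta g φ i p)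
          = (∑ h, CotangentLift.Gam g φ p h i j • CotangentLift.delta g φ h p)
            + ∑ h, CotangentLift.S g φ C p h i j • CotangentLift.dP φ h p) ∧
    -- the coefficients are `M`-tensor fields
    CotangentLift.IsMTensor 2 1
      (fun φ (p : CotangentLift.CotangentBundle n M) up lo ↦
        CotangentLift.Q g φ C p (up 0) (up 1) (lo 0)) ∧
    CotangentLift.IsMTensor 2 1
      (fun φ (p : CotangentLift.CotangentBundle n M) up lo ↦
        CotangentLift.P g φ C p (up 0) (up 1) (lo 0)) ∧
    CotangentLift.IsMTensor 0 3
      (fun φ (p : CotangentLift.CotangentBundle n M) _ lo ↦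
        CotangentLift.S g φ C p (lo 0) (lo 1) (lo 2)) ∧
    -- their expressions when `(M, g)` has constant sectional curvature `c`
    ∀ c : ℝ, CotangentLift.HasConstantSectionalCurvature g c →
      ∀ φ ∈ IsManifold.maximalAtlas (𝓡 n) ∞ M,
      ∀ p : CotangentLift.CotangentBundle n M, p.proj ∈ φ.source → ∀ h i j : Fin n,
        let t := CotangentLift.energy g φ p
        let c₁ := C.c₁ t
        let c₂ := C.c₂ t
        let d₁ := C.d₁ t
        let d₂ := C.d₂ t
        let c₁' := CotangentLift.tDeriv C.c₁ t
        let c₂' := CotangentLift.tDeriv C.c₂ t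
        let d₁' := CotangentLift.tDeriv C.d₁ t
        let d₂' := CotangentLift.tDeriv C.d₂ t
        let δ : Fin n → Fin n → ℝ := CotangentLift.kron
        let gl := CotangentLift.gLow g φ p
        let gu := CotangentLift.gUp g φ p
        let g0 := CotangentLift.pUp g φ p
        let P' := CotangentLift.mom φ p
        CotangentLift.Q g φ C p i j h =
          -((c₂' - 2 * d₂) / (2 * (c₂ + 2 * d₂ * t))) * gu i j * P' h
            + c₂' / (2 * c₂) * (δ h j * g0 i + δ h i * g0 j)
            + (-2 * c₂' * d₂ + c₂ * d₂') / (2 * c₂ * (c₂ + 2 * d₂ * t)) * P' h * g0 i * g0 j ∧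
        CotangentLift.P g φ C p h i j =
          -((c * c₂ - d₁) / (2 * c₁)) * gu h i * P' j
            + (c * c₂ + d₁) / (2 * (c₁ + 2 * d₁ * t)) * δ i j * g0 h
            + c₁' / (2 * c₁) * δ h j * g0 i
            + (-c₁' * d₁ + c * c₂ * d₁ - d₁ ^ 2 + c₁ * d₁') / (2 * c₁ * (c₁ + 2 * d₁ * t))
              * P' j * g0 h * g0 i ∧
        CotangentLift.S g φ C p h i j =
          -c₁' / (2 * (c₂ + 2 * d₂ * t)) * gl i j * P' h
            + (c * c₂ - d₁) / (2 * c₂) * gl h j * P' i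
            - (c * c₂ + d₁) / (2 * c₂) * gl h i * P' j
            - (c₂ * d₁' - 2 * d₁ * d₂) / (2 * c₂ * (c₂ + 2 * d₂ * t))
              * P' h * P' i * P' j := by
  refine ⟨fun nabla hnabla φ hφ p hp i j ↦ ?_, CotangentLift.isMTensor_Q g C hc₂ hd₂ hpos,
    CotangentLift.isMTensor_P g C hc₁ hc₂ hd₁ hd₂ hpos,
    CotangentLift.isMTensor_S g C hc₁ hc₂ hd₁ hd₂ hpos, fun c hc φ hφ p hp h i j ↦ ?_⟩
  · have key := CotangentLift.leviCivita_adaptedFrame g C hφ hp hc₁ hc₂ hd₁ hd₂ hpos nabla hnabla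
    exact ⟨key (.inl i) (.inl j), key (.inr i) (.inl j), key (.inl i) (.inr j),
      key (.inr i) (.inr j)⟩
  · exact ⟨CotangentLift.Q_formula g C hφ hp hpos hc₂ hd₂ i j h,
      CotangentLift.P_formula g C hφ hp hpos hc hc₁ hd₁ h i j,
      CotangentLift.S_formula g C hφ hp hpos hc hc₁ hd₁ h i j⟩
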